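/- Let $\kappa\le\lambda=\lambda^{<\kappa}$ be cardinals with $\kappa$ (strongly) inaccessible. Conventions. Languages are sets of finitary relation and function symbols, and the size of a language is its number of symbols. For $\mu\in\{\omega_1,\kappa\}$ the logic $\mathcal L_{\mu,\mu}$ has $\mu$ many variables and allows conjunctions of fewer than $\mu$ formulas and quantification over fewer than $\mu$ variables at once. An $\mathcal L_{\mu,\mu}$-theory is a set of sentences. An $\mathcal L_{\mu,\mu}$-type is a set $p$ of formulas whose free variables all lie in one set of fewer than $\mu$ variables; a (nonempty) structure omits $p$ if no assignment in it satisfies all formulas of $p$. A club in $P_\kappa X=\{x\subseteq X: |x|<\kappa\}$ is a subset that is cofinal under inclusion and closed under unions of nonempty increasing sequences of length $<\kappa$. Say that *compactness with omission holds for $(T,p)$* if the following is true: if there is a club $C$ in $P_\kappa(T\cup p)$ such that for every $x\in C$ there is a model of $x\cap T$ that omits $x\cap p$, then there is a model of $T$ that omits $p$. Say that *$\kappa$-$\mathcal L_{\mu,\mu}$-compactness with type omission holds for languages of size $\lambda$* if compactness with omission holds for $(T,p)$ for every language of size $\lambda$, every $\mathcal L_{\mu,\mu}$-theory $T$ and every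 $\mathcal L_{\mu,\mu}$-type $p$ in it. $\mathrm{ZFC}^-$ is ZFC without power set, with the collection scheme and the well-ordering principle. For a transitive set $M$ with $\kappa\in M$, let $(\ast)_M$ be the statement: there are a transitive set $N$ and an elementary embedding $j:(M,\in)\to(N,\in)$ with critical point $\kappa$ such that $j''M=\{j(x):x\in M\}\in N$. Theorem. The following are equivalent: 1. $(\ast)_M$ holds for every transitive model $M$ of $\mathrm{ZFC}^-$ of cardinality $\lambda$ with $\kappa\in M$ and ${}^{<\kappa}M\subseteq M$ (every function from an ordinal $<\kappa$ to $M$ belongs to $M$). 1'. $(\ast)_M$ holds for every transitive set $M$ of cardinality $\lambda$ with $\kappa\in M$ such that every subset of $M$ of cardinality $<\kappa$ belongs to $M$. 2. $\kappa$-$\mathcal L_{\kappa,\kappa}$-compactness with type omission holds for languages of size $\lambda$. 3. $\kappa$-$\mathcal L_{\omega_1,\omega_1}$-compactness with type omission holds for languages of size $\lambda$. 3'. For every language of size $\lambda$ with a distinguished binary relation symbol $E$, every first-order theory $T_0$ and every set $p(x)$ of first-order formulas in a single free variable $x$ in that language, compactness with omission holds for $(T,p)$, where $T=T_0\cup\{\sigma_E\}$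 and $\sigma_E$ is the $\mathcal L_{\omega_1,\omega_1}$-sentence $\neg\exists x_0x_1x_2\cdots\bigwedge_{n<\omega}E(x_{n+1},x_n)$ asserting that $E$ is well founded. -/

import Mathlib

open FirstOrder Cardinal

universe u

namespace TypeOmission

section Logic

/-- A fixed set of `μ` many variables. -/
abbrev Var (μ : Cardinal.{u}) : Type u := μ.out

/-- Formulas of the infinitary logic `L_{μ,μ}` over the (finitary) language `L`: besides the
first-order constructions there are conjunctions of fewer than `μ` formulas (indexed by a set of
variables, used merely as an index set) and universal quantification over
a set of fewer than `μ` variables at once. Disjunctions and existential quantifiers are obtained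
by negation. -/
inductive InfFormula (L : FirstOrder.Language.{u, u}) (μ : Cardinal.{u}) : Type u
  | equal (s t : L.Term (Var μ)) : InfFormula L μ
  | rel {n : ℕ} (R : L.Relations n) (ts : Fin n → L.Term (Var μ)) : InfFormula L μ
  | neg (φ : InfFormula L μ) : InfFormula L μ
  | conj (S : Set (Var μ)) (hS : #S < μ) (φ : S → InfFormula L μ) : InfFormula L μ
  | all (V : Set (Var μ)) (hV : #V < μ) (φ : InfFormula L μ) : InfFormula L μ

namespace InfFormula

variable {L : FirstOrder.Language.{u, u}} {μ : Cardinal.{u}}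

/-- Satisfaction of a formula under an assignment `v` of the variables. -/
def Realize {A : Type u} [L.Structure A] : InfFormula L μ → (Var μ → A) → Prop
  | equal s t, v => s.realize v = t.realize v
  | rel R ts, v => FirstOrder.Language.Structure.RelMap R fun i => (ts i).realize v
  | neg φ, v => ¬ φ.Realize v
  | conj _ _ φ, v => ∀ i, (φ i).Realize v
  | all V _ φ, v => ∀ w : Var μ → A, (∀ x, x ∉ V → w x = v x) → φ.Realize w

open Classical in
/-- The set of free variables of a formula. -/
noncomputable def freeVars : InfFormula L μ → Set (Var μ)
  | equal s t => (s.varFinset : Set (Var μ)) ∪ t.varFinset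
  | rel _ ts => ⋃ i, ((ts i).varFinset : Set (Var μ))
  | neg φ => φ.freeVars
  | conj _ _ φ => ⋃ i, (φ i).freeVars
  | all V _ φ => φ.freeVars \ V

/-- First-order formulas: all conjunctions and all quantifier blocks are finite. -/
def IsFirstOrder : InfFormula L μ → Prop
  | equal _ _ => True
  | rel _ _ => True
  | neg φ => φ.IsFirstOrder
  | conj S _ φ => S.Finite ∧ ∀ i, (φ i).IsFirstOrder
  | all V _ φ => V.Finite ∧ φ.IsFirstOrder

end InfFormula

/-- `T` is a theory, that is, a set of sentences. -/
def IsTheory {L : FirstOrder.Language.{u, u}} {μ : Cardinal.{u}} (T : Set (InfFormula L μ)) : Prop :=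
  ∀ φ ∈ T, φ.freeVars = ∅

/-- `p` is a type: a set of formulas in a common set of fewer than `μ` free variables. -/
def IsType {L : FirstOrder.Language.{u, u}} {μ : Cardinal.{u}} (p : Set (InfFormula L μ)) : Prop :=
  #(⋃ φ ∈ p, φ.freeVars : Set (Var μ)) < μ

/-- Some (nonempty) model of `T` omits `p`: no assignment satisfies all the formulas of `p`. -/
def HasModelOmitting {L : FirstOrder.Language.{u, u}} {μ : Cardinal.{u}} (T p : Set (InfFormula L μ)) : Prop :=
  ∃ (A : Type u) (_ : Nonempty A) (_ : L.Structure A),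
    (∀ φ ∈ T, ∀ v : Var μ → A, φ.Realize v) ∧ ¬ ∃ v : Var μ → A, ∀ φ ∈ p, φ.Realize v

/-- `C` is a club in `P_κ X = {x ⊆ X : |x| < κ}`: cofinal, and closed under unions of nonempty
increasing sequences of length less than `κ`. -/
def IsClub {α : Type u} (κ : Cardinal.{u}) (X : Set α) (C : Set (Set α)) : Prop :=
  (∀ x ∈ C, x ⊆ X ∧ #x < κ) ∧
  (∀ x : Set α, x ⊆ X → #x < κ → ∃ y ∈ C, x ⊆ y) ∧
  ∀ a : Ordinal.{u}, a ≠ 0 → a < κ.ord → ∀ f : Set.Iio a → Set α, Monotone f →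
    (∀ i, f i ∈ C) → (⋃ i, f i) ∈ C

/-- The instance of compactness with type omission for the theory `T` and the type `p`: if for club
many `T' ∪ p' ∈ P_κ (T ∪ p)` some model of `T'` omits `p'`, then some model of `T` omits `p`. -/
def CompactOmitting {L : FirstOrder.Language.{u, u}} {μ : Cardinal.{u}} (κ : Cardinal.{u})
    (T p : Set (InfFormula L μ)) : Prop :=
  (∃ C, IsClub κ (T ∪ p) C ∧ ∀ x ∈ C, HasModelOmitting (x ∩ T) (x ∩ p)) → HasModelOmitting T p

/-- `κ`-`L_{μ,μ}`-compactness with type omission for languages of size `lam`. -/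
def CompactnessWithTypeOmission (κ μ lam : Cardinal.{u}) : Prop :=
  ∀ L : FirstOrder.Language.{u, u}, L.card = lam → ∀ T p : Set (InfFormula L μ),
    IsTheory T → IsType p → CompactOmitting κ T p

theorem infinite_var_aleph_one : Infinite (Var.{u} ℵ₁) := by
  rw [Cardinal.infinite_iff, Cardinal.mk_out]
  exact Cardinal.aleph0_le_aleph 1

/-- A sequence of distinct variables of `L_{ω₁,ω₁}`. -/
noncomputable def seqVar : ℕ ↪ Var.{u} ℵ₁ :=
  haveI := infinite_var_aleph_one.{u}
  Infinite.natEmbedding (Var.{u} ℵ₁)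

theorem mk_range_seqVar_lt : #(Set.range seqVar.{u}) < ℵ₁ :=
  lt_of_le_of_lt ((Cardinal.le_aleph0_iff_set_countable).2 (Set.countable_range _))
    Cardinal.aleph0_lt_aleph_one

/-- The `L_{ω₁,ω₁}`-sentence `¬ ∃ x₀ x₁ x₂ … ⋀ₙ E(xₙ₊₁, xₙ)` asserting that `E` is well founded. -/
noncomputable def wfSentence {L : FirstOrder.Language.{u, u}} (E : L.Relations 2) : InfFormula L ℵ₁ :=
  .all (Set.range seqVar) mk_range_seqVar_lt <| .neg <|
    .conj (Set.range seqVar) mk_range_seqVar_lt fun y =>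
      let n : ℕ := (Equiv.ofInjective seqVar seqVar.injective).symm y
      .rel E ![.var (seqVar (n + 1)), .var (seqVar n)]

/-- The restriction of `κ`-`L_{ω₁,ω₁}`-compactness with type omission for languages of size `lam`
to first-order types in one variable and to theories that consist of a first-order theory together
with the sentence asserting that the binary relation `E` of the language is well founded. -/
def WellFoundedCompactnessWithTypeOmission (κ lam : Cardinal.{u}) : Prop :=
  ∀ L : FirstOrder.Language.{u, u}, L.card = lam → ∀ (E : L.Relations 2) (T p : Set (InfFormula L ℵ₁)),
    IsTheory T → (∀ φ ∈ T, φ.IsFirstOrder) →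
    (∃ x, ∀ φ ∈ p, φ.freeVars ⊆ {x}) → (∀ φ ∈ p, φ.IsFirstOrder) →
    CompactOmitting κ (T ∪ {wfSentence E}) p

end Logic

section Models

/-- The only symbol of the language of set theory. -/
inductive MemRel : ℕ → Type
  | mem : MemRel 2

/-- The language of set theory. -/
def setLang : FirstOrder.Language.{0, 0} := ⟨fun _ => Empty, MemRel⟩

/-- A set `M`, viewed as the structure `(M, ∈)`. -/
instance (M : ZFSet.{u}) : setLang.Structure M where
  funMap := fun f => Empty.elim f
  RelMap := fun {_} R xs => match R, xs with
    | MemRel.mem, xs => (xs 0 : ZFSet.{u}) ∈ (xs 1 : ZFSet.{u})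

/-- `M` is a transitive model of `ZFC⁻`, i.e. of `ZFC` without the power set axiom, with the
collection scheme and the well-ordering principle. Extensionality and foundation hold in every
transitive set; pairing, union, infinity and choice are stated in the form they take in a transitive
set; separation and collection are for formulas of set theory with parameters from `M`. -/
structure IsTransitiveModelZFCMinus (M : ZFSet.{u}) : Prop where
  transitive : M.IsTransitive
  pairing : ∀ x ∈ M, ∀ y ∈ M, ({x, y} : ZFSet.{u}) ∈ M
  union : ∀ x ∈ M, ZFSet.sUnion x ∈ M
  infinity : ZFSet.omega ∈ M
  separation : ∀ D : Set M, (Set.univ : Set M).Definable₁ setLang D → ∀ a : M, ∃ b : M, ∀ x : M,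
    x.1 ∈ b.1 ↔ x.1 ∈ a.1 ∧ x ∈ D
  collection : ∀ R : Set (M × M), (Set.univ : Set M).Definable₂ setLang R → ∀ a : M,
    (∀ x : M, x.1 ∈ a.1 → ∃ y : M, (x, y) ∈ R) →
      ∃ b : M, ∀ x : M, x.1 ∈ a.1 → ∃ y : M, y.1 ∈ b.1 ∧ (x, y) ∈ R
  choice : ∀ a ∈ M, ∃ α ∈ M, ∃ f ∈ M, α.IsOrdinal ∧ ZFSet.IsFunc α a f ∧
    ∀ y ∈ a, ∃ i ∈ α, ZFSet.pair i y ∈ f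

/-- `^{<κ}M ⊆ M`: every function from an ordinal less than `κ` to `M` is an element of `M`. -/
def SeqClosed (κ : Cardinal.{u}) (M : ZFSet.{u}) : Prop :=
  ∀ a : Ordinal.{u}, a < κ.ord → ∀ f : ZFSet.{u}, ZFSet.IsFunc a.toZFSet M f → f ∈ M

/-- Every subset of `M` of cardinality less than `κ` is an element of `M`. -/
def SubsetClosed (κ : Cardinal.{u}) (M : ZFSet.{u}) : Prop :=
  ∀ x : ZFSet.{u}, x ⊆ M → x.card < κ → x ∈ M

/-- The ordinal `a` is the critical point of `j`: it is the least ordinal that is moved by `j`. -/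
def IsCrit {M N : ZFSet.{u}} (j : M → N) (a : Ordinal.{u}) : Prop :=
  (∃ h : a.toZFSet ∈ M, (j ⟨a.toZFSet, h⟩ : ZFSet.{u}) ≠ a.toZFSet) ∧
  ∀ b < a, ∀ h : b.toZFSet ∈ M, (j ⟨b.toZFSet, h⟩ : ZFSet.{u}) = b.toZFSet

/-- There are a transitive `N` and an elementary embedding `j : M → N` with critical point `κ`
such that `j '' M` is an element of `N`. -/
def HasEmbedding (κ : Cardinal.{u}) (M : ZFSet.{u}) : Prop :=
  ∃ N : ZFSet.{u}, N.IsTransitive ∧ ∃ j : M ↪ₑ[setLang] N, IsCrit j κ.ord ∧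
    ∃ s ∈ N, ∀ y : ZFSet.{u}, y ∈ s ↔ ∃ x : M, (j x : ZFSet.{u}) = y

end Models

end TypeOmission

/-!
# Compactness with type omission and embeddings of small transitive models

All five conditions are equivalent to a combinatorial guessing principle, `Guessing κ X` for all `X`
of size at most `lam`: for every list of functions `d x : x → x` for `x` in `P_κ X` there is
`c : X → X` such that every restriction of `c` to a small set agrees with some `d x` there.

*Embeddings give guesses* (`guessing_of_hasEmbedding`). Code a list `d` on `X` in a transitive
elementary submodel `M`, of size `lam`, of the sets of hereditary size at most `lam`
(`exists_elementary_model`), and let `j : M → N` be an embedding with critical point `κ` and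
`j '' M ∈ N`. If `j '' X` had size less than `j κ` in `N`, then the entry of `j d` at `j '' X` would
be a guess. An embedding of such a small model need not satisfy `j κ > lam`, so the argument
proceeds by induction on the size of `X`, with a Jónsson function `F` on `X`, for which every subset
of full size contains sequences with arbitrary values under `F` (`exists_jonsson`). By the
induction hypothesis, for every `Y ⊆ X`, either `d` has a guess on `Y` or `F` takes all values on
sequences in `Y`. Elementarity transfers this dichotomy (`GuessOrCover`) to `N`, where it applies to
`Y = j '' X`. In the first case the guess pulls back to `X` (`exists_guess_of_map`). The second is
impossible: a sequence in `j '' X` is the image of a sequence in `X`, so its value under `j F` is in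
the range of `j`, which omits an element of `j κ`.

*Guesses give compactness* (`compactness_of_guessing`). A suitable list, together with its guess,
generates a fine `κ`-complete filter that is normal and an ultrafilter with respect to `lam` many
prescribed functions and sets. It lives on `P_κ` of a set comprising the formulas and the members of
the given club, and almost all its points have traces in the club (`exists_normal_filter`,
`IsClub.exists_operation`). The elements named by infinitary Skolem
terms in the product of the given models modulo this filter form a structure of size at most `lam`
that satisfies Łoś's theorem (`SkolemProduct.realize_iff`). Hence it is a model of `T`, and
it omits `p` by normality.

*Compactness gives embeddings* (`hasEmbedding_of_wellFoundedCompactness`). For a transitive set `M`,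
consider the elementary diagram of `(M, ∈)` with two more constants: a cover, which has all elements
of `M` and all elements of ordinals below `κ` as elements, and a point, which is an element of `κ`
different from all ordinals below `κ`. The type to be omitted is that of an element of the cover that
is not in `M`. Small fragments have models on `M` itself, since small subsets of `M` can serve as the
cover. The Mostowski collapse of a well-founded model of the whole theory that omits the type
is the target of the embedding, and the collapse of the cover is `j '' M`
(`hasEmbedding_of_hasModelOmitting`).
-/

namespace TypeOmission

/-- The membership symbol. -/
def memSym : setLang.Relations 2 := MemRel.mem

/-! ### Formulas of set theory with named variables -/

/-- Formulas of the language of set theory whose variables are named by natural numbers. -/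
inductive SetFormula
  | mem (i j : ℕ)
  | eq (i j : ℕ)
  | neg (φ : SetFormula)
  | and (φ ψ : SetFormula)
  | all (i : ℕ) (φ : SetFormula)

namespace SetFormula

/-- Satisfaction of a set-theoretic formula in the class `M`. -/
def Sat (M : Set ZFSet.{u}) : SetFormula → (ℕ → ZFSet.{u}) → Prop
  | mem i j, v => v i ∈ v j
  | eq i j, v => v i = v j
  | neg φ, v => ¬ Sat M φ v
  | and φ ψ, v => Sat M φ v ∧ Sat M ψ v
  | all i φ, v => ∀ x ∈ M, Sat M φ (Function.update v i x)

/-- Disjunction. -/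
def or (φ ψ : SetFormula) : SetFormula := neg (and (neg φ) (neg ψ))
/-- Implication. -/
def imp (φ ψ : SetFormula) : SetFormula := neg (and φ (neg ψ))
/-- Existential quantification. -/
def ex (i : ℕ) (φ : SetFormula) : SetFormula := neg (all i (neg φ))
/-- Quantification over the elements of the value of variable `j`. -/
def allIn (i j : ℕ) (φ : SetFormula) : SetFormula := all i (imp (mem i j) φ)
/-- Existential quantification over the elements of the value of variable `j`. -/
def exIn (i j : ℕ) (φ : SetFormula) : SetFormula := ex i (and (mem i j) φ)

variable {M : Set ZFSet.{u}} {v : ℕ → ZFSet.{u}} {φ ψ : SetFormula} {i j : ℕ}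

@[simp] theorem sat_mem : Sat M (mem i j) v ↔ v i ∈ v j := Iff.rfl
@[simp] theorem sat_eq : Sat M (eq i j) v ↔ v i = v j := Iff.rfl
@[simp] theorem sat_neg : Sat M (neg φ) v ↔ ¬ Sat M φ v := Iff.rfl
@[simp] theorem sat_and : Sat M (and φ ψ) v ↔ Sat M φ v ∧ Sat M ψ v := Iff.rfl
@[simp] theorem sat_all : Sat M (all i φ) v ↔ ∀ x ∈ M, Sat M φ (Function.update v i x) := Iff.rfl
@[simp] theorem sat_or : Sat M (or φ ψ) v ↔ Sat M φ v ∨ Sat M ψ v := by simp [or]; tauto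
@[simp] theorem sat_imp : Sat M (imp φ ψ) v ↔ (Sat M φ v → Sat M ψ v) := by simp [imp]
@[simp] theorem sat_ex : Sat M (ex i φ) v ↔ ∃ x ∈ M, Sat M φ (Function.update v i x) := by
  simp [ex]
@[simp] theorem sat_allIn : Sat M (allIn i j φ) v ↔
    ∀ x ∈ M, x ∈ (Function.update v i x) j → Sat M φ (Function.update v i x) := by
  simp [allIn]
@[simp] theorem sat_exIn : Sat M (exIn i j φ) v ↔
    ∃ x ∈ M, x ∈ (Function.update v i x) j ∧ Sat M φ (Function.update v i x) := by
  simp [exIn]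

/-- The same formula in Mathlib's syntax. -/
def toFormula : SetFormula → setLang.Formula ℕ
  | mem i j => memSym.formula ![.var i, .var j]
  | eq i j => (Language.Term.var i).equal (Language.Term.var j)
  | neg φ => φ.toFormula.not
  | and φ ψ => φ.toFormula ⊓ ψ.toFormula
  | all i φ =>
    (Language.BoundedFormula.relabel (fun k => if k = i then Sum.inr (0 : Fin 1) else Sum.inl k)
      φ.toFormula : setLang.BoundedFormula ℕ 1).all

theorem realize_toFormula {A : Type*} [setLang.Structure A] (ι : A → ZFSet.{u})
    (hι : Function.Injective ι) (hE : ∀ xs : Fin 2 → A,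
      Language.Structure.RelMap memSym xs ↔ ι (xs 0) ∈ ι (xs 1))
    (φ : SetFormula) (v : ℕ → A) :
    φ.toFormula.Realize v ↔ Sat (Set.range ι) φ (ι ∘ v) := by
  induction φ generalizing v with
  | mem i j =>
    rw [toFormula, Language.Formula.realize_rel, hE]
    simp
  | eq i j => simp [toFormula, hι.eq_iff]
  | neg φ ih => simp [toFormula, ih]
  | and φ ψ h1 h2 => simp [toFormula, h1, h2]
  | all i φ ih =>
    simp only [toFormula, Language.Formula.Realize, Language.BoundedFormula.realize_all, sat_all,
      Set.forall_mem_range]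
    refine forall_congr' fun a => ?_
    rw [Language.BoundedFormula.realize_relabel]
    have := ih (Function.update v i a)
    rw [Language.Formula.Realize] at this
    rw [Function.comp_update] at this
    rw [← this]
    apply iff_of_eq
    congr 1
    · funext k
      by_cases hk : k = i
      · subst hk; simp [Fin.snoc]
      · simp [hk]
    · exact Subsingleton.elim _ _

end SetFormula

section

open SetFormula

/-- A class of sets, viewed as the structure `(H, ∈)`. -/
instance classStructure (H : Set ZFSet.{u}) : setLang.Structure H where
  funMap := fun f => Empty.elim f
  RelMap := fun {_} R xs => match R, xs with
    | MemRel.mem, xs => (xs 0 : ZFSet.{u}) ∈ (xs 1 : ZFSet.{u})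

theorem realize_toFormula_set (M : ZFSet.{u}) (φ : SetFormula) (v : ℕ → M) :
    φ.toFormula.Realize v ↔ Sat (M : Set ZFSet.{u}) φ (fun i => v i) := by
  have := realize_toFormula (A := M) (fun x => x) Subtype.val_injective (fun _ => Iff.rfl) φ v
  rw [this]
  have : Set.range (fun x : M => (x : ZFSet.{u})) = (M : Set ZFSet.{u}) := Subtype.range_val
  rw [this]; rfl

theorem realize_toFormula_class (M : Set ZFSet.{u}) (φ : SetFormula) (v : ℕ → M) :
    φ.toFormula.Realize v ↔ Sat M φ (fun i => v i) := by
  have := realize_toFormula (A := M) (fun x => x) Subtype.val_injective (fun _ => Iff.rfl) φ v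
  rw [this]
  have : Set.range (fun x : M => (x : ZFSet.{u})) = M := Subtype.range_val
  rw [this]; rfl

/-- An elementary embedding preserves satisfaction of formulas with named variables. -/
theorem sat_elementaryEmbedding {M N : ZFSet.{u}} (j : M ↪ₑ[setLang] N) (φ : SetFormula)
    (v : ℕ → M) :
    Sat (M : Set ZFSet.{u}) φ (fun i => v i) ↔ Sat (N : Set ZFSet.{u}) φ (fun i => j (v i)) := by
  rw [← realize_toFormula_set M φ v, ← realize_toFormula_set N φ (fun i => j (v i))]
  exact (j.map_formula φ.toFormula v).symm

end

/-! ### Sets hereditarily of bounded size -/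

/-- The sets that are hereditarily of cardinality at most `lam`. -/
inductive Her (lam : Cardinal.{u}) : ZFSet.{u} → Prop
  | mk (x : ZFSet.{u}) (hx : x.card ≤ lam) (h : ∀ y ∈ x, Her lam y) : Her lam x

namespace Her
variable {lam : Cardinal.{u}} {x y : ZFSet.{u}}

theorem card_le (h : Her lam x) : x.card ≤ lam := by cases h; assumption
theorem of_mem (h : Her lam x) (hy : y ∈ x) : Her lam y := by
  cases h with | mk _ _ h => exact h y hy

theorem of_subset (h : Her lam x) (hy : y ⊆ x) : Her lam y :=
  ⟨y, (ZFSet.card_mono hy).trans h.card_le, fun _ hz => h.of_mem (hy hz)⟩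

theorem empty : Her lam ∅ := ⟨_, by simp, fun y hy => absurd hy (ZFSet.notMem_empty y)⟩

theorem range {ι : Type*} [Small.{u} ι] {f : ι → ZFSet.{u}}
    (hι : #(Shrink.{u} ι) ≤ lam) (h : ∀ i, Her lam (f i)) : Her lam (ZFSet.range f) := by
  refine ⟨_, ?_, fun y hy => ?_⟩
  · have : ZFSet.range f = ZFSet.range (f ∘ (equivShrink.{u} ι).symm) := by
      ext z; simp [(equivShrink.{u} ι).symm.exists_congr_left]
    rw [this]
    have := ZFSet.lift_card_range_le (f := f ∘ (equivShrink.{u} ι).symm)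
    simp only [lift_id] at this
    exact this.trans hι
  · obtain ⟨i, rfl⟩ := ZFSet.mem_range.1 hy
    exact h i

theorem range' {ι : Type u} {f : ι → ZFSet.{u}}
    (hι : #ι ≤ lam) (h : ∀ i, Her lam (f i)) : Her lam (ZFSet.range f) :=
  range ((mk_congr (equivShrink.{u} ι).symm).trans_le hι) h

theorem insert_pair (hl : ℵ₀ ≤ lam) (hx : Her lam x) (hy : Her lam y) :
    Her lam {x, y} := by
  refine ⟨_, ?_, fun z hz => ?_⟩
  · refine ZFSet.card_insert_le.trans ?_
    rw [ZFSet.card_singleton]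
    refine le_trans ?_ hl
    exact_mod_cast (natCast_lt_aleph0 (n := 1 + 1)).le
  · rcases ZFSet.mem_pair.1 hz with rfl | rfl <;> assumption

theorem singleton (hl : ℵ₀ ≤ lam) (hx : Her lam x) : Her lam {x} := by
  have := insert_pair hl hx hx
  rwa [ZFSet.pair_eq_singleton] at this

theorem pair (hl : ℵ₀ ≤ lam) (hx : Her lam x) (hy : Her lam y) : Her lam (ZFSet.pair x y) :=
  insert_pair hl (singleton hl hx) (insert_pair hl hx hy)

theorem sUnion (hl : ℵ₀ ≤ lam) (hx : Her lam x) : Her lam (ZFSet.sUnion x) := by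
  refine ⟨_, ?_, fun z hz => ?_⟩
  · have h : ZFSet.sUnion x =
        ZFSet.iUnion fun i : Shrink.{u} x => (((equivShrink.{u} x).symm i : x) : ZFSet.{u}) := by
      ext z
      simp only [ZFSet.mem_sUnion, ZFSet.mem_iUnion]
      constructor
      · rintro ⟨y, hy, hz⟩
        exact ⟨equivShrink.{u} x ⟨y, hy⟩, by simpa using hz⟩
      · rintro ⟨i, hi⟩
        exact ⟨_, ((equivShrink.{u} x).symm i).2, hi⟩
    rw [h]
    have := ZFSet.lift_card_iUnion_le_sum_card
      (f := fun i : Shrink.{u} x => (((equivShrink.{u} x).symm i : x) : ZFSet.{u}))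
    rw [lift_id] at this
    refine this.trans ((sum_le_sum _ (fun _ => lam) fun i => ?_).trans ?_)
    · exact (hx.of_mem ((equivShrink.{u} x).symm i).2).card_le
    · rw [sum_const']
      exact (mul_le_mul_left hx.card_le lam).trans (mul_eq_self hl).le
  · obtain ⟨y, hy, hz⟩ := ZFSet.mem_sUnion.1 hz
    exact (hx.of_mem hy).of_mem hz

theorem toZFSet (a : Ordinal.{u}) (ha : a.card ≤ lam) : Her lam a.toZFSet := by
  induction a using WellFoundedLT.induction with
  | ind a ih =>
    refine ⟨_, by simpa using ha, fun y hy => ?_⟩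
    obtain ⟨b, hb, rfl⟩ := Ordinal.mem_toZFSet_iff.1 hy
    exact ih b hb ((Ordinal.card_le_card hb.le).trans ha)

theorem omega (hl : ℵ₀ ≤ lam) : Her lam ZFSet.omega := by
  have key : ZFSet.omega.{u} = ZFSet.range (fun n : ULift.{u} ℕ => ZFSet.mk (PSet.ofNat.{u} n.down)) := by
    ext z
    obtain ⟨z, rfl⟩ : ∃ p, ZFSet.mk p = z := Quotient.exists_rep z
    rw [ZFSet.mem_range]
    constructor
    · rintro ⟨n, hn⟩
      exact ⟨n, (Quotient.sound hn).symm⟩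
    · rintro ⟨n, hn⟩
      exact ⟨n, PSet.Equiv.symm (Quotient.exact hn)⟩
  rw [key]
  refine range' (by simpa using hl) fun ⟨n⟩ => ?_
  induction n with
  | zero => exact empty
  | succ n ih =>
    have : ZFSet.mk (PSet.ofNat.{u} (n + 1)) =
      ZFSet.sUnion {ZFSet.mk (PSet.ofNat n), {ZFSet.mk (PSet.ofNat n)}} := by
      change insert (ZFSet.mk (PSet.ofNat n)) (ZFSet.mk (PSet.ofNat n)) = _
      ext z
      simp [or_comm]
    simp only at ih ⊢
    rw [this]
    exact sUnion hl (insert_pair hl ih (singleton hl ih))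

end Her

/-- The set of pairs `(i, g i)` for ordinals `i < a`. -/
noncomputable def seqGraph (a : Ordinal.{u}) (g : Ordinal.{u} → ZFSet.{u}) : ZFSet.{u} :=
  ZFSet.range fun i : Set.Iio a => ZFSet.pair i.1.toZFSet (g i)

theorem mem_seqGraph {a : Ordinal.{u}} {g : Ordinal.{u} → ZFSet.{u}} {z : ZFSet.{u}} :
    z ∈ seqGraph a g ↔ ∃ i < a, ZFSet.pair i.toZFSet (g i) = z := by
  simp [seqGraph]

theorem isFunc_seqGraph {a : Ordinal.{u}} {g : Ordinal.{u} → ZFSet.{u}} {y : ZFSet.{u}}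
    (h : ∀ i < a, g i ∈ y) : ZFSet.IsFunc a.toZFSet y (seqGraph a g) := by
  constructor
  · intro z hz
    obtain ⟨i, hi, rfl⟩ := mem_seqGraph.1 hz
    exact ZFSet.pair_mem_prod.2 ⟨Ordinal.toZFSet_mem_toZFSet_iff.2 hi, h i hi⟩
  · intro z hz
    obtain ⟨i, hi, rfl⟩ := Ordinal.mem_toZFSet_iff.1 hz
    refine ⟨g i, mem_seqGraph.2 ⟨i, hi, rfl⟩, fun w hw => ?_⟩
    obtain ⟨k, hk, hkw⟩ := mem_seqGraph.1 hw
    obtain ⟨h1, h2⟩ := ZFSet.pair_inj.1 hkw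
    rw [← h2, Ordinal.toZFSet_injective h1]

theorem her_seqGraph {lam : Cardinal.{u}} (hl : ℵ₀ ≤ lam) {a : Ordinal.{u}} (ha : a.card ≤ lam)
    {g : Ordinal.{u} → ZFSet.{u}} (h : ∀ i < a, Her lam (g i)) : Her lam (seqGraph a g) := by
  refine Her.range ?_ fun i => Her.pair hl
    (Her.toZFSet _ ((Ordinal.card_le_card (le_of_lt i.2)).trans ha)) (h i i.2)
  rwa [← lift_le.{u + 1}, lift_mk_shrink'', Cardinal.mk_Iio_ordinal, lift_le]

/-- Every set is the range of a function on a set of ordinals of the same cardinality. -/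
theorem exists_enumeration (x : ZFSet.{u}) : ∃ g : Ordinal.{u} → ZFSet.{u},
    (∀ i < x.card.ord, g i ∈ x) ∧ ∀ y ∈ x, ∃ i < x.card.ord, g i = y := by
  have : #(Set.Iio x.card.ord) = #x := by
    rw [Cardinal.mk_Iio_ordinal, card_ord, ZFSet.cardinalMk_coe_sort]
  obtain ⟨e⟩ := Cardinal.eq.1 this
  refine ⟨fun i => if h : i ∈ Set.Iio x.card.ord then e ⟨i, h⟩ else ∅, fun i hi => ?_, fun y hy => ?_⟩
  · simp only [Set.mem_Iio, hi, dite_true]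
    exact (e ⟨i, hi⟩).2
  · refine ⟨e.symm ⟨y, hy⟩, (e.symm ⟨y, hy⟩).2, ?_⟩
    have := (e.symm ⟨y, hy⟩).2
    simp only [dif_pos this]
    simp

/-! ### Elementary submodels of the class of sets of hereditarily bounded size -/

/-- Given operations on sets of bounded arities, some set of cardinality at most `lam` is closed
under all of them and contains only sets generated by them. -/
theorem exists_closure {lam : Cardinal.{u}} {A : Type u} (B : A → Type u) (hA : #A ≤ lam)
    (hl : ℵ₀ ≤ lam) (hB : ∀ a, lam ^ #(B a) ≤ lam) (op : ∀ a, (B a → ZFSet.{u}) → ZFSet.{u}) :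
    ∃ M : ZFSet.{u}, M.card ≤ lam ∧ (∀ a v, (∀ b, v b ∈ M) → op a v ∈ M) ∧
      ∀ Q : ZFSet.{u} → Prop, (∀ a v, (∀ b, Q (v b)) → Q (op a v)) → ∀ x ∈ M, Q x := by
  let ev : WType B → ZFSet.{u} := WType.elim _ (fun s => op s.1 s.2)
  refine ⟨ZFSet.range ev, ?_, fun a v hv => ?_, fun Q hQ x hx => ?_⟩
  · have := ZFSet.lift_card_range_le (f := ev)
    simp only [lift_id] at this
    refine this.trans (WType.cardinalMk_le_of_le ?_)
    refine (sum_le_sum _ (fun _ => lam) hB).trans ?_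
    rw [sum_const']
    exact (mul_le_mul_left hA lam).trans (mul_eq_self hl).le
  · choose t ht using fun b => ZFSet.mem_range.1 (hv b)
    refine ZFSet.mem_range.2 ⟨WType.mk a t, ?_⟩
    change op a (fun b => ev (t b)) = _
    exact congrArg _ (funext ht)
  · obtain ⟨t, rfl⟩ := ZFSet.mem_range.1 hx
    induction t with
    | mk a t ih => exact hQ a _ fun b => ih b (ZFSet.mem_range_self _)

/-- Codes for the operations under which an elementary submodel is closed: finitely many basic
operations, the enumeration of the elements of a set by `K`, Skolem functions, and
collecting fewer than `κ` sets into one set. -/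
inductive HullOp (K I : Type u) : Type u
  | basic (n : Fin 7)
  | elem (k : K)
  | skolem (φ : Σ n, setLang.BoundedFormula Empty (n + 1))
  | small (i : I)

namespace HullOp

/-- The arities of the operations. -/
def Arity {K I : Type u} [Preorder I] : HullOp K I → Type u
  | basic _ => ULift (Fin 2)
  | elem _ => ULift (Fin 1)
  | skolem φ => ULift (Fin φ.1)
  | small i => Set.Iio i

theorem mk_le {K I : Type u} {lam : Cardinal.{u}} (hl : ℵ₀ ≤ lam) (hK : #K ≤ lam) (hI : #I ≤ lam) :
    #(HullOp K I) ≤ lam := by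
  have hc : Countable (Σ n, setLang.BoundedFormula Empty (n + 1)) := by
    have : Countable setLang.Symbols := by
      have : Countable (Σ l, setLang.Functions l) :=
        ⟨fun x => x.2.elim, fun x => x.2.elim⟩
      have : Countable (Σ l, setLang.Relations l) :=
        ⟨fun _ => 0, fun ⟨_, MemRel.mem⟩ ⟨_, MemRel.mem⟩ _ => rfl⟩
      exact inferInstanceAs (Countable ((Σ l, setLang.Functions l) ⊕ (Σ l, setLang.Relations l)))
    have h2 : Countable (Σ n, setLang.BoundedFormula Empty n) := inferInstance
    refine Function.Injective.countable
      (f := fun φ => (⟨φ.1 + 1, φ.2⟩ : Σ n, setLang.BoundedFormula Empty n)) ?_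
    rintro ⟨n, φ⟩ ⟨m, ψ⟩ h
    simp only [Sigma.mk.injEq, Nat.add_right_cancel_iff] at h
    obtain ⟨rfl, h⟩ := h
    simpa using h
  let f : HullOp K I → (ULift.{u} (Fin 7) ⊕ K) ⊕
      (ULift.{u} (Σ n, setLang.BoundedFormula Empty (n + 1)) ⊕ I)
    | basic n => .inl (.inl ⟨n⟩)
    | elem k => .inl (.inr k)
    | skolem φ => .inr (.inl ⟨φ⟩)
    | small i => .inr (.inr i)
  have hf : Function.Injective f := by
    intro a b h
    cases a <;> cases b <;> simp_all [f]
  refine (mk_le_of_injective hf).trans ?_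
  rw [mk_sum, mk_sum, mk_sum]
  simp only [lift_id]
  have h1 : #(ULift.{u} (Fin 7)) ≤ lam := (mk_le_aleph0).trans hl
  have h2 : #(ULift.{u} (Σ n, setLang.BoundedFormula Empty (n + 1))) ≤ lam := by
    refine le_trans ?_ hl
    exact mk_le_aleph0
  exact add_le_of_le hl (add_le_of_le hl h1 hK) (add_le_of_le hl h2 hI)

end HullOp

/-- A chosen enumeration of a set by an initial ordinal, as a set of pairs. -/
noncomputable def enumGraph (x : ZFSet.{u}) : ZFSet.{u} :=
  seqGraph x.card.ord (exists_enumeration x).choose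

open Classical in
/-- The element of `x` with index `k` in some enumeration of `x` by `K`. -/
noncomputable def elemAt {K : Type u} (k : K) (x : ZFSet.{u}) : ZFSet.{u} :=
  if h : ∃ g : K → ZFSet.{u}, (∀ k, g k ∈ x) ∧ ∀ y ∈ x, ∃ k, g k = y then h.choose k else ∅

theorem exists_elemAt {K : Type u} {x y : ZFSet.{u}} (hx : x.card ≤ #K) (hy : y ∈ x) :
    ∃ k : K, elemAt k x = y := by
  have h : ∃ g : K → ZFSet.{u}, (∀ k, g k ∈ x) ∧ ∀ y ∈ x, ∃ k, g k = y := by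
    obtain ⟨f⟩ := hx
    have : Nonempty (Shrink.{u} x) := ⟨equivShrink.{u} x ⟨y, hy⟩⟩
    refine ⟨fun k => (equivShrink.{u} x).symm (Function.invFun f k), fun k => Subtype.prop _,
      fun z hz => ⟨f (equivShrink.{u} x ⟨z, hz⟩), ?_⟩⟩
    simp [Function.leftInverse_invFun f.injective _]
  obtain ⟨k, hk⟩ := h.choose_spec.2 y hy
  exact ⟨k, by rw [elemAt, dif_pos h]; exact hk⟩

theorem her_elemAt {lam : Cardinal.{u}} {K : Type u} {k : K} {x : ZFSet.{u}} (hx : Her lam x) :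
    Her lam (elemAt k x) := by
  rw [elemAt]
  split_ifs with h
  · exact hx.of_mem (h.choose_spec.1 k)
  · exact Her.empty

/-- The class of sets of hereditary cardinality at most `lam`. -/
def herClass (lam : Cardinal.{u}) : Set ZFSet.{u} := {x | Her lam x}

open Classical in
/-- A Skolem function of `herClass lam` for the formula `φ`; its value is `∅` if there is
no witness. -/
noncomputable def skolemFun (lam : Cardinal.{u}) {n : ℕ} (φ : setLang.BoundedFormula Empty (n + 1))
    (v : Fin n → ZFSet.{u}) : ZFSet.{u} :=
  if h : ∃ (w : Fin n → herClass lam) (a : herClass lam), (∀ i, (w i : ZFSet.{u}) = v i) ∧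
    φ.Realize default (Fin.snoc w a : _ → herClass lam) then h.choose_spec.choose else ∅

theorem her_skolemFun {lam : Cardinal.{u}} {n : ℕ} {φ : setLang.BoundedFormula Empty (n + 1)}
    {v : Fin n → ZFSet.{u}} : Her lam (skolemFun lam φ v) := by
  rw [skolemFun]
  split_ifs with h
  · exact h.choose_spec.choose.2
  · exact Her.empty

/-- The interpretation of the basic operations: the set `s` to be included, two sets that bound
`M.card` from below and witness infinity, pairing, union, and a well-ordering of `x` with
its domain. -/
noncomputable def basicOp (lam : Cardinal.{u}) (s : ZFSet.{u}) (x y : ZFSet.{u}) :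
    Fin 7 → ZFSet.{u}
  | 0 => s
  | 1 => lam.ord.toZFSet
  | 2 => ZFSet.omega
  | 3 => {x, y}
  | 4 => ZFSet.sUnion x
  | 5 => x.card.ord.toZFSet
  | 6 => enumGraph x

/-- The interpretation of all the operations. -/
noncomputable def HullOp.eval (lam : Cardinal.{u}) (s : ZFSet.{u}) {K I : Type u} [Preorder I] :
    (a : HullOp K I) → (a.Arity → ZFSet.{u}) → ZFSet.{u}
  | .basic n, v => basicOp lam s (v ⟨0⟩) (v ⟨1⟩) n
  | .elem k, v => elemAt k (v ⟨0⟩)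
  | .skolem φ, v => skolemFun lam φ.2 fun i => v ⟨i⟩
  | .small _, v => ZFSet.range v

theorem her_basicOp {lam : Cardinal.{u}} (hl : ℵ₀ ≤ lam) {s x y : ZFSet.{u}} (hs : Her lam s)
    (hx : Her lam x) (hy : Her lam y) (n : Fin 7) : Her lam (basicOp lam s x y n) := by
  fin_cases n
  · exact hs
  · exact Her.toZFSet _ (by simp)
  · exact Her.omega hl
  · exact Her.insert_pair hl hx hy
  · exact Her.sUnion hl hx
  · exact Her.toZFSet _ (by simpa using hx.card_le)
  · exact her_seqGraph hl (by simpa using hx.card_le)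
      fun i hi => hx.of_mem ((exists_enumeration x).choose_spec.1 i hi)

theorem HullOp.her_eval {lam κ : Cardinal.{u}} (hl : ℵ₀ ≤ lam) (hκl : κ ≤ lam) {s : ZFSet.{u}}
    (hs : Her lam s) {K : Type u} (a : HullOp K κ.ord.ToType) (v : a.Arity → ZFSet.{u})
    (hv : ∀ b, Her lam (v b)) : Her lam (a.eval lam s v) := by
  cases a with
  | basic n => exact her_basicOp hl hs (hv _) (hv _) n
  | elem k => exact her_elemAt (hv _)
  | skolem φ => exact her_skolemFun
  | small i =>
    have hi : #(Set.Iio i) < κ := by simpa using Cardinal.mk_Iio_lt i (by simp)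
    exact Her.range' (hi.le.trans hκl) hv

/-- A set of size less than `κ`, all of whose elements are in a set closed under the operations, is
in that set. -/
theorem exists_small_eval {lam κ : Cardinal.{u}} {s x : ZFSet.{u}} {K : Type u} (hx : x.card < κ)
    (hx0 : x.Nonempty) :
    ∃ (i : κ.ord.ToType) (v : (HullOp.small (K := K) i).Arity → ZFSet.{u}),
      (∀ b, v b ∈ x) ∧ (HullOp.small (K := K) i).eval lam s v = x := by
  let i : κ.ord.ToType := Ordinal.ToType.mk ⟨x.card.ord, ord_lt_ord.2 hx⟩
  have hi : x.card = #(Set.Iio i) := by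
    have e : Set.Iio i ≃ Set.Iio x.card.ord :=
      { toFun := fun b => ⟨(Ordinal.ToType.mk.symm b.1).1, by
          have h : Ordinal.ToType.mk.symm b.1 < Ordinal.ToType.mk.symm i :=
            Ordinal.ToType.mk.symm.lt_iff_lt.2 b.2
          rw [OrderIso.symm_apply_apply] at h
          exact h⟩
        invFun := fun b => ⟨Ordinal.ToType.mk ⟨b.1, lt_trans b.2 (ord_lt_ord.2 hx)⟩, by
          simp only [Set.mem_Iio, i, OrderIso.lt_iff_lt]
          exact b.2⟩
        left_inv := fun b => Subtype.ext (Ordinal.ToType.mk.apply_symm_apply b.1)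
        right_inv := fun b => by simp }
    have := Cardinal.mk_congr_lift e
    simp only [Cardinal.mk_Iio_ordinal] at this
    rw [← lift_inj.{u, u + 1}]
    simpa using this.symm
  obtain ⟨y, hy⟩ := hx0
  obtain ⟨e⟩ := Cardinal.eq.1 hi
  refine ⟨i, fun b => (equivShrink.{u} x).symm (e.symm b), fun b => Subtype.prop _, ?_⟩
  ext z
  change z ∈ ZFSet.range _ ↔ _
  rw [ZFSet.mem_range]
  constructor
  · rintro ⟨b, rfl⟩
    exact Subtype.prop _
  · intro hz
    exact ⟨e (equivShrink.{u} x ⟨z, hz⟩), by simp⟩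

section
variable {lam : Cardinal.{u}} {M : ZFSet.{u}}

/-- A relation on `M` that is definable with parameters is defined by a parameter-free formula in
which the parameters have become free variables; such a formula can be evaluated
in other structures. -/
theorem exists_formula_of_definable {α : Type*} {D : Set (α → M)}
    (hD : (Set.univ : Set M).Definable setLang D) :
    ∃ φ : setLang.Formula ((Set.univ : Set M) ⊕ α), ∀ x : α → M,
      φ.Realize (Sum.elim (fun a => a.1) x) ↔ x ∈ D := by
  obtain ⟨φ, rfl⟩ := hD
  refine ⟨Language.BoundedFormula.constantsVarsEquiv φ, fun x => ?_⟩
  exact Language.BoundedFormula.realize_constantsVarsEquiv (φ := φ) (v := x) (xs := default)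

/-- An elementary submodel of `herClass lam` satisfies separation, because `herClass lam`
contains all subsets of its elements. -/
theorem separation_of_elementary
    (j : M ↪ₑ[setLang] herClass lam) (hj : ∀ x, (j x : ZFSet.{u}) = x) (D : Set M)
    (hD : (Set.univ : Set M).Definable₁ setLang D) (a : M) :
    ∃ b : M, ∀ x : M, x.1 ∈ b.1 ↔ x.1 ∈ a.1 ∧ x ∈ D := by
  obtain ⟨φ, hφ⟩ := exists_formula_of_definable hD
  let χ : setLang.BoundedFormula ((Set.univ : Set M) ⊕ Unit) 2 :=
    Language.BoundedFormula.relabel (n := 2) (k := 0)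
      (Sum.elim (fun c => Sum.inl (Sum.inl c)) (fun _ => Sum.inr 1)) φ
  have hχ : ∀ {A : Type (u + 1)} [setLang.Structure A] (v : (Set.univ : Set M) ⊕ Unit → A)
      (xs : Fin 2 → A),
      χ.Realize v xs ↔ φ.Realize (Sum.elim (fun c => v (Sum.inl c)) (fun _ => xs 1)) := by
    intro A _ v xs
    rw [Language.BoundedFormula.realize_relabel, Language.Formula.Realize]
    apply iff_of_eq
    congr 1
    · funext c
      rcases c with c | c <;> rfl
    · exact Subsingleton.elim _ _
  let θ : setLang.Formula ((Set.univ : Set M) ⊕ Unit) :=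
    Language.BoundedFormula.ex <| Language.BoundedFormula.all <|
      Language.BoundedFormula.iff
        (memSym.boundedFormula₂ (.var (Sum.inr 1)) (.var (Sum.inr 0)))
        (memSym.boundedFormula₂ (.var (Sum.inr 1)) (.var (Sum.inl (Sum.inr ()))) ⊓ χ)
  have hθ : ∀ {A : Type (u + 1)} [setLang.Structure A] (v : (Set.univ : Set M) ⊕ Unit → A),
      θ.Realize v ↔ ∃ b : A, ∀ x : A, Language.Structure.RelMap memSym ![x, b] ↔
        Language.Structure.RelMap memSym ![x, v (Sum.inr ())] ∧
          φ.Realize (Sum.elim (fun c => v (Sum.inl c)) (fun _ => x)) := by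
    intro A _ v
    simp only [θ, Language.Formula.Realize, Language.BoundedFormula.realize_ex,
      Language.BoundedFormula.realize_all, Language.BoundedFormula.realize_iff,
      Language.BoundedFormula.realize_inf, hχ, Language.BoundedFormula.realize_rel₂]
    rfl
  let v : (Set.univ : Set M) ⊕ Unit → M := Sum.elim (fun c => c.1) (fun _ => a)
  have key : θ.Realize (j ∘ v) := by
    rw [hθ]
    let b : ZFSet.{u} := ZFSet.sep (fun x => ∃ hx : x ∈ herClass lam,
      φ.Realize (Sum.elim (fun c => j (v (Sum.inl c))) (fun _ => (⟨x, hx⟩ : herClass lam)))) a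
    have hb : Her lam b := (hj a ▸ (j a).2 : Her lam a).of_subset
      (fun z hz => (ZFSet.mem_sep.1 hz).1)
    refine ⟨⟨b, hb⟩, fun x => ?_⟩
    change x.1 ∈ b ↔ x.1 ∈ (j a).1 ∧ _
    rw [hj, ZFSet.mem_sep]
    exact and_congr_right fun _ => ⟨fun ⟨_, h⟩ => h, fun h => ⟨x.2, h⟩⟩
  rw [j.map_formula, hθ] at key
  obtain ⟨b, hb⟩ := key
  exact ⟨b, fun x => (hb x).trans (and_congr_right fun _ => hφ (fun _ => x))⟩

/-- A transitive elementary submodel of `herClass lam` satisfies collection: a set of chosen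
witnesses for the at most `lam` many elements of `a` belongs to `herClass lam`. -/
theorem collection_of_elementary (hM : M.IsTransitive)
    (j : M ↪ₑ[setLang] herClass lam) (hj : ∀ x, (j x : ZFSet.{u}) = x) (R : Set (M × M))
    (hR : (Set.univ : Set M).Definable₂ setLang R) (a : M)
    (ha : ∀ x : M, x.1 ∈ a.1 → ∃ y : M, (x, y) ∈ R) :
    ∃ b : M, ∀ x : M, x.1 ∈ a.1 → ∃ y : M, y.1 ∈ b.1 ∧ (x, y) ∈ R := by
  obtain ⟨φ, hφ⟩ := exists_formula_of_definable hR
  let χ : setLang.BoundedFormula ((Set.univ : Set M) ⊕ Unit) 3 :=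
    Language.BoundedFormula.relabel (n := 3) (k := 0)
      (Sum.elim (fun c => Sum.inl (Sum.inl c)) (fun i => Sum.inr i.succ)) φ
  have hχ : ∀ {A : Type (u + 1)} [setLang.Structure A] (v : (Set.univ : Set M) ⊕ Unit → A)
      (xs : Fin 3 → A),
      χ.Realize v xs ↔ φ.Realize (Sum.elim (fun c => v (Sum.inl c)) (fun i => xs i.succ)) := by
    intro A _ v xs
    rw [Language.BoundedFormula.realize_relabel, Language.Formula.Realize]
    apply iff_of_eq
    congr 1
    · funext c
      rcases c with c | c <;> rfl
    · exact Subsingleton.elim _ _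
  let θ : setLang.Formula ((Set.univ : Set M) ⊕ Unit) :=
    Language.BoundedFormula.ex <| Language.BoundedFormula.all <|
      Language.BoundedFormula.imp
        (memSym.boundedFormula₂ (.var (Sum.inr 1)) (.var (Sum.inl (Sum.inr ()))))
        (Language.BoundedFormula.ex
          (memSym.boundedFormula₂ (.var (Sum.inr 2)) (.var (Sum.inr 0)) ⊓ χ))
  have hθ : ∀ {A : Type (u + 1)} [setLang.Structure A] (v : (Set.univ : Set M) ⊕ Unit → A),
      θ.Realize v ↔ ∃ b : A, ∀ x : A,
        Language.Structure.RelMap memSym ![x, v (Sum.inr ())] →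
          ∃ y : A, Language.Structure.RelMap memSym ![y, b] ∧
          φ.Realize (Sum.elim (fun c => v (Sum.inl c)) ![x, y]) := by
    intro A _ v
    simp only [θ, Language.Formula.Realize, Language.BoundedFormula.realize_ex,
      Language.BoundedFormula.realize_all, Language.BoundedFormula.realize_imp,
      Language.BoundedFormula.realize_inf, hχ, Language.BoundedFormula.realize_rel₂]
    refine exists_congr fun b => forall_congr' fun x => imp_congr Iff.rfl <|
      exists_congr fun y => and_congr Iff.rfl ?_
    have : (fun i : Fin 2 => (Fin.snoc (Fin.snoc (Fin.snoc default b) x) y : Fin 3 → A) i.succ) =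
        ![x, y] := by
      funext i
      fin_cases i <;> rfl
    rw [this]
  let v : (Set.univ : Set M) ⊕ Unit → M := Sum.elim (fun c => c.1) (fun _ => a)
  have key : θ.Realize (j ∘ v) := by
    rw [hθ]
    have haM : ∀ x : a.1, x.1 ∈ M := fun x => hM _ a.2 x.2
    choose F hF using fun x : a.1 => ha ⟨x.1, haM x⟩ x.2
    have haH : Her lam a := (hj a ▸ (j a).2 : Her lam a)
    let b : ZFSet.{u} := ZFSet.range fun x : a.1 => (F x).1
    have hb : Her lam b := Her.range haH.card_le fun x => hj (F x) ▸ (j (F x)).2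
    refine ⟨⟨b, hb⟩, fun x hx => ?_⟩
    have hx' : x.1 ∈ a.1 := by
      have : x.1 ∈ (j a).1 := hx
      rwa [hj] at this
    refine ⟨j (F ⟨x.1, hx'⟩), ?_, ?_⟩
    · change (j (F ⟨x.1, hx'⟩)).1 ∈ b
      rw [hj]
      exact ZFSet.mem_range.2 ⟨⟨x.1, hx'⟩, rfl⟩
    · have h1 := (hφ ![⟨x.1, haM ⟨x.1, hx'⟩⟩, F ⟨x.1, hx'⟩]).2 (hF ⟨x.1, hx'⟩)
      rw [← j.map_formula] at h1
      convert h1 using 1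
      funext c
      rcases c with c | i
      · rfl
      · fin_cases i
        · exact Subtype.ext (hj ⟨x.1, haM ⟨x.1, hx'⟩⟩).symm
        · rfl
  rw [j.map_formula, hθ] at key
  obtain ⟨b, hb⟩ := key
  refine ⟨b, fun x hx => ?_⟩
  obtain ⟨y, hy, h⟩ := hb x hx
  exact ⟨y, hy, (hφ ![x, y]).1 h⟩

end

/-- Every set of hereditary cardinality at most `lam` belongs to a transitive model of `ZFC⁻` of
cardinality `lam` that is closed under subsets of size less than `κ` and
is an elementary submodel of the class of all sets of hereditary cardinality at most `lam`. -/
theorem exists_elementary_model {κ lam : Cardinal.{u}} (hκ : κ.IsInaccessible) (hle : κ ≤ lam)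
    (hlam : lam = lam ^< κ) {s : ZFSet.{u}} (hs : Her lam s) :
    ∃ M : ZFSet.{u}, IsTransitiveModelZFCMinus M ∧ s ∈ M ∧ lam.ord.toZFSet ∈ M ∧ M.card = lam ∧
      SubsetClosed κ M ∧
      ∃ j : M ↪ₑ[setLang] herClass lam, ∀ x, (j x : ZFSet.{u}) = x := by
  have hκ0 : ℵ₀ < κ := hκ.1
  have hl : ℵ₀ ≤ lam := hκ0.le.trans hle
  have har : ∀ a : HullOp lam.out κ.ord.ToType, #a.Arity < κ := by
    rintro (n | k | φ | i)
    · exact (lt_aleph0_of_finite (ULift (Fin 2))).trans hκ0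
    · exact (lt_aleph0_of_finite (ULift (Fin 1))).trans hκ0
    · exact (lt_aleph0_of_finite (ULift (Fin φ.1))).trans hκ0
    · have hi : #(Set.Iio i) < κ := by simpa using Cardinal.mk_Iio_lt i (by simp)
      exact hi
  obtain ⟨M, hMc, hMcl, hMind⟩ := exists_closure (lam := lam)
    (A := HullOp lam.out κ.ord.ToType) HullOp.Arity
    (HullOp.mk_le hl (by simp) (by simpa using hle)) hl
    (fun a => (le_powerlt lam (har a)).trans hlam.ge) (HullOp.eval lam s)
  have hbasic : ∀ n : Fin 7, ∀ x ∈ M, ∀ y ∈ M, basicOp lam s x y n ∈ M := by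
    intro n x hx y hy
    refine hMcl (.basic n) (fun b : ULift (Fin 2) => if b.down = 0 then x else y) ?_
    intro (b : ULift (Fin 2))
    split_ifs <;> assumption
  -- any operation without arguments provides an element
  have hempty : ∃ x, x ∈ M := ⟨_, hMcl (.skolem ⟨0, ⊤⟩) (fun b => b.down.elim0) fun b => b.down.elim0⟩
  obtain ⟨x₀, hx₀⟩ := hempty
  have hher : ∀ x ∈ M, Her lam x := hMind _ fun a v hv => HullOp.her_eval hl hle hs a v hv
  have htrans : M.IsTransitive := by
    intro x hx y hy
    obtain ⟨k, hk⟩ := exists_elemAt (K := lam.out) (by simpa using (hher x hx).card_le) hy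
    rw [← hk]
    exact hMcl (.elem k) (fun _ => x) fun _ => hx
  have hlamM : lam.ord.toZFSet ∈ M := hbasic 1 x₀ hx₀ x₀ hx₀
  have hsub : SubsetClosed κ M := by
    intro x hx hxc
    rcases x.eq_empty_or_nonempty with rfl | hne
    · have := htrans _ hlamM
      refine this ?_
      rw [← Ordinal.toZFSet_zero, Ordinal.toZFSet_mem_toZFSet_iff]
      exact ord_pos.2 (aleph0_pos.trans_le hl)
    · obtain ⟨i, v, hv, hvx⟩ := exists_small_eval (lam := lam) (s := s) (K := lam.out) hxc hne
      rw [← hvx]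
      exact hMcl (.small i) v fun b => hx (hv b)
  let f : M ↪[setLang] herClass lam :=
    { toFun := fun x => ⟨x, hher x x.2⟩
      inj' := fun x y h => Subtype.ext (congrArg (fun z : herClass lam => z.1) h)
      map_fun' := fun f => Empty.elim f
      map_rel' := fun {n} R xs => by
        cases R
        exact Iff.rfl }
  have htv : ∀ (n : ℕ) (φ : setLang.BoundedFormula Empty (n + 1)) (x : Fin n → M)
      (a : herClass lam), φ.Realize default (Fin.snoc (f ∘ x) a : _ → herClass lam) →
      ∃ b : M, φ.Realize default (Fin.snoc (f ∘ x) (f b) : _ → herClass lam) := by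
    intro n φ x a h
    have hex : ∃ (w : Fin n → herClass lam) (a : herClass lam), (∀ i, (w i : ZFSet.{u}) = x i) ∧
      φ.Realize default (Fin.snoc w a : _ → herClass lam) := ⟨f ∘ x, a, fun _ => rfl, h⟩
    have hm : skolemFun lam φ (fun i => (x i : ZFSet.{u})) ∈ M :=
      hMcl (.skolem ⟨n, φ⟩) (fun b => x b.down) fun b => (x b.down).2
    refine ⟨⟨_, hm⟩, ?_⟩
    have h2 := hex.choose_spec.choose_spec
    convert h2.2 using 2
    · funext i
      exact Subtype.ext (h2.1 i).symm
    · apply Subtype.ext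
      change skolemFun lam φ _ = _
      rw [skolemFun, dif_pos hex]
  let j := f.toElementaryEmbedding htv
  have hj : ∀ x, (j x : ZFSet.{u}) = x := fun x => rfl
  refine ⟨M, ?_, hbasic 0 x₀ hx₀ x₀ hx₀, hlamM, ?_, hsub, j, hj⟩
  · exact
    { transitive := htrans
      pairing := fun x hx y hy => hbasic 3 x hx y hy
      union := fun x hx => hbasic 4 x hx x hx
      infinity := hbasic 2 x₀ hx₀ x₀ hx₀
      separation := separation_of_elementary j hj
      collection := collection_of_elementary htrans j hj
      choice := fun a ha => by
        refine ⟨_, hbasic 5 a ha a ha, _, hbasic 6 a ha a ha, ZFSet.isOrdinal_toZFSet _,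
          isFunc_seqGraph (exists_enumeration a).choose_spec.1, fun y hy => ?_⟩
        obtain ⟨i, hi, rfl⟩ := (exists_enumeration a).choose_spec.2 y hy
        exact ⟨i.toZFSet, Ordinal.toZFSet_mem_toZFSet_iff.2 hi, mem_seqGraph.2 ⟨i, hi, rfl⟩⟩ }
  · refine le_antisymm hMc ?_
    have := ZFSet.card_mono (htrans _ hlamM)
    simpa using this

/-! ### Set-theoretic notions expressed by formulas -/

namespace SetFormula

/-- `w = {a}`, with auxiliary variable `t`. -/
def isSing (t w a : ℕ) : SetFormula := and (mem a w) (allIn t w (eq t a))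
/-- `w = {a, b}`, with auxiliary variable `t`. -/
def isUPair (t w a b : ℕ) : SetFormula :=
  and (mem a w) (and (mem b w) (allIn t w (or (eq t a) (eq t b))))
/-- `p = (a, b)`, for variables with numbers below 200. -/
def isPair (p a b : ℕ) : SetFormula :=
  and (exIn 200 p (isSing 201 200 a)) (and (exIn 200 p (isUPair 201 200 a b))
    (allIn 200 p (or (isSing 201 200 a) (isUPair 201 200 a b))))
/-- `(a, b) ∈ f`, for variables with numbers below 200. -/
def pairMem (a b f : ℕ) : SetFormula := exIn 202 f (isPair 202 a b)
/-- `(x, (a, b)) ∈ f`, for variables with numbers below 199. -/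
def tripleMem (x a b f : ℕ) : SetFormula := ex 199 (and (isPair 199 a b) (pairMem x 199 f))
/-- `f` is single-valued. -/
def functional (f : ℕ) : SetFormula :=
  all 190 (all 191 (all 192 (imp (pairMem 190 191 f) (imp (pairMem 190 192 f) (eq 191 192)))))

variable {M : Set ZFSet.{u}} {v : ℕ → ZFSet.{u}}

theorem sat_isSing (hM : ∀ x ∈ M, ∀ y ∈ x, y ∈ M) {t w a : ℕ} (h1 : w ≠ t) (h2 : a ≠ t)
    (hw : v w ∈ M) : Sat M (isSing t w a) v ↔ v w = {v a} := by
  simp only [isSing, sat_and, sat_mem, sat_allIn, sat_eq, Function.update_self,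
    Function.update_of_ne h1, Function.update_of_ne h2]
  constructor
  · rintro ⟨h, h'⟩
    ext z
    rw [ZFSet.mem_singleton]
    exact ⟨fun hz => h' z (hM _ hw z hz) hz, fun hz => hz ▸ h⟩
  · intro h
    rw [h]
    simp

theorem sat_isUPair (hM : ∀ x ∈ M, ∀ y ∈ x, y ∈ M) {t w a b : ℕ} (h1 : w ≠ t) (h2 : a ≠ t)
    (h3 : b ≠ t) (hw : v w ∈ M) : Sat M (isUPair t w a b) v ↔ v w = {v a, v b} := by
  simp only [isUPair, sat_and, sat_mem, sat_allIn, sat_eq, sat_or, Function.update_self,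
    Function.update_of_ne h1, Function.update_of_ne h2, Function.update_of_ne h3]
  constructor
  · rintro ⟨h, h', h''⟩
    ext z
    rw [ZFSet.mem_pair]
    exact ⟨fun hz => h'' z (hM _ hw z hz) hz, fun hz => by rcases hz with rfl | rfl <;> assumption⟩
  · intro h
    rw [h]
    simp

theorem sat_isPair (hM : ∀ x ∈ M, ∀ y ∈ x, y ∈ M) {p a b : ℕ} (h1 : p < 200 ∨ p = 202)
    (h2 : a < 200) (h3 : b < 200) (hp : v p ∈ M) :
    Sat M (isPair p a b) v ↔ v p = ZFSet.pair (v a) (v b) := by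
  have h1' : p ≠ 200 := by omega
  have h2' : a ≠ 200 := by omega
  have h3' : b ≠ 200 := by omega
  have e1 : ∀ x ∈ v p, Sat M (isSing 201 200 a) (Function.update v 200 x) ↔ x = {v a} := by
    intro x hx
    rw [sat_isSing hM (by omega) (by omega) (by simpa using hM _ hp _ hx)]
    simp [h2']
  have e2 : ∀ x ∈ v p, Sat M (isUPair 201 200 a b) (Function.update v 200 x) ↔ x = {v a, v b} := by
    intro x hx
    rw [sat_isUPair hM (by omega) (by omega) (by omega) (by simpa using hM _ hp _ hx)]
    simp [h2', h3']
  simp only [isPair, sat_and, sat_exIn, sat_allIn, sat_or, Function.update_of_ne h1']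
  constructor
  · rintro ⟨⟨x, _, hx, hx'⟩, ⟨y, _, hy, hy'⟩, hz⟩
    rw [e1 x hx] at hx'
    rw [e2 y hy] at hy'
    subst hx' hy'
    ext z
    rw [ZFSet.pair, ZFSet.mem_pair]
    constructor
    · intro h
      have := hz z (hM _ hp _ h) h
      rwa [e1 z h, e2 z h] at this
    · rintro (rfl | rfl) <;> assumption
  · intro h
    have m1 : ({v a} : ZFSet.{u}) ∈ v p := by rw [h, ZFSet.pair]; simp
    have m2 : ({v a, v b} : ZFSet.{u}) ∈ v p := by rw [h, ZFSet.pair]; simp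
    refine ⟨⟨_, hM _ hp _ m1, m1, (e1 _ m1).2 rfl⟩, ⟨_, hM _ hp _ m2, m2, (e2 _ m2).2 rfl⟩, ?_⟩
    intro x _ hx
    rw [e1 x hx, e2 x hx]
    rwa [h, ZFSet.pair, ZFSet.mem_pair] at hx

theorem sat_pairMem (hM : ∀ x ∈ M, ∀ y ∈ x, y ∈ M) {a b f : ℕ} (h1 : a < 200) (h2 : b < 200)
    (h3 : f < 200) (hf : v f ∈ M) :
    Sat M (pairMem a b f) v ↔ ZFSet.pair (v a) (v b) ∈ v f := by
  have h1' : a ≠ 202 := by omega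
  have h2' : b ≠ 202 := by omega
  have h3' : f ≠ 202 := by omega
  have e : ∀ x ∈ M, Sat M (isPair 202 a b) (Function.update v 202 x) ↔
      x = ZFSet.pair (v a) (v b) := by
    intro x hx
    rw [sat_isPair hM (Or.inr rfl) h1 h2 (by simpa using hx)]
    simp [h1', h2']
  simp only [pairMem, sat_exIn, Function.update_of_ne h3']
  constructor
  · rintro ⟨x, hx, hxf, h⟩
    rw [e x hx] at h
    exact h ▸ hxf
  · intro h
    exact ⟨_, hM _ hf _ h, h, (e _ (hM _ hf _ h)).2 rfl⟩

theorem pair_components_mem (hM : ∀ x ∈ M, ∀ y ∈ x, y ∈ M) {x y : ZFSet.{u}}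
    (h : ZFSet.pair x y ∈ M) : x ∈ M ∧ y ∈ M := by
  have m2 : ({x, y} : ZFSet.{u}) ∈ M := hM _ h _ (by rw [ZFSet.pair]; simp)
  exact ⟨hM _ m2 _ (by simp), hM _ m2 _ (by simp)⟩

theorem sat_tripleMem (hM : ∀ x ∈ M, ∀ y ∈ x, y ∈ M) {x a b f : ℕ} (h0 : x < 199) (h1 : a < 199)
    (h2 : b < 199) (h3 : f < 199) (hf : v f ∈ M) :
    Sat M (tripleMem x a b f) v ↔ ZFSet.pair (v x) (ZFSet.pair (v a) (v b)) ∈ v f := by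
  have h0' : x ≠ 199 := by omega
  have h1' : a ≠ 199 := by omega
  have h2' : b ≠ 199 := by omega
  have h3' : f ≠ 199 := by omega
  simp only [tripleMem, sat_ex, sat_and]
  have e : ∀ q ∈ M, (Sat M (isPair 199 a b) (Function.update v 199 q) ∧
      Sat M (pairMem x 199 f) (Function.update v 199 q)) ↔
      q = ZFSet.pair (v a) (v b) ∧ ZFSet.pair (v x) q ∈ v f := by
    intro q hq
    rw [sat_isPair hM (by omega) (by omega) (by omega) (by simpa using hq),
      sat_pairMem hM (by omega) (by omega) (by omega) (by simpa [h3'] using hf)]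
    simp [h0', h1', h2', h3']
  constructor
  · rintro ⟨q, hq, h⟩
    obtain ⟨rfl, h⟩ := (e q hq).1 h
    exact h
  · intro h
    have := (pair_components_mem hM (hM _ hf _ h)).2
    exact ⟨_, this, (e _ this).2 ⟨rfl, h⟩⟩

theorem sat_functional (hM : ∀ x ∈ M, ∀ y ∈ x, y ∈ M) {f : ℕ} (h3 : f < 190) (hf : v f ∈ M) :
    Sat M (functional f) v ↔ ∀ x y z, ZFSet.pair x y ∈ v f → ZFSet.pair x z ∈ v f → y = z := by
  have h1' : f ≠ 190 := by omega
  have h2' : f ≠ 191 := by omega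
  have h3' : f ≠ 192 := by omega
  simp only [functional, sat_all, sat_imp, sat_eq]
  have e : ∀ x y z, Sat M (pairMem 190 191 f)
      (Function.update (Function.update (Function.update v 190 x) 191 y) 192 z) ↔
      ZFSet.pair x y ∈ v f := by
    intro x y z
    rw [sat_pairMem hM (by omega) (by omega) (by omega) (by simpa [h1', h2', h3'] using hf)]
    simp [h1', h2', h3']
  have e' : ∀ x y z, Sat M (pairMem 190 192 f)
      (Function.update (Function.update (Function.update v 190 x) 191 y) 192 z) ↔
      ZFSet.pair x z ∈ v f := by
    intro x y z
    rw [sat_pairMem hM (by omega) (by omega) (by omega) (by simpa [h1', h2', h3'] using hf)]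
    simp [h1', h2', h3']
  simp only [e, e']
  constructor
  · intro h x y z hy hz
    have h1 := pair_components_mem hM (hM _ hf _ hy)
    have h2 := pair_components_mem hM (hM _ hf _ hz)
    simpa using h x h1.1 y h1.2 z h2.2 hy hz
  · intro h x _ y _ z _ hy hz
    simpa using h x y z hy hz

/-- The statement `GuessOrCover` below, with parameters the variables `0`, `1`, `2`, `3`. -/
def guessOrCover : SetFormula :=
  all 4 (imp (allIn 5 4 (mem 5 0)) (or
    (ex 6 (and (allIn 7 4 (exIn 8 4 (pairMem 7 8 6)))
      (allIn 9 1 (imp (allIn 7 9 (mem 7 4)) (exIn 10 1 (and (allIn 7 9 (mem 7 10))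
        (allIn 7 9 (allIn 8 4 (imp (pairMem 7 8 6) (tripleMem 10 7 8 2))))))))))
    (allIn 11 0 (ex 12 (and (pairMem 12 11 3)
      (allIn 13 12 (ex 14 (exIn 15 4 (isPair 13 14 15)))))))))

/-- In the class `M`, for every `Y ⊆ U` one of the following holds: some function `c` on `Y` is
such that every `s ∈ Q` included in `Y` is included in some `x ∈ Q` for which `D` agrees with `c`
on `s`; or `F` takes every value in `U` at a set of pairs with second coordinates in `Y`. -/
def GuessOrCover (M : Set ZFSet.{u}) (U Q D F : ZFSet.{u}) : Prop :=
  ∀ Y ∈ M, (∀ a ∈ Y, a ∈ U) →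
    (∃ c ∈ M, (∀ a ∈ Y, ∃ b ∈ Y, ZFSet.pair a b ∈ c) ∧
      ∀ s ∈ Q, (∀ a ∈ s, a ∈ Y) → ∃ x ∈ Q, (∀ a ∈ s, a ∈ x) ∧
        ∀ a ∈ s, ∀ b ∈ Y, ZFSet.pair a b ∈ c → ZFSet.pair x (ZFSet.pair a b) ∈ D) ∨
    ∀ ξ ∈ U, ∃ g ∈ M, ZFSet.pair g ξ ∈ F ∧ ∀ q ∈ g, ∃ n ∈ M, ∃ y ∈ Y, q = ZFSet.pair n y

theorem forall_mem_class (hM : ∀ x ∈ M, ∀ y ∈ x, y ∈ M) {x : ZFSet.{u}} (hx : x ∈ M)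
    {P : ZFSet.{u} → Prop} : (∀ y ∈ M, y ∈ x → P y) ↔ ∀ y ∈ x, P y :=
  ⟨fun h y hy => h y (hM _ hx _ hy) hy, fun h y _ hy => h y hy⟩
theorem exists_mem_class (hM : ∀ x ∈ M, ∀ y ∈ x, y ∈ M) {x : ZFSet.{u}} (hx : x ∈ M)
    {P : ZFSet.{u} → Prop} : (∃ y ∈ M, y ∈ x ∧ P y) ↔ ∃ y ∈ x, P y :=
  ⟨fun ⟨y, _, hy, h⟩ => ⟨y, hy, h⟩, fun ⟨y, hy, h⟩ => ⟨y, hM _ hx _ hy, hy, h⟩⟩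

theorem sat_allIn_of_mem (hM : ∀ x ∈ M, ∀ y ∈ x, y ∈ M) {i j : ℕ} {φ : SetFormula} (hij : j ≠ i)
    (hj : v j ∈ M) : Sat M (allIn i j φ) v ↔ ∀ x ∈ v j, Sat M φ (Function.update v i x) := by
  rw [sat_allIn]; simp only [Function.update_of_ne hij]; exact forall_mem_class hM hj
theorem sat_exIn_of_mem (hM : ∀ x ∈ M, ∀ y ∈ x, y ∈ M) {i j : ℕ} {φ : SetFormula} (hij : j ≠ i)
    (hj : v j ∈ M) : Sat M (exIn i j φ) v ↔ ∃ x ∈ v j, Sat M φ (Function.update v i x) := by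
  rw [sat_exIn]; simp only [Function.update_of_ne hij]; exact exists_mem_class hM hj

set_option linter.unusedSimpArgs false in
theorem sat_guessOrCover (hM : ∀ x ∈ M, ∀ y ∈ x, y ∈ M) (h0 : v 0 ∈ M) (h1 : v 1 ∈ M)
    (h2 : v 2 ∈ M) (h3 : v 3 ∈ M) :
    Sat M guessOrCover v ↔ GuessOrCover M (v 0) (v 1) (v 2) (v 3) := by
  rw [guessOrCover, GuessOrCover, sat_all]
  refine forall₂_congr fun Y hY => ?_
  rw [sat_imp]
  refine imp_congr ?_ ?_
  · rw [sat_allIn_of_mem hM (by omega) (by simpa using hY)]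
    simp
  rw [sat_or]
  refine or_congr ?_ ?_
  · rw [sat_ex]
    refine exists_congr fun c => and_congr_right fun hc => ?_
    rw [sat_and, sat_allIn_of_mem hM (by omega) (by simpa using hY),
      sat_allIn_of_mem hM (by omega) (by simpa using h1)]
    refine and_congr ?_ ?_
    · simp only [Function.update_self, ne_eq, OfNat.ofNat_eq_ofNat, Nat.reduceEqDiff,
        not_false_eq_true, Function.update_of_ne]
      refine forall₂_congr fun a ha => ?_
      rw [sat_exIn_of_mem hM (by omega) (by simpa using hY)]
      simp only [Function.update_self, ne_eq, OfNat.ofNat_eq_ofNat, Nat.reduceEqDiff,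
        not_false_eq_true, Function.update_of_ne]
      refine exists_congr fun b => and_congr_right fun hb => ?_
      rw [sat_pairMem hM (by omega) (by omega) (by omega) (by simpa using hc)]
      simp
    · simp only [Function.update_self, ne_eq, OfNat.ofNat_eq_ofNat, Nat.reduceEqDiff,
        not_false_eq_true, Function.update_of_ne, OfNat.one_ne_ofNat]
      refine forall₂_congr fun s hs => ?_
      have hsM := hM _ h1 _ hs
      rw [sat_imp, sat_allIn_of_mem hM (by omega) (by simpa using hsM),
        sat_exIn_of_mem hM (by omega) (by simpa using h1)]
      refine imp_congr (by simp) ?_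
      simp only [Function.update_self, ne_eq, OfNat.ofNat_eq_ofNat, Nat.reduceEqDiff,
        not_false_eq_true, Function.update_of_ne, OfNat.one_ne_ofNat]
      refine exists_congr fun x => and_congr_right fun hx => ?_
      have hxM := hM _ h1 _ hx
      rw [sat_and, sat_allIn_of_mem hM (by omega) (by simpa using hsM),
        sat_allIn_of_mem hM (by omega) (by simpa using hsM)]
      refine and_congr (by simp) ?_
      simp only [Function.update_self, ne_eq, OfNat.ofNat_eq_ofNat, Nat.reduceEqDiff,
        not_false_eq_true, Function.update_of_ne, OfNat.one_ne_ofNat]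
      refine forall₂_congr fun a ha => ?_
      rw [sat_allIn_of_mem hM (by omega) (by simpa using hY)]
      simp only [Function.update_self, ne_eq, OfNat.ofNat_eq_ofNat, Nat.reduceEqDiff,
        not_false_eq_true, Function.update_of_ne, OfNat.one_ne_ofNat]
      refine forall₂_congr fun b hb => ?_
      rw [sat_imp, sat_pairMem hM (by omega) (by omega) (by omega) (by simpa using hc),
        sat_tripleMem hM (by omega) (by omega) (by omega) (by omega) (by simpa using h2)]
      simp
  · rw [sat_allIn_of_mem hM (by omega) (by simpa using h0)]
    simp only [Function.update_self, ne_eq, OfNat.ofNat_eq_ofNat, Nat.reduceEqDiff,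
      not_false_eq_true, Function.update_of_ne, OfNat.zero_ne_ofNat]
    refine forall₂_congr fun ξ hξ => ?_
    rw [sat_ex]
    refine exists_congr fun g => and_congr_right fun hg => ?_
    rw [sat_and, sat_pairMem hM (by omega) (by omega) (by omega) (by simpa using h3),
      sat_allIn_of_mem hM (by omega) (by simpa using hg)]
    refine and_congr (by simp) ?_
    simp only [Function.update_self]
    refine forall₂_congr fun q hq => ?_
    have hqM := hM _ hg _ hq
    rw [sat_ex]
    refine exists_congr fun n => and_congr_right fun hn => ?_
    rw [sat_exIn_of_mem hM (by omega) (by simpa using hY)]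
    simp only [Function.update_self, ne_eq, OfNat.ofNat_eq_ofNat, Nat.reduceEqDiff,
      not_false_eq_true, Function.update_of_ne]
    refine exists_congr fun y => and_congr_right fun hy => ?_
    rw [sat_isPair hM (by omega) (by omega) (by omega) (by simpa using hqM)]
    simp

end SetFormula

section

open SetFormula

/-! ### Elementary maps between transitive sets -/

/-- `j` restricts to an elementary map from the transitive set `M` to the transitive set `N`. -/
structure IsElementaryMap (M N : ZFSet.{u}) (j : ZFSet.{u} → ZFSet.{u}) : Prop where
  source : M.IsTransitive
  target : N.IsTransitive
  maps : ∀ x ∈ M, j x ∈ N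
  sat : ∀ (φ : SetFormula) (v : ℕ → ZFSet.{u}), (∀ i, v i ∈ M) →
    (Sat (M : Set ZFSet.{u}) φ v ↔ Sat (N : Set ZFSet.{u}) φ (fun i => j (v i)))

open Classical in
theorem exists_isElementaryMap {M N : ZFSet.{u}} (hM : M.IsTransitive) (hN : N.IsTransitive)
    (j : M ↪ₑ[setLang] N) :
    ∃ i : ZFSet.{u} → ZFSet.{u}, (∀ x : M, i x = j x) ∧ IsElementaryMap M N i := by
  have h : ∀ x : M, (fun x => if h : x ∈ M then (j ⟨x, h⟩ : ZFSet.{u}) else ∅) (x : ZFSet.{u}) =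
      j x := fun x => by simp
  refine ⟨fun x => if h : x ∈ M then (j ⟨x, h⟩ : ZFSet.{u}) else ∅, h, hM, hN, fun x hx => ?_,
    fun φ v hv => ?_⟩
  · simp [hx]
  · rw [sat_elementaryEmbedding j φ (fun i => ⟨v i, hv i⟩)]
    simp [hv]

namespace IsElementaryMap

variable {M N : ZFSet.{u}} {j : ZFSet.{u} → ZFSet.{u}}

theorem mem_iff (hj : IsElementaryMap M N j) {x y : ZFSet.{u}} (hx : x ∈ M) (hy : y ∈ M) :
    j x ∈ j y ↔ x ∈ y := by
  have := hj.sat (mem 0 1) (fun i => if i = 0 then x else y)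
    (fun i => by split_ifs <;> assumption)
  simpa using this.symm

theorem injective (hj : IsElementaryMap M N j) {x y : ZFSet.{u}} (hx : x ∈ M) (hy : y ∈ M)
    (h : j x = j y) : x = y := by
  have := hj.sat (eq 0 1) (fun i => if i = 0 then x else y)
    (fun i => by split_ifs <;> assumption)
  simpa [h] using this

theorem pair (hj : IsElementaryMap M N j) {x y : ZFSet.{u}} (h : ZFSet.pair x y ∈ M) :
    j (ZFSet.pair x y) = ZFSet.pair (j x) (j y) := by
  obtain ⟨hx, hy⟩ := pair_components_mem (M := (M : Set ZFSet.{u})) hj.source h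
  have := hj.sat (isPair 0 1 2)
    (fun i => if i = 0 then ZFSet.pair x y else if i = 1 then x else y)
    (fun i => by split_ifs <;> assumption)
  rw [sat_isPair hj.source (by omega) (by omega) (by omega) (by simpa using h),
    sat_isPair hj.target (by omega) (by omega) (by omega) (by simpa using hj.maps _ h)] at this
  simpa using this

theorem functional (hj : IsElementaryMap M N j) {f : ZFSet.{u}} (hf : f ∈ M)
    (h : ∀ x y z, ZFSet.pair x y ∈ f → ZFSet.pair x z ∈ f → y = z) :
    ∀ x y z, ZFSet.pair x y ∈ j f → ZFSet.pair x z ∈ j f → y = z := by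
  have := hj.sat (SetFormula.functional 0) (fun _ => f) (fun i => hf)
  rw [sat_functional hj.source (by omega) hf,
    sat_functional hj.target (by omega) (hj.maps _ hf)] at this
  exact this.1 h

theorem guessOrCover (hj : IsElementaryMap M N j) {U Q D F : ZFSet.{u}} (hU : U ∈ M) (hQ : Q ∈ M)
    (hD : D ∈ M) (hF : F ∈ M) (h : GuessOrCover (M : Set ZFSet.{u}) U Q D F) :
    GuessOrCover (N : Set ZFSet.{u}) (j U) (j Q) (j D) (j F) := by
  have := hj.sat SetFormula.guessOrCover
    (fun i => if i = 0 then U else if i = 1 then Q else if i = 2 then D else F)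
    (fun i => by split_ifs <;> assumption)
  rw [sat_guessOrCover hj.source (by simpa) (by simpa) (by simpa) (by simpa),
    sat_guessOrCover hj.target (by simpa using hj.maps _ hU) (by simpa using hj.maps _ hQ)
      (by simpa using hj.maps _ hD) (by simpa using hj.maps _ hF)] at this
  simpa using this.1 (by simpa using h)

/-- An elementary map moves a set of size less than its critical point pointwise. -/
theorem exists_of_mem_small (hj : IsElementaryMap M N j) {κ : Cardinal.{u}}
    (hM : SubsetClosed κ M) (hpair : ∀ x ∈ M, ∀ y ∈ M, ZFSet.pair x y ∈ M)
    (hκM : κ.ord.toZFSet ∈ M)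
    (hfix : ∀ b < κ.ord, j b.toZFSet = b.toZFSet) {s : ZFSet.{u}} (hs : s ∈ M) (hsκ : s.card < κ)
    {y : ZFSet.{u}} (hy : y ∈ j s) : ∃ x ∈ s, j x = y := by
  obtain ⟨g, hg, hgs⟩ := exists_enumeration s
  have hord : s.card.ord < κ.ord := ord_lt_ord.2 hsκ
  have hordM : ∀ i < κ.ord, i.toZFSet ∈ M := fun i hi =>
    hj.source _ hκM (Ordinal.toZFSet_mem_toZFSet_iff.2 hi)
  set G := seqGraph s.card.ord g with hGdef
  have hGM : G ∈ M := by
    refine hM _ (fun z hz => ?_) ?_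
    · obtain ⟨i, hi, rfl⟩ := mem_seqGraph.1 hz
      exact hpair _ (hordM i (hi.trans hord)) _ (hj.source _ hs (hg i hi))
    · refine lt_of_le_of_lt ?_ hsκ
      have := ZFSet.lift_card_range_le
        (f := fun i : Set.Iio s.card.ord => ZFSet.pair i.1.toZFSet (g i))
      rw [Cardinal.mk_Iio_ordinal, card_ord] at this
      simpa [hGdef, seqGraph] using this
  have hGf : ∀ x y z, ZFSet.pair x y ∈ G → ZFSet.pair x z ∈ G → y = z := by
    intro x y z h1 h2
    obtain ⟨i, _, hi⟩ := mem_seqGraph.1 h1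
    obtain ⟨k, _, hk⟩ := mem_seqGraph.1 h2
    obtain ⟨rfl, rfl⟩ := ZFSet.pair_inj.1 hi
    obtain ⟨e, rfl⟩ := ZFSet.pair_inj.1 hk
    rw [Ordinal.toZFSet_injective e]
  have hαM := hordM _ hord
  have := hj.sat (allIn 3 0 (exIn 4 1 (pairMem 4 3 2)))
    (fun i => if i = 0 then s else if i = 1 then s.card.ord.toZFSet else G)
    (fun i => by split_ifs <;> assumption)
  have key : ∀ (K : ZFSet.{u}) (hK : K.IsTransitive) (a b c : ZFSet.{u}), a ∈ K → b ∈ K → c ∈ K →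
      (Sat (K : Set ZFSet.{u}) (allIn 3 0 (exIn 4 1 (pairMem 4 3 2)))
        (fun i => if i = 0 then a else if i = 1 then b else c) ↔
        ∀ y ∈ a, ∃ i ∈ b, ZFSet.pair i y ∈ c) := by
    intro K hK a b c ha hb hc
    rw [sat_allIn_of_mem hK (by omega) (by simpa using ha)]
    refine forall₂_congr fun y hy => ?_
    rw [sat_exIn_of_mem hK (by omega) (by simpa using hb)]
    refine exists_congr fun i => and_congr (by simp) ?_
    rw [sat_pairMem hK (by omega) (by omega) (by omega) (by simpa using hc)]
    simp
  have e : (fun i => j ((fun i => if i = 0 then s else if i = 1 then s.card.ord.toZFSet else G) i)) =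
      (fun i : ℕ => if i = 0 then j s else if i = 1 then j s.card.ord.toZFSet else j G) := by
    funext i
    simp only
    split_ifs <;> rfl
  rw [e, key M hj.source _ _ _ hs hαM hGM,
    key N hj.target _ _ _ (hj.maps _ hs) (hj.maps _ hαM) (hj.maps _ hGM)] at this
  obtain ⟨i, hi, hiy⟩ := this.1 (fun y hy => by
    obtain ⟨i, hi, rfl⟩ := hgs y hy
    exact ⟨_, Ordinal.toZFSet_mem_toZFSet_iff.2 hi, mem_seqGraph.2 ⟨i, hi, rfl⟩⟩) y hy
  rw [hfix _ hord] at hi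
  obtain ⟨b, hb, rfl⟩ := Ordinal.mem_toZFSet_iff.1 hi
  have hbG : ZFSet.pair b.toZFSet (g b) ∈ G := mem_seqGraph.2 ⟨b, hb, rfl⟩
  have hbM : ZFSet.pair b.toZFSet (g b) ∈ M := hj.source _ hGM hbG
  have h2 := (hj.mem_iff hbM hGM).2 hbG
  rw [hj.pair hbM, hfix _ (hb.trans hord)] at h2
  exact ⟨g b, hg b hb, hj.functional hGM hGf _ _ _ h2 hiy⟩

/-- A set of fewer than `κ` values of an elementary map with critical point `κ` is a value. -/
theorem exists_eq_of_small (hj : IsElementaryMap M N j) {κ : Cardinal.{u}}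
    (hM : SubsetClosed κ M) (hpair : ∀ x ∈ M, ∀ y ∈ M, ZFSet.pair x y ∈ M)
    (hκM : κ.ord.toZFSet ∈ M) (hfix : ∀ b < κ.ord, j b.toZFSet = b.toZFSet)
    {t : ZFSet.{u}} (ht : t.card < κ) (htj : ∀ y ∈ t, ∃ x ∈ M, j x = y) :
    ∃ s ∈ M, j s = t := by
  let s : ZFSet.{u} := ZFSet.sep (fun x => j x ∈ t) M
  have hsM : s ⊆ M := fun x hx => (ZFSet.mem_sep.1 hx).1
  have hsc : s.card < κ := by
    refine lt_of_le_of_lt ?_ ht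
    rw [ZFSet.card, ZFSet.card, ← lift_le.{u + 1}, lift_mk_shrink'', lift_mk_shrink'']
    refine mk_le_of_injective (f := fun x : s => (⟨j x, (ZFSet.mem_sep.1 x.2).2⟩ : t)) ?_
    intro x y h
    exact Subtype.ext (hj.injective (hsM x.2) (hsM y.2) (congrArg (fun z : t => z.1) h))
  have hs : s ∈ M := hM s hsM hsc
  refine ⟨s, hs, ?_⟩
  ext y
  constructor
  · intro hy
    obtain ⟨x, hx, rfl⟩ := hj.exists_of_mem_small hM hpair hκM hfix hs hsc hy
    exact (ZFSet.mem_sep.1 hx).2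
  · intro hy
    obtain ⟨x, hx, rfl⟩ := htj y hy
    exact (hj.mem_iff hx hs).2 (ZFSet.mem_sep.2 ⟨hx, hy⟩)

/-- Some element of the image of the critical point is not a value of the map. -/
theorem exists_not_value (hj : IsElementaryMap M N j) {κ : Cardinal.{u}}
    (hκM : κ.ord.toZFSet ∈ M) (hfix : ∀ b < κ.ord, j b.toZFSet = b.toZFSet)
    (hcrit : j κ.ord.toZFSet ≠ κ.ord.toZFSet) :
    ∃ ξ ∈ j κ.ord.toZFSet, ∀ x ∈ M, j x ≠ ξ := by
  have hsub : κ.ord.toZFSet ⊆ j κ.ord.toZFSet := by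
    intro z hz
    obtain ⟨b, hb, rfl⟩ := Ordinal.mem_toZFSet_iff.1 hz
    rw [← hfix b hb]
    exact (hj.mem_iff (hj.source _ hκM hz) hκM).2 hz
  have : ∃ ξ ∈ j κ.ord.toZFSet, ξ ∉ κ.ord.toZFSet := by
    by_contra! h
    exact hcrit (le_antisymm (fun z hz => h z hz) hsub)
  obtain ⟨ξ, hξ, hξ'⟩ := this
  refine ⟨ξ, hξ, fun x hx hxe => hξ' ?_⟩
  subst hxe
  have hxκ := (hj.mem_iff hx hκM).1 hξ
  obtain ⟨b, hb, rfl⟩ := Ordinal.mem_toZFSet_iff.1 hxκ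
  rwa [hfix b hb]

end IsElementaryMap

end

/-! ### Jónsson functions -/

/-- Two sequences are tail equivalent if they have a common tail. -/
def tailSetoid (X : Type u) : Setoid (ℕ → X) where
  r s t := ∃ m n, ∀ k, s (m + k) = t (n + k)
  iseqv :=
    { refl := fun _ => ⟨0, 0, fun _ => rfl⟩
      symm := fun ⟨m, n, h⟩ => ⟨n, m, fun k => (h k).symm⟩
      trans := by
        rintro s t r ⟨m, n, h⟩ ⟨m', n', h'⟩
        refine ⟨m + m', n' + n, fun k => ?_⟩
        have h1 := h (m' + k)
        have h2 := h' (n + k)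
        rw [show m + m' + k = m + (m' + k) by omega, h1,
          show n + (m' + k) = m' + (n + k) by omega, h2]
        congr 1; omega }

/-- A function on sequences that takes every value in `A` on the sequences in any subset of `A` of
full size. It is defined at a proper tail of the chosen representative of its tail class as the
term preceding that tail. -/
theorem exists_jonsson_on (X : Type u) [Infinite X] :
    ∃ (f : (ℕ → X) → X) (A : Set X), #A = #X ∧ ∀ B ⊆ A, #B = #X → ∀ ξ ∈ A,
      ∃ s : ℕ → X, (∀ n, s n ∈ B) ∧ f s = ξ := by
  classical
  let rep : (ℕ → X) → ℕ → X := fun s => (Quotient.mk (tailSetoid X) s).out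
  have rep_eq : ∀ s t, (∃ m n, ∀ k, s (m + k) = t (n + k)) → rep s = rep t := by
    intro s t h
    have : Quotient.mk (tailSetoid X) s = Quotient.mk (tailSetoid X) t := Quotient.sound h
    exact congrArg Quotient.out this
  have rep_rel : ∀ s, ∃ m n, ∀ k, rep s (m + k) = s (n + k) := fun s =>
    Quotient.mk_out (s := tailSetoid X) s
  let f : (ℕ → X) → X := fun t =>
    if h : ∃ m, ∀ k, t k = rep t (m + 1 + k) then rep t h.choose else t 0
  refine ⟨f, ?_⟩
  -- otherwise there is a decreasing sequence of sets, each of which omits a point of the preceding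
  -- one that `f` does not take as a value on it; `f` takes the sequence of these points, shifted,
  -- to the preceding point
  by_contra! hcon
  have step : ∀ A : {A : Set X // #A = #X}, ∃ (B : {B : Set X // #B = #X}) (ξ : X), B.1 ⊆ A.1 ∧
      ξ ∈ A.1 ∧ ξ ∉ B.1 ∧ ∀ s : ℕ → X, (∀ n, s n ∈ B.1) → f s ≠ ξ := by
    rintro ⟨A, hA⟩
    obtain ⟨B, hBA, hB, ξ, hξ, h⟩ := hcon A hA
    refine ⟨⟨B \ {ξ}, ?_⟩, ξ, Set.sdiff_subset.trans hBA, hξ, by simp, fun s hs =>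
      h s fun n => (hs n).1⟩
    refine le_antisymm (mk_set_le _) ?_
    by_contra hlt
    have h1 : #(B \ {ξ} : Set X) + #({ξ} : Set X) < #X :=
      add_lt_of_lt (aleph0_le_mk X) (not_le.1 hlt)
        (lt_of_lt_of_le (by simp) (aleph0_le_mk X))
    have h2 : B ⊆ (B \ {ξ}) ∪ {ξ} := by simp
    have h3 := (mk_le_mk_of_subset h2).trans (mk_union_le _ _)
    rw [hB] at h3
    exact absurd (h3.trans_lt h1) (lt_irrefl _)
  choose nxt pt hsub hmem hnot hval using step
  let A : ℕ → {A : Set X // #A = #X} := fun n => nxt^[n] ⟨Set.univ, mk_univ⟩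
  have hA : ∀ n, A (n + 1) = nxt (A n) := fun n => Function.iterate_succ_apply' _ _ _
  let s : ℕ → X := fun n => pt (A n)
  have hanti : ∀ m n, (A (m + n)).1 ⊆ (A m).1 := by
    intro m n
    induction n with
    | zero => exact subset_rfl
    | succ n ih => rw [← add_assoc, hA]; exact (hsub _).trans ih
  have hs : ∀ m n, s (m + n) ∈ (A m).1 := fun m n => hanti m n (hmem _)
  have hne : ∀ m d, s m ≠ s (m + 1 + d) := by
    intro m d h
    have := hs (m + 1) d
    rw [← h, hA] at this
    exact hnot _ this
  obtain ⟨m, n, hmn⟩ := rep_rel s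
  let t : ℕ → X := fun k => s (n + 1 + k)
  have htr : rep t = rep s := rep_eq _ _ ⟨0, n + 1, fun k => by simp [t]⟩
  have hex : ∃ m, ∀ k, t k = rep t (m + 1 + k) := ⟨m, fun k => by
    rw [htr, add_assoc m, hmn, ← add_assoc]⟩
  -- the position of the tail is unique because the terms of the sequence are distinct
  have hch : hex.choose = m := by
    have h1 := hex.choose_spec
    have h2 : ∀ k, t k = rep t (m + 1 + k) := fun k => by
      rw [htr, add_assoc m, hmn, ← add_assoc]
    generalize hex.choose = m' at h1
    have aux : ∀ p q d, (∀ k, t k = rep t (p + 1 + k)) → (∀ k, t k = rep t (q + 1 + k)) →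
        q ≠ p + (d + 1) := by
      rintro p q d hp hq rfl
      have e1 := hq 0
      have e2 := hp (d + 1)
      rw [show p + (d + 1) + 1 + 0 = p + 1 + (d + 1) by omega, ← e2] at e1
      have := hne (n + 1) d
      exact this (by simpa [t, add_assoc, add_comm, add_left_comm] using e1)
    rcases lt_trichotomy m' m with h | h | h
    · exact absurd (by omega) (aux m' m (m - m' - 1) h1 h2)
    · exact h
    · exact absurd (by omega) (aux m m' (m' - m - 1) h2 h1)
  have hft : f t = s n := by
    simp only [f]
    rw [dif_pos hex, hch, htr]
    simpa using hmn 0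
  refine hval (A n) t (fun k => ?_) hft
  rw [← hA]
  exact hs (n + 1) k

/-- There is an `ω`-Jónsson function on every infinite set. -/
theorem exists_jonsson (X : Type u) [Infinite X] :
    ∃ f : (ℕ → X) → X, ∀ Y : Set X, #Y = #X → ∀ ξ, ∃ s : ℕ → X, (∀ n, s n ∈ Y) ∧ f s = ξ := by
  classical
  obtain ⟨f, A, hA, hf⟩ := exists_jonsson_on X
  obtain ⟨e⟩ := Cardinal.eq.1 hA
  have hx : X := (Infinite.nonempty X).some
  refine ⟨fun s => if h : f (fun n => (e.symm (s n) : X)) ∈ A then e ⟨_, h⟩ else hx,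
    fun Y hY ξ => ?_⟩
  have hB : #((fun x => (e.symm x : X)) '' Y) = #X := by
    rw [mk_image_eq (f := fun x => (e.symm x : X)) (Subtype.val_injective.comp e.symm.injective), hY]
  obtain ⟨s, hs, hsξ⟩ := hf _ (by rintro _ ⟨x, _, rfl⟩; exact (e.symm x).2) hB
    (e.symm ξ) (e.symm ξ).2
  choose t ht hts using hs
  refine ⟨t, ht, ?_⟩
  have : (fun n => (e.symm (t n) : X)) = s := funext hts
  simp [this, hsξ]

/-! ### The guessing principle -/

/-- The guessing principle: for every list of functions `d x` that map `x` to itself there is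
a function `c : X → X` each of whose restrictions to a set `s` of size less than `κ` agrees with
`d x` for some `x` of size less than `κ` including `s`. Only the values `d x a` with `a ∈ x` and
`#x < κ` matter. -/
def Guessing (κ : Cardinal.{u}) (X : Type u) : Prop :=
  ∀ d : Set X → X → X, (∀ x, ∀ a ∈ x, d x a ∈ x) →
    ∃ c : X → X, ∀ s : Set X, #s < κ → ∃ x : Set X, #x < κ ∧ s ⊆ x ∧ ∀ a ∈ s, d x a = c a

theorem guessing_of_lt {κ : Cardinal.{u}} {X : Type u} (h : #X < κ) : Guessing κ X := by
  intro d hd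
  exact ⟨d Set.univ, fun s _ => ⟨Set.univ, by simpa using h, Set.subset_univ _, fun _ _ => rfl⟩⟩

/-- A list on `X` has a guess on every subset `Y` of `X` that satisfies the guessing principle: it
restricts to a list on `Y`, as `d x` maps every `x ⊆ Y` to itself. -/
theorem Guessing.exists_on {κ : Cardinal.{u}} {X : Type u} {Y : Set X} (h : Guessing κ Y)
    (d : Set X → X → X) (hd : ∀ x, ∀ a ∈ x, d x a ∈ x) :
    ∃ c : X → X, (∀ a ∈ Y, c a ∈ Y) ∧ ∀ s ⊆ Y, #s < κ → ∃ x : Set X, #x < κ ∧ s ⊆ x ∧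
      ∀ a ∈ s, d x a = c a := by
  classical
  obtain ⟨c, hc⟩ := h (fun x a => if h : d (Subtype.val '' x) a ∈ Y then ⟨_, h⟩ else a) (by
    intro x a ha
    have h1 := hd (Subtype.val '' x) a (Set.mem_image_of_mem _ ha)
    obtain ⟨b, hb, hba⟩ := h1
    have h2 : d (Subtype.val '' x) a ∈ Y := hba ▸ b.2
    rw [dif_pos h2]
    have : (⟨d (Subtype.val '' x) a, h2⟩ : Y) = b := Subtype.ext hba.symm
    rwa [this])
  refine ⟨fun a => if h : a ∈ Y then c ⟨a, h⟩ else a, fun a ha => by simp [ha],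
    fun s hsY hs => ?_⟩
  have hs' : #(Subtype.val ⁻¹' s : Set Y) < κ :=
    (mk_preimage_of_injective _ _ Subtype.val_injective).trans_lt hs
  obtain ⟨x, hx, hsx, hxc⟩ := hc _ hs'
  refine ⟨Subtype.val '' x, mk_image_le.trans_lt hx, fun a ha => ⟨⟨a, hsY ha⟩, hsx ha, rfl⟩,
    fun a ha => ?_⟩
  have h1 := hd (Subtype.val '' x) a ⟨⟨a, hsY ha⟩, hsx ha, rfl⟩
  obtain ⟨b, hb, hba⟩ := h1
  have h2 : d (Subtype.val '' x) a ∈ Y := hba ▸ b.2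
  have h3 := hxc ⟨a, hsY ha⟩ ha
  simp only [dif_pos h2] at h3
  simp only [hsY ha, dif_pos]
  rw [← h3]

/-- The number of subsets of size less than `κ`. -/
theorem mk_small_subsets_le {κ lam : Cardinal.{u}} (hκ : κ.IsInaccessible) (hle : κ ≤ lam)
    (hlam : lam = lam ^< κ) {X : Type u} (hX : #X ≤ lam) : #{x : Set X // #x < κ} ≤ lam := by
  classical
  have hl : ℵ₀ ≤ lam := hκ.1.le.trans hle
  rcases isEmpty_or_nonempty X with hemp | ⟨⟨a₀⟩⟩
  · exact ((mk_le_of_injective Subtype.val_injective).trans (by simp)).trans hl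
  have hlt : ∀ i : κ.ord.ToType, #(Set.Iio i) < κ := fun i => by
    simpa using Cardinal.mk_Iio_lt i (by simp)
  have hcard : #(Σ i : κ.ord.ToType, (Set.Iio i → X)) ≤ lam := by
    rw [mk_sigma]
    refine (sum_le_sum _ (fun _ => lam) fun i => ?_).trans ?_
    · rw [← power_def]
      exact (power_le_power_right hX).trans ((le_powerlt lam (hlt i)).trans hlam.ge)
    · rw [sum_const', mk_ord_toType]
      exact (mul_le_mul_left hle lam).trans (mul_eq_self hl).le
  have hsurj : ∀ x : {x : Set X // #x < κ}, ∃ g : Option (Σ i : κ.ord.ToType, (Set.Iio i → X)),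
      x.1 = (match g with
        | none => ∅
        | some g => Set.range g.2) := by
    rintro ⟨x, hx⟩
    rcases x.eq_empty_or_nonempty with rfl | ⟨y, hy⟩
    · exact ⟨none, rfl⟩
    · let i : κ.ord.ToType := Ordinal.ToType.mk ⟨(#x).ord, ord_lt_ord.2 hx⟩
      have hi : #x ≤ #(Set.Iio i) := by
        rw [← lift_le.{u + 1}]
        have : lift.{u + 1} #x = lift.{u} #(Set.Iio (#x).ord) := by
          rw [Cardinal.mk_Iio_ordinal, card_ord, lift_lift]
        rw [this]
        refine lift_mk_le_lift_mk_of_injective (f := fun b : Set.Iio (#x).ord => (⟨Ordinal.ToType.mk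
          ⟨b.1, lt_trans b.2 (ord_lt_ord.2 hx)⟩, by
            simp only [Set.mem_Iio, i, OrderIso.lt_iff_lt]
            exact b.2⟩ : Set.Iio i)) ?_
        intro b c h
        simpa [Subtype.ext_iff] using h
      obtain ⟨f⟩ := hi
      have : Nonempty x := ⟨⟨y, hy⟩⟩
      refine ⟨some ⟨i, fun k => (Function.invFun f k : x)⟩, ?_⟩
      ext z
      constructor
      · intro hz
        exact ⟨f ⟨z, hz⟩, by simp [Function.leftInverse_invFun f.injective _]⟩
      · rintro ⟨k, rfl⟩
        exact Subtype.prop _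
  choose g hg using hsurj
  have hinj : Function.Injective g := fun x y h => Subtype.ext (by rw [hg x, hg y, h])
  refine (mk_le_of_injective hinj).trans ?_
  rw [mk_option]
  exact add_le_of_le hl hcard ((one_lt_aleph0).le.trans hl)

section

open SetFormula

namespace IsElementaryMap

variable {M N : ZFSet.{u}} {j : ZFSet.{u} → ZFSet.{u}}

theorem subset (hj : IsElementaryMap M N j) {x y : ZFSet.{u}} (hx : x ∈ M) (hy : y ∈ M)
    (h : x ⊆ y) : j x ⊆ j y := by
  have := hj.sat (allIn 2 0 (mem 2 1)) (fun i => if i = 0 then x else y)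
    (fun i => by split_ifs <;> assumption)
  rw [sat_allIn_of_mem hj.source (by omega) (by simpa using hx),
    sat_allIn_of_mem hj.target (by omega) (by simpa using hj.maps _ hx)] at this
  simp only [sat_mem, Function.update_self] at this
  exact fun z hz => by simpa using this.1 (fun z hz => by simpa using h hz) z (by simpa using hz)

/-- The target of an elementary map is closed under intersections if the source is. -/
theorem inter_mem (hj : IsElementaryMap M N j) (hM : ∀ x ∈ M, ∀ y ∈ M, x ∩ y ∈ M)
    (hne : ∃ x, x ∈ M) {x y : ZFSet.{u}} (hx : x ∈ N) (hy : y ∈ N) : x ∩ y ∈ N := by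
  obtain ⟨x₀, hx₀⟩ := hne
  let φ : SetFormula := all 0 (all 1 (ex 2 (and (allIn 3 2 (and (mem 3 0) (mem 3 1)))
    (allIn 3 0 (imp (mem 3 1) (mem 3 2))))))
  have key : ∀ (K : ZFSet.{u}) (hK : K.IsTransitive) (v : ℕ → ZFSet.{u}),
      Sat (K : Set ZFSet.{u}) φ v ↔ ∀ x ∈ K, ∀ y ∈ K, ∃ z ∈ K,
        (∀ w ∈ z, w ∈ x ∧ w ∈ y) ∧ ∀ w ∈ x, w ∈ y → w ∈ z := by
    intro K hK v
    simp only [φ, sat_all, sat_ex]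
    refine forall₂_congr fun x hx => forall₂_congr fun y hy => exists_congr fun z =>
      and_congr_right fun hz => ?_
    rw [sat_and, sat_allIn_of_mem hK (by omega) (by simpa using hz),
      sat_allIn_of_mem hK (by omega) (by simpa using hx)]
    simp
  have := hj.sat φ (fun _ => x₀) (fun _ => hx₀)
  rw [key M hj.source, key N hj.target] at this
  obtain ⟨z, hz, h1, h2⟩ := this.1 (fun x hx y hy => ⟨_, hM x hx y hy,
    fun w hw => ZFSet.mem_inter.1 hw, fun w hw hw' => ZFSet.mem_inter.2 ⟨hw, hw'⟩⟩) x hx y hy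
  have : x ∩ y = z := by
    ext w
    rw [ZFSet.mem_inter]
    exact ⟨fun h => h2 w h.1 h.2, h1 w⟩
  rwa [this]

/-- If in `N` some element of `j Q` includes `j s` and is related by `j D` to all elements of
`j t`, then the same is true in `M` without `j`. -/
theorem exists_guess (hj : IsElementaryMap M N j) {s Q D t x : ZFSet.{u}} (hs : s ∈ M) (hQ : Q ∈ M)
    (hD : D ∈ M) (ht : t ∈ M) (hx : x ∈ j Q) (hsx : ∀ a ∈ j s, a ∈ x)
    (htx : ∀ p ∈ j t, ZFSet.pair x p ∈ j D) :
    ∃ x ∈ Q, (∀ a ∈ s, a ∈ x) ∧ ∀ p ∈ t, ZFSet.pair x p ∈ D := by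
  let φ : SetFormula := exIn 4 1 (and (allIn 5 0 (mem 5 4)) (allIn 5 3 (pairMem 4 5 2)))
  have key : ∀ (K : ZFSet.{u}) (hK : K.IsTransitive) (a b c d : ZFSet.{u}), a ∈ K → b ∈ K → c ∈ K →
      d ∈ K → (Sat (K : Set ZFSet.{u}) φ
        (fun i => if i = 0 then a else if i = 1 then b else if i = 2 then c else d) ↔
        ∃ x ∈ b, (∀ y ∈ a, y ∈ x) ∧ ∀ p ∈ d, ZFSet.pair x p ∈ c) := by
    intro K hK a b c d ha hb hc hd
    rw [sat_exIn_of_mem hK (by omega) (by simpa using hb)]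
    refine exists_congr fun x => and_congr (by simp) ?_
    rw [sat_and, sat_allIn_of_mem hK (by omega) (by simpa using ha),
      sat_allIn_of_mem hK (by omega) (by simpa using hd)]
    refine and_congr (by simp) (forall_congr' fun p => imp_congr (by simp) ?_)
    rw [sat_pairMem hK (by omega) (by omega) (by omega) (by simpa using hc)]
    simp
  have := hj.sat φ (fun i => if i = 0 then s else if i = 1 then Q else if i = 2 then D else t)
    (fun i => by split_ifs <;> assumption)
  have e : (fun i => j ((fun i => if i = 0 then s else if i = 1 then Q else if i = 2 then D else t) i)) =
      (fun i : ℕ => if i = 0 then j s else if i = 1 then j Q else if i = 2 then j D else j t) := by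
    funext i
    simp only
    split_ifs <;> rfl
  rw [e, key M hj.source _ _ _ _ hs hQ hD ht, key N hj.target _ _ _ _ (hj.maps _ hs) (hj.maps _ hQ)
    (hj.maps _ hD) (hj.maps _ ht)] at this
  exact this.2 ⟨x, hx, hsx, htx⟩

/-- If every set in the domain of `F` is a single-valued relation with first coordinates in `W`,
then the same holds for `j F` and `j W`. -/
theorem domain_functional (hj : IsElementaryMap M N j) {F W : ZFSet.{u}} (hF : F ∈ M) (hW : W ∈ M)
    (h : ∀ g ξ, ZFSet.pair g ξ ∈ F → (∀ x y z, ZFSet.pair x y ∈ g → ZFSet.pair x z ∈ g → y = z) ∧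
      ∀ q ∈ g, ∃ n ∈ W, ∃ y, q = ZFSet.pair n y) {g ξ : ZFSet.{u}} (hg : ZFSet.pair g ξ ∈ j F) :
    (∀ x y z, ZFSet.pair x y ∈ g → ZFSet.pair x z ∈ g → y = z) ∧
      ∀ q ∈ g, ∃ n ∈ j W, ∃ y, q = ZFSet.pair n y := by
  let φ : SetFormula := all 2 (all 3 (imp (pairMem 2 3 0) (and (SetFormula.functional 2)
    (allIn 4 2 (exIn 5 1 (ex 6 (isPair 4 5 6)))))))
  have key : ∀ (K : ZFSet.{u}) (hK : K.IsTransitive) (a b : ZFSet.{u}), a ∈ K → b ∈ K →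
      (Sat (K : Set ZFSet.{u}) φ (fun i => if i = 0 then a else b) ↔
        ∀ g ξ, ZFSet.pair g ξ ∈ a → (∀ x y z, ZFSet.pair x y ∈ g → ZFSet.pair x z ∈ g → y = z) ∧
          ∀ q ∈ g, ∃ n ∈ b, ∃ y, q = ZFSet.pair n y) := by
    intro K hK a b ha hb
    have aux : ∀ g ∈ K, ∀ ξ ∈ K, (Sat (K : Set ZFSet.{u}) (imp (pairMem 2 3 0)
        (and (SetFormula.functional 2) (allIn 4 2 (exIn 5 1 (ex 6 (isPair 4 5 6))))))
        (Function.update (Function.update (fun i => if i = 0 then a else b) 2 g) 3 ξ) ↔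
        (ZFSet.pair g ξ ∈ a → (∀ x y z, ZFSet.pair x y ∈ g → ZFSet.pair x z ∈ g → y = z) ∧
          ∀ q ∈ g, ∃ n ∈ b, ∃ y, q = ZFSet.pair n y)) := by
      intro g hg ξ hξ
      rw [sat_imp, sat_pairMem hK (by omega) (by omega) (by omega) (by simpa using ha), sat_and,
        sat_functional hK (by omega) (by simpa using hg),
        sat_allIn_of_mem hK (by omega) (by simpa using hg)]
      refine imp_congr (by simp) (and_congr (by simp) (forall_congr' fun q => imp_congr_ctx (by simp) fun hq => ?_))
      have hqK : q ∈ K := hK _ hg hq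
      rw [sat_exIn_of_mem hK (by omega) (by simpa using hb)]
      refine exists_congr fun n => and_congr (by simp) ?_
      rw [sat_ex]
      constructor
      · rintro ⟨y, hy, h⟩
        rw [sat_isPair hK (by omega) (by omega) (by omega) (by simpa using hqK)] at h
        exact ⟨y, by simpa using h⟩
      · rintro ⟨y, rfl⟩
        have hyK := (pair_components_mem (M := (K : Set ZFSet.{u})) hK hqK).2
        refine ⟨y, hyK, ?_⟩
        rw [sat_isPair hK (by omega) (by omega) (by omega) (by simpa using hqK)]
        simp
    constructor
    · intro h g ξ hgξ
      obtain ⟨hg, hξ⟩ := pair_components_mem (M := (K : Set ZFSet.{u})) hK (hK _ ha hgξ)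
      exact (aux g hg ξ hξ).1 (h g hg ξ hξ) hgξ
    · intro h g hg ξ hξ
      exact (aux g hg ξ hξ).2 (h g ξ)
  have := hj.sat φ (fun i => if i = 0 then F else W) (fun i => by split_ifs <;> assumption)
  have e : (fun i => j ((fun i => if i = 0 then F else W) i)) =
      (fun i : ℕ => if i = 0 then j F else j W) := by
    funext i
    simp only
    split_ifs <;> rfl
  rw [e, key M hj.source _ _ hF hW, key N hj.target _ _ (hj.maps _ hF) (hj.maps _ hW)] at this
  exact this.1 h g ξ hg

theorem exists_pair_mem (hj : IsElementaryMap M N j) {F g ξ : ZFSet.{u}} (hF : F ∈ M) (hg : g ∈ M)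
    (h : ZFSet.pair (j g) ξ ∈ j F) : ∃ y, ZFSet.pair g y ∈ F := by
  have := hj.sat (ex 2 (pairMem 0 2 1)) (fun i => if i = 0 then g else F)
    (fun i => by split_ifs <;> assumption)
  rw [sat_ex, sat_ex] at this
  have hξ := (pair_components_mem (M := (N : Set ZFSet.{u})) hj.target
    (hj.target _ (hj.maps _ hF) h)).2
  obtain ⟨y, hy, hgy⟩ := this.2 ⟨ξ, hξ, by
    rw [sat_pairMem hj.target (by omega) (by omega) (by omega) (by simpa using hj.maps _ hF)]
    simpa using h⟩
  rw [sat_pairMem hj.source (by omega) (by omega) (by omega) (by simpa using hF)] at hgy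
  exact ⟨y, by simpa using hgy⟩

end IsElementaryMap

theorem seqClosed_of_subsetClosed {κ : Cardinal.{u}} {M : ZFSet.{u}} (hM : SubsetClosed κ M)
    (htr : M.IsTransitive) (hpair : ∀ x ∈ M, ∀ y ∈ M, ZFSet.pair x y ∈ M)
    (hκM : κ.ord.toZFSet ∈ M) : SeqClosed κ M := by
  intro a ha f hf
  have haM : a.toZFSet ⊆ M := fun z hz =>
    htr _ hκM (Ordinal.toZFSet_monotone ha.le hz)
  refine hM f (fun z hz => ?_) ?_
  · obtain ⟨x, hx, y, hy, rfl⟩ := ZFSet.mem_prod.1 (hf.1 hz)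
    exact hpair _ (haM hx) _ hy
  · have h1 : f.card ≤ a.toZFSet.card := by
      rw [ZFSet.card, ZFSet.card, ← lift_le.{u + 1}, lift_mk_shrink'', lift_mk_shrink'']
      choose fst hfst snd hsnd hp using fun z : f => ZFSet.mem_prod.1 (hf.1 z.2)
      refine mk_le_of_injective (f := fun z : f => (⟨fst z, hfst z⟩ : a.toZFSet)) ?_
      intro z w h
      have h' : fst z = fst w := congrArg (fun t : a.toZFSet => t.1) h
      apply Subtype.ext
      rw [hp z, hp w, h']
      have hz := z.2
      have hw := w.2
      rw [hp z, h'] at hz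
      rw [hp w] at hw
      rw [(hf.2 _ (hfst w)).unique hz hw]
    refine h1.trans_lt ?_
    rw [Ordinal.card_toZFSet]
    exact lt_ord.1 ha

end

section

open SetFormula

/-! ### Combinatorial objects on a type as sets -/

section Encoding

variable {X : Type u} (ρ : X → ZFSet.{u})

/-- The set of the codes `ρ a` for `a ∈ x`. -/
noncomputable def code (x : Set X) : ZFSet.{u} := ZFSet.range fun a : x => ρ a

/-- The sequence `s` as a set of pairs. -/
noncomputable def seqCode (s : ℕ → X) : ZFSet.{u} :=
  ZFSet.range fun n : ℕ => ZFSet.pair (n : Ordinal.{u}).toZFSet (ρ (s n))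

/-- The set of codes of the subsets of size less than `κ`. -/
noncomputable def smallCodes (κ : Cardinal.{u}) : ZFSet.{u} :=
  ZFSet.range fun x : {x : Set X // #x < κ} => code ρ x.1

/-- The list `d` as a set of triples. -/
noncomputable def listCode (κ : Cardinal.{u}) (d : Set X → X → X) : ZFSet.{u} :=
  ZFSet.range fun p : Σ x : {x : Set X // #x < κ}, x.1 =>
    ZFSet.pair (code ρ p.1.1) (ZFSet.pair (ρ p.2) (ρ (d p.1.1 p.2)))

/-- A function on sequences as a set of pairs. -/
noncomputable def funCode (f : (ℕ → X) → X) : ZFSet.{u} :=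
  ZFSet.range fun s : ℕ → X => ZFSet.pair (seqCode ρ s) (ρ (f s))

variable {ρ}

theorem mem_code {x : Set X} {z : ZFSet.{u}} : z ∈ code ρ x ↔ ∃ a ∈ x, ρ a = z := by
  simp [code]

theorem mem_seqCode {s : ℕ → X} {z : ZFSet.{u}} :
    z ∈ seqCode ρ s ↔ ∃ n : ℕ, ZFSet.pair (n : Ordinal.{u}).toZFSet (ρ (s n)) = z := by
  simp [seqCode]

theorem mem_code_of_injective (hρ : Function.Injective ρ) {x : Set X} {a : X} :
    ρ a ∈ code ρ x ↔ a ∈ x := by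
  rw [mem_code]
  exact ⟨fun ⟨b, hb, h⟩ => hρ h ▸ hb, fun h => ⟨a, h, rfl⟩⟩

theorem code_injective (hρ : Function.Injective ρ) : Function.Injective (code ρ) := by
  intro x y h
  ext a
  rw [← mem_code_of_injective hρ, h, mem_code_of_injective hρ]

theorem seqCode_apply (hρ : Function.Injective ρ) {s : ℕ → X} {n : ℕ} {a : X}
    (h : ZFSet.pair (n : Ordinal.{u}).toZFSet (ρ a) ∈ seqCode ρ s) : s n = a := by
  obtain ⟨m, hm⟩ := mem_seqCode.1 h
  obtain ⟨h1, h2⟩ := ZFSet.pair_inj.1 hm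
  have : m = n := by exact_mod_cast Ordinal.toZFSet_injective h1
  subst this
  exact hρ h2

theorem seqCode_injective (hρ : Function.Injective ρ) : Function.Injective (seqCode ρ) := by
  intro s t h
  funext n
  refine (seqCode_apply hρ (s := t) (n := n) (a := s n) ?_).symm
  rw [← h]
  exact mem_seqCode.2 ⟨n, rfl⟩

theorem seqCode_functional {s : ℕ → X} {x y z : ZFSet.{u}} (h1 : ZFSet.pair x y ∈ seqCode ρ s)
    (h2 : ZFSet.pair x z ∈ seqCode ρ s) : y = z := by
  obtain ⟨m, hm⟩ := mem_seqCode.1 h1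
  obtain ⟨n, hn⟩ := mem_seqCode.1 h2
  obtain ⟨rfl, rfl⟩ := ZFSet.pair_inj.1 hm
  obtain ⟨h3, rfl⟩ := ZFSet.pair_inj.1 hn
  have : n = m := by exact_mod_cast Ordinal.toZFSet_injective h3
  rw [this]

theorem mem_smallCodes {κ : Cardinal.{u}} {z : ZFSet.{u}} :
    z ∈ smallCodes ρ κ ↔ ∃ x : Set X, #x < κ ∧ code ρ x = z := by
  simp [smallCodes]

theorem mem_listCode {κ : Cardinal.{u}} {d : Set X → X → X} {z : ZFSet.{u}} :
    z ∈ listCode ρ κ d ↔ ∃ x : Set X, #x < κ ∧ ∃ a ∈ x,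
      ZFSet.pair (code ρ x) (ZFSet.pair (ρ a) (ρ (d x a))) = z := by
  rw [listCode, ZFSet.mem_range]
  constructor
  · rintro ⟨⟨⟨x, hx⟩, a, ha⟩, h⟩
    exact ⟨x, hx, a, ha, h⟩
  · rintro ⟨x, hx, a, ha, h⟩
    exact ⟨⟨⟨x, hx⟩, a, ha⟩, h⟩

theorem mem_funCode {f : (ℕ → X) → X} {z : ZFSet.{u}} :
    z ∈ funCode ρ f ↔ ∃ s, ZFSet.pair (seqCode ρ s) (ρ (f s)) = z := by
  simp [funCode]

variable {lam κ : Cardinal.{u}}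

theorem her_code (hX : #X ≤ lam) (hρ : ∀ a, Her lam (ρ a)) (x : Set X) : Her lam (code ρ x) :=
  Her.range' ((mk_set_le x).trans hX) fun a => hρ a

theorem her_seqCode (hl : ℵ₀ ≤ lam) (hρ : ∀ a, Her lam (ρ a)) (s : ℕ → X) :
    Her lam (seqCode ρ s) := by
  refine Her.range ((mk_le_aleph0).trans hl) fun n =>
    Her.pair hl (Her.toZFSet _ ?_) (hρ _)
  simpa using (natCast_lt_aleph0 (n := n)).le.trans hl

theorem her_smallCodes (hκ : κ.IsInaccessible) (hle : κ ≤ lam)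
    (hlam : lam = lam ^< κ) (hX : #X ≤ lam) (hρ : ∀ a, Her lam (ρ a)) :
    Her lam (smallCodes ρ κ) :=
  Her.range' (mk_small_subsets_le hκ hle hlam hX) fun x => her_code hX hρ x.1

theorem her_listCode (hκ : κ.IsInaccessible) (hle : κ ≤ lam)
    (hlam : lam = lam ^< κ) (hX : #X ≤ lam) (hρ : ∀ a, Her lam (ρ a)) (d : Set X → X → X) :
    Her lam (listCode ρ κ d) := by
  have hl : ℵ₀ ≤ lam := hκ.1.le.trans hle
  refine Her.range' ?_ fun p => Her.pair hl (her_code hX hρ _) (Her.pair hl (hρ _) (hρ _))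
  rw [mk_sigma]
  refine (sum_le_sum _ (fun _ => lam) fun i => (mk_set_le _).trans hX).trans ?_
  rw [sum_const']
  exact (mul_le_mul_left (mk_small_subsets_le hκ hle hlam hX) lam).trans (mul_eq_self hl).le

theorem her_funCode (hκ : κ.IsInaccessible) (hle : κ ≤ lam)
    (hlam : lam = lam ^< κ) (hX : #X ≤ lam) (hρ : ∀ a, Her lam (ρ a)) (f : (ℕ → X) → X) :
    Her lam (funCode ρ f) := by
  have hl : ℵ₀ ≤ lam := hκ.1.le.trans hle
  refine Her.range' ?_ fun p => Her.pair hl (her_seqCode hl hρ _) (hρ _)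
  have : #(ℕ → X) = #X ^ ℵ₀ := by simp
  rw [this]
  exact (power_le_power_right hX).trans ((le_powerlt lam hκ.1).trans hlam.ge)

/-- Among the sets of hereditary size at most `lam`, the codes of a list and of
a function on sequences satisfy the dichotomy whenever the list and the function do. -/
theorem guessOrCover_herClass (hl : ℵ₀ ≤ lam) (hX : #X ≤ lam) (hρ : ∀ a, Her lam (ρ a))
    (hinj : Function.Injective ρ) {d : Set X → X → X} {f : (ℕ → X) → X}
    (h : ∀ Y : Set X, (∃ c : X → X, (∀ a ∈ Y, c a ∈ Y) ∧ ∀ s ⊆ Y, #s < κ → ∃ x : Set X, #x < κ ∧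
      s ⊆ x ∧ ∀ a ∈ s, d x a = c a) ∨ ∀ ξ, ∃ s : ℕ → X, (∀ n, s n ∈ Y) ∧ f s = ξ) :
    GuessOrCover (herClass lam) (code ρ Set.univ) (smallCodes ρ κ) (listCode ρ κ d)
      (funCode ρ f) := by
  intro Yz _ hYU
  obtain ⟨Y, rfl⟩ : ∃ Y : Set X, code ρ Y = Yz := by
    refine ⟨{a | ρ a ∈ Yz}, ?_⟩
    ext z
    rw [mem_code]
    constructor
    · rintro ⟨a, ha, rfl⟩
      exact ha
    · intro hz
      obtain ⟨a, -, rfl⟩ := mem_code.1 (hYU z hz)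
      exact ⟨a, hz, rfl⟩
  rcases h Y with ⟨c, hcY, hc⟩ | hξ
  · left
    refine ⟨ZFSet.range fun a : Y => ZFSet.pair (ρ a) (ρ (c a)), Her.range'
      ((mk_set_le Y).trans hX) fun a => Her.pair hl (hρ _) (hρ _), ?_, ?_⟩
    · intro z hz
      obtain ⟨a, ha, rfl⟩ := mem_code.1 hz
      exact ⟨ρ (c a), mem_code.2 ⟨_, hcY a ha, rfl⟩, ZFSet.mem_range.2 ⟨⟨a, ha⟩, rfl⟩⟩
    · intro sz hs hsY
      obtain ⟨s, hsκ, rfl⟩ := mem_smallCodes.1 hs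
      have hsY' : s ⊆ Y := fun a ha =>
        (mem_code_of_injective hinj).1 (hsY _ ((mem_code_of_injective hinj).2 ha))
      obtain ⟨x, hx, hsx, hxc⟩ := hc s hsY' hsκ
      refine ⟨code ρ x, mem_smallCodes.2 ⟨x, hx, rfl⟩, fun z hz => ?_, fun z hz w hw hzw => ?_⟩
      · obtain ⟨a, ha, rfl⟩ := mem_code.1 hz
        exact mem_code.2 ⟨a, hsx ha, rfl⟩
      · obtain ⟨a, ha, rfl⟩ := mem_code.1 hz
        obtain ⟨⟨b, hb⟩, hbw⟩ := ZFSet.mem_range.1 hzw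
        obtain ⟨h1, rfl⟩ := ZFSet.pair_inj.1 hbw
        have h1' : b = a := hinj h1
        subst h1'
        refine mem_listCode.2 ⟨x, hx, b, hsx ha, ?_⟩
        rw [hxc b ha]
  · right
    intro z hz
    obtain ⟨ξ, -, rfl⟩ := mem_code.1 hz
    obtain ⟨s, hsY, rfl⟩ := hξ ξ
    refine ⟨seqCode ρ s, her_seqCode hl hρ s, mem_funCode.2 ⟨s, rfl⟩, fun q hq => ?_⟩
    obtain ⟨n, rfl⟩ := mem_seqCode.1 hq
    exact ⟨_, Her.toZFSet _ (by simpa using (natCast_lt_aleph0 (n := n)).le.trans hl), _,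
      mem_code.2 ⟨_, hsY n, rfl⟩, rfl⟩

end Encoding

/-! ### From embeddings to the guessing principle -/

/-- A list that satisfies the dichotomy in `M` is guessed, provided that `M` has an
elementary map `j` with critical point `κ` for which `j '' M` belongs to the target: in the target,
the dichotomy applies to the pointwise image of `X`, and the elements of `j κ` that are not values
of `j` exclude the second alternative. -/
theorem exists_guess_of_map {κ : Cardinal.{u}} (hκ : ℵ₀ < κ) {M N : ZFSet.{u}}
    {j : ZFSet.{u} → ZFSet.{u}}
    (hj : IsElementaryMap M N j) (hM : SubsetClosed κ M)
    (hpair : ∀ x ∈ M, ∀ y ∈ M, ZFSet.pair x y ∈ M) (hinter : ∀ x ∈ M, ∀ y ∈ M, x ∩ y ∈ M)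
    (hκM : κ.ord.toZFSet ∈ M) (hfix : ∀ b < κ.ord, j b.toZFSet = b.toZFSet)
    (hcrit : j κ.ord.toZFSet ≠ κ.ord.toZFSet)
    {S : ZFSet.{u}} (hS : S ∈ N) (hSj : ∀ y, y ∈ S ↔ ∃ x ∈ M, j x = y)
    {X : Type u} {ρ : X → ZFSet.{u}} (hinj : Function.Injective ρ)
    {d : Set X → X → X} {f : (ℕ → X) → X}
    (hU : code ρ Set.univ ∈ M) (hQ : smallCodes ρ κ ∈ M) (hD : listCode ρ κ d ∈ M)
    (hF : funCode ρ f ∈ M) (hκU : κ.ord.toZFSet ⊆ code ρ Set.univ)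
    (h : GuessOrCover (M : Set ZFSet.{u}) (code ρ Set.univ) (smallCodes ρ κ) (listCode ρ κ d)
      (funCode ρ f)) :
    ∃ c : X → X, ∀ s : Set X, #s < κ → ∃ x : Set X, #x < κ ∧ s ⊆ x ∧ ∀ a ∈ s, d x a = c a := by
  set U := code ρ Set.univ with hUdef
  have hρU : ∀ a, ρ a ∈ U := fun a => mem_code.2 ⟨a, trivial, rfl⟩
  have hρM : ∀ a, ρ a ∈ M := fun a => hj.source _ hU (hρU a)
  have hY : S ∩ j U ∈ N := hj.inter_mem hinter ⟨U, hU⟩ hS (hj.maps _ hU)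
  have hYmem : ∀ y, y ∈ S ∩ j U ↔ ∃ a, j (ρ a) = y := by
    intro y
    rw [ZFSet.mem_inter, hSj]
    constructor
    · rintro ⟨⟨x, hx, rfl⟩, hy⟩
      obtain ⟨a, -, rfl⟩ := mem_code.1 ((hj.mem_iff hx hU).1 hy)
      exact ⟨a, rfl⟩
    · rintro ⟨a, rfl⟩
      exact ⟨⟨_, hρM a, rfl⟩, (hj.mem_iff (hρM a) hU).2 (hρU a)⟩
  rcases hj.guessOrCover hU hQ hD hF h _ hY (fun a ha => (ZFSet.mem_inter.1 ha).2) with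
    ⟨c, hc, hcY, hcg⟩ | hcov
  · -- `c` is defined on the pointwise image of `X`, so it is the image of a function on `X`, and
    -- elementarity reflects its guessing property for `j s`, the pointwise image of `s`
    have hc0 : ∀ a, ∃ b, ZFSet.pair (j (ρ a)) (j (ρ b)) ∈ c := by
      intro a
      obtain ⟨y, hy, hp⟩ := hcY _ ((hYmem _).2 ⟨a, rfl⟩)
      obtain ⟨b, rfl⟩ := (hYmem y).1 hy
      exact ⟨b, hp⟩
    choose c0 hc0 using hc0
    refine ⟨c0, fun s hs => ?_⟩
    have hcard : ∀ g : X → ZFSet.{u}, (ZFSet.range fun a : s => g a).card < κ := fun g => by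
      refine lt_of_le_of_lt ?_ hs
      have := ZFSet.lift_card_range_le (f := fun a : s => g a)
      simpa using this
    have hsM : code ρ s ∈ M := by
      refine hM _ (fun z hz => ?_) (hcard ρ)
      obtain ⟨a, -, rfl⟩ := mem_code.1 hz
      exact hρM a
    have hpM : ∀ a, ZFSet.pair (ρ a) (ρ (c0 a)) ∈ M := fun a => hpair _ (hρM _) _ (hρM _)
    let t : ZFSet.{u} := ZFSet.range fun a : s => ZFSet.pair (ρ a) (ρ (c0 a))
    have htc : t.card < κ := hcard fun a => ZFSet.pair (ρ a) (ρ (c0 a))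
    have htM : t ∈ M := by
      refine hM _ (fun z hz => ?_) htc
      obtain ⟨a, rfl⟩ := ZFSet.mem_range.1 hz
      exact hpM a
    have hjs : ∀ z ∈ j (code ρ s), ∃ a ∈ s, j (ρ a) = z := by
      intro z hz
      obtain ⟨y, hy, rfl⟩ := hj.exists_of_mem_small hM hpair hκM hfix hsM (hcard ρ) hz
      obtain ⟨a, ha, rfl⟩ := mem_code.1 hy
      exact ⟨a, ha, rfl⟩
    have hsQ : code ρ s ∈ smallCodes ρ κ := mem_smallCodes.2 ⟨s, hs, rfl⟩
    obtain ⟨x, hx, hsx, hxD⟩ := hcg (j (code ρ s)) ((hj.mem_iff hsM hQ).2 hsQ) (fun z hz => by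
      obtain ⟨a, -, rfl⟩ := hjs z hz
      exact (hYmem _).2 ⟨a, rfl⟩)
    obtain ⟨x', hx', hsx', htx'⟩ := hj.exists_guess hsM hQ hD htM hx hsx (by
      intro p hp
      obtain ⟨q, hq, rfl⟩ := hj.exists_of_mem_small hM hpair hκM hfix htM htc hp
      obtain ⟨⟨a, ha⟩, rfl⟩ := ZFSet.mem_range.1 hq
      rw [hj.pair (hpM a)]
      exact hxD _ ((hj.mem_iff (hρM a) hsM).2 (mem_code.2 ⟨a, ha, rfl⟩)) _
        ((hYmem _).2 ⟨_, rfl⟩) (hc0 a))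
    obtain ⟨x0, hx0, rfl⟩ := mem_smallCodes.1 hx'
    refine ⟨x0, hx0, fun a ha => ?_, fun a ha => ?_⟩
    · exact (mem_code_of_injective hinj).1 (hsx' _ (mem_code.2 ⟨a, ha, rfl⟩))
    · obtain ⟨x1, _, b, _, hb⟩ := mem_listCode.1 (htx' _ (ZFSet.mem_range.2 ⟨⟨a, ha⟩, rfl⟩))
      obtain ⟨h1, h2⟩ := ZFSet.pair_inj.1 hb
      obtain ⟨h3, h4⟩ := ZFSet.pair_inj.1 h2
      have h1' := code_injective hinj h1
      have h3' : b = a := hinj h3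
      subst h1' h3'
      exact hinj h4
  · -- a sequence in the pointwise image of `X` is the image of a sequence in `X`, so the value of
    -- `j F` at it is a value of `j`, unlike `ξ`
    exfalso
    obtain ⟨ξ, hξ, hξj⟩ := hj.exists_not_value hκM hfix hcrit
    obtain ⟨g, hg, hgF, hgY⟩ := hcov ξ (hj.subset hκM hU hκU hξ)
    have hω : Ordinal.omega0 < κ.ord := by
      rw [lt_ord]; simpa using hκ
    have hωM : (Ordinal.omega0.{u}).toZFSet ∈ M :=
      hj.source _ hκM (Ordinal.toZFSet_mem_toZFSet_iff.2 hω)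
    have hdom : ∀ g ξ, ZFSet.pair g ξ ∈ funCode ρ f →
        (∀ x y z, ZFSet.pair x y ∈ g → ZFSet.pair x z ∈ g → y = z) ∧
        ∀ q ∈ g, ∃ n ∈ (Ordinal.omega0.{u}).toZFSet, ∃ y, q = ZFSet.pair n y := by
      intro g ξ hgξ
      obtain ⟨s, hs⟩ := mem_funCode.1 hgξ
      obtain ⟨rfl, -⟩ := ZFSet.pair_inj.1 hs
      refine ⟨fun x y z => seqCode_functional, fun q hq => ?_⟩
      obtain ⟨n, rfl⟩ := mem_seqCode.1 hq
      exact ⟨_, Ordinal.toZFSet_mem_toZFSet_iff.2 (Ordinal.natCast_lt_omega0 n), _, rfl⟩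
    obtain ⟨hgf, hgω⟩ := hj.domain_functional hF hωM hdom hgF
    rw [hfix _ hω] at hgω
    have hgc : g.card < κ := by
      refine lt_of_le_of_lt ?_ hκ
      have : g.card ≤ (Ordinal.omega0.{u}).toZFSet.card := by
        rw [ZFSet.card, ZFSet.card, ← lift_le.{u + 1}, lift_mk_shrink'', lift_mk_shrink'']
        choose n hn y hy using fun q : g => hgω q q.2
        refine mk_le_of_injective
          (f := fun q : g => (⟨n q, hn q⟩ : (Ordinal.omega0.{u}).toZFSet)) ?_
        intro p q hpq
        have hpq' : n p = n q :=
          congrArg (fun t : (Ordinal.omega0.{u}).toZFSet => t.1) hpq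
        have h1 := p.2
        have h2 := q.2
        rw [hy p, hpq'] at h1
        rw [hy q] at h2
        apply Subtype.ext
        rw [hy p, hy q, hpq', hgf _ _ _ h1 h2]
      simpa using this
    have hgv : ∀ q ∈ g, ∃ x ∈ M, j x = q := by
      intro q hq
      obtain ⟨n, hn, y, hy⟩ := hgω q hq
      obtain ⟨n', _, y', hy', hqy⟩ := hgY q hq
      rw [hy] at hqy
      obtain ⟨rfl, rfl⟩ := ZFSet.pair_inj.1 hqy
      obtain ⟨a, rfl⟩ := (hYmem _).1 hy'
      obtain ⟨b, hb, rfl⟩ := Ordinal.mem_toZFSet_iff.1 hn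
      have hbM : b.toZFSet ∈ M :=
        hj.source _ hκM (Ordinal.toZFSet_mem_toZFSet_iff.2 (hb.trans hω))
      refine ⟨_, hpair _ hbM _ (hρM a), ?_⟩
      rw [hj.pair (hpair _ hbM _ (hρM a)), hfix _ (hb.trans hω), hy]
    obtain ⟨g', hg', rfl⟩ := hj.exists_eq_of_small hM hpair hκM hfix hgc hgv
    obtain ⟨y, hy⟩ := hj.exists_pair_mem hF hg' hgF
    have hyM := hj.source _ hF hy
    have h1 := (hj.mem_iff hyM hF).2 hy
    rw [hj.pair hyM] at h1
    refine hξj y (pair_components_mem (M := (M : Set ZFSet.{u})) hj.source hyM).2 ?_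
    refine hj.functional hF ?_ _ _ _ h1 hgF
    intro x y z hxy hxz
    obtain ⟨s, hs⟩ := mem_funCode.1 hxy
    obtain ⟨t, ht⟩ := mem_funCode.1 hxz
    obtain ⟨h2, h3⟩ := ZFSet.pair_inj.1 hs
    obtain ⟨h4, h5⟩ := ZFSet.pair_inj.1 ht
    rw [← h3, ← h5, seqCode_injective hinj (h2.trans h4.symm)]

end

section

open SetFormula

/-- Satisfaction in an elementary submodel of `herClass lam` agrees with satisfaction in
`herClass lam`. -/
theorem sat_elementary_herClass {lam : Cardinal.{u}} {M : ZFSet.{u}}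
    (j : M ↪ₑ[setLang] herClass lam) (hj : ∀ x, (j x : ZFSet.{u}) = x) (φ : SetFormula)
    (v : ℕ → ZFSet.{u}) (hv : ∀ i, v i ∈ M) :
    Sat (M : Set ZFSet.{u}) φ v ↔ Sat (herClass lam) φ v := by
  have h1 := realize_toFormula_set M φ (fun i => ⟨v i, hv i⟩)
  have h2 := realize_toFormula_class (herClass lam) φ (fun i => j ⟨v i, hv i⟩)
  have h3 := j.map_formula φ.toFormula (fun i => ⟨v i, hv i⟩)
  simp only [hj] at h2
  rw [← h1, ← h2, ← h3]
  rfl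

/-- The guessing principle follows from the existence of embeddings of models of `ZFC⁻`, by
induction on the cardinality of `X`: the induction hypothesis provides guesses on all smaller subsets
of `X`, and a Jónsson function covers `X` by sequences from any subset of full size. -/
theorem guessing_of_hasEmbedding {κ lam : Cardinal.{u}} (hκ : κ.IsInaccessible) (hle : κ ≤ lam)
    (hlam : lam = lam ^< κ)
    (h1 : ∀ M : ZFSet.{u}, IsTransitiveModelZFCMinus M → κ.ord.toZFSet ∈ M →
        M.card = lam → SeqClosed κ M → HasEmbedding κ M) :
    ∀ μ ≤ lam, ∀ X : Type u, #X = μ → Guessing κ X := by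
  intro μ
  induction μ using WellFoundedLT.induction with
  | ind μ ih =>
  intro hμ X hX
  rcases lt_or_ge μ κ with hμκ | hμκ
  · exact guessing_of_lt (hX.trans_lt hμκ)
  have hl : ℵ₀ ≤ lam := hκ.1.le.trans hle
  have hinf : Infinite X := by
    rw [infinite_iff, hX]
    exact hκ.1.le.trans hμκ
  intro d hd
  obtain ⟨f, hf⟩ := exists_jonsson X
  -- small subsets are covered by the induction hypothesis, subsets of full size by the Jónsson
  -- function
  have hdich : ∀ Y : Set X, (∃ c : X → X, (∀ a ∈ Y, c a ∈ Y) ∧ ∀ s ⊆ Y, #s < κ →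
      ∃ x : Set X, #x < κ ∧ s ⊆ x ∧ ∀ a ∈ s, d x a = c a) ∨
      ∀ ξ, ∃ s : ℕ → X, (∀ n, s n ∈ Y) ∧ f s = ξ := by
    intro Y
    rcases (mk_set_le Y).lt_or_eq with hY | hY
    · left
      rw [hX] at hY
      exact (ih _ hY (hY.le.trans hμ) Y rfl).exists_on d hd
    · exact Or.inr (hf Y hY)
  obtain ⟨e⟩ : Nonempty (X ≃ μ.ord.ToType) := Cardinal.eq.1 (by rw [hX, mk_ord_toType])
  let ρ : X → ZFSet.{u} := fun a => (Ordinal.ToType.mk.symm (e a)).1.toZFSet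
  have hinj : Function.Injective ρ := by
    intro a b hab
    have := Ordinal.toZFSet_injective hab
    exact e.injective (Ordinal.ToType.mk.symm.injective (Subtype.ext this))
  have hρ : ∀ a, Her lam (ρ a) := by
    intro a
    refine Her.toZFSet _ ?_
    have : (Ordinal.ToType.mk.symm (e a)).1 < μ.ord := (Ordinal.ToType.mk.symm (e a)).2
    exact (lt_ord.1 this).le.trans hμ
  have hU : code ρ Set.univ = μ.ord.toZFSet := by
    ext z
    rw [mem_code, Ordinal.mem_toZFSet_iff]
    constructor
    · rintro ⟨a, -, rfl⟩
      exact ⟨_, (Ordinal.ToType.mk.symm (e a)).2, rfl⟩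
    · rintro ⟨b, hb, rfl⟩
      exact ⟨e.symm (Ordinal.ToType.mk ⟨b, hb⟩), trivial, by simp [ρ]⟩
  have hXl : #X ≤ lam := hX.trans_le hμ
  have hUH := her_code hXl hρ Set.univ
  have hQH := her_smallCodes hκ hle hlam hXl hρ
  have hDH := her_listCode hκ hle hlam hXl hρ d
  have hFH := her_funCode hκ hle hlam hXl hρ f
  obtain ⟨M, hZFC, hsM, hlamM, hMc, hMcl, i, hi⟩ := exists_elementary_model hκ hle hlam
    (Her.pair hl (Her.pair hl hUH hQH) (Her.pair hl hDH hFH))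
  have htr := hZFC.transitive
  have hκM : κ.ord.toZFSet ∈ M := by
    rcases hle.eq_or_lt with h | h
    · rwa [h]
    · exact htr _ hlamM (Ordinal.toZFSet_mem_toZFSet_iff.2 (ord_lt_ord.2 h))
  have hpair : ∀ x ∈ M, ∀ y ∈ M, ZFSet.pair x y ∈ M := by
    intro x hx y hy
    have h := hZFC.pairing x hx x hx
    rw [ZFSet.pair_eq_singleton] at h
    exact hZFC.pairing _ h _ (hZFC.pairing x hx y hy)
  have hMH : ∀ x ∈ M, Her lam x := fun x hx => by
    have := (i ⟨x, hx⟩).2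
    rwa [hi] at this
  have htrM : ∀ x ∈ (M : Set ZFSet.{u}), ∀ y ∈ x, y ∈ (M : Set ZFSet.{u}) := fun x hx y hy =>
    htr x hx hy
  have htrH : ∀ x ∈ herClass lam, ∀ y ∈ x, y ∈ herClass lam := fun x hx y hy => Her.of_mem hx hy
  have hinter : ∀ x ∈ M, ∀ y ∈ M, x ∩ y ∈ M := by
    intro x hx y hy
    let φ : SetFormula := ex 2 (and (allIn 3 2 (and (mem 3 0) (mem 3 1)))
      (allIn 3 0 (imp (mem 3 1) (mem 3 2))))
    have key : ∀ (K : Set ZFSet.{u}) (hK : ∀ x ∈ K, ∀ y ∈ x, y ∈ K), x ∈ K →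
        (Sat K φ (fun i => if i = 0 then x else y) ↔ x ∩ y ∈ K) := by
      intro K hK hxK
      rw [sat_ex]
      constructor
      · rintro ⟨z, hz, h⟩
        rw [sat_and, sat_allIn_of_mem hK (by omega) (by simpa using hz),
          sat_allIn_of_mem hK (by omega) (by simpa using hxK)] at h
        have : x ∩ y = z := by
          ext w
          rw [ZFSet.mem_inter]
          exact ⟨fun hw => by simpa [hw.1, hw.2] using h.2 w, fun hw => by simpa [hw] using h.1 w⟩
        rwa [this]
      · intro h
        refine ⟨_, h, ?_⟩
        rw [sat_and, sat_allIn_of_mem hK (by omega) (by simpa using h),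
          sat_allIn_of_mem hK (by omega) (by simpa using hxK)]
        simp +contextual
    have := sat_elementary_herClass i hi φ (fun i => if i = 0 then x else y)
      (fun i => by split_ifs <;> assumption)
    rw [key _ htrM hx, key _ htrH (hMH x hx)] at this
    exact this.2 ((hMH x hx).of_subset fun z hz => (ZFSet.mem_inter.1 hz).1)
  obtain ⟨h2, h3⟩ := pair_components_mem htrM hsM
  obtain ⟨hUM, hQM⟩ := pair_components_mem htrM h2
  obtain ⟨hDM, hFM⟩ := pair_components_mem htrM h3
  have hGM : GuessOrCover (M : Set ZFSet.{u}) (code ρ Set.univ) (smallCodes ρ κ)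
      (listCode ρ κ d) (funCode ρ f) := by
    have h4 := sat_elementary_herClass i hi SetFormula.guessOrCover
      (fun i => if i = 0 then code ρ Set.univ else if i = 1 then smallCodes ρ κ else
        if i = 2 then listCode ρ κ d else funCode ρ f)
      (fun i => by split_ifs <;> assumption)
    rw [sat_guessOrCover htrM (by simpa) (by simpa) (by simpa) (by simpa),
      sat_guessOrCover htrH (by simpa [herClass] using hUH) (by simpa [herClass] using hQH)
      (by simpa [herClass] using hDH) (by simpa [herClass] using hFH)] at h4
    simpa using h4.2 (by simpa using guessOrCover_herClass hl hXl hρ hinj hdich)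
  obtain ⟨N, hN, j, hcrit, S, hS, hSj⟩ := h1 M hZFC hκM hMc
    (seqClosed_of_subsetClosed hMcl htr hpair hκM)
  obtain ⟨k, hk, hkE⟩ := exists_isElementaryMap htr hN j
  have hfix : ∀ b < κ.ord, k b.toZFSet = b.toZFSet := by
    intro b hb
    have hbM : b.toZFSet ∈ M := htr _ hκM (Ordinal.toZFSet_mem_toZFSet_iff.2 hb)
    exact (hk ⟨_, hbM⟩).trans (hcrit.2 b hb hbM)
  have hne : k κ.ord.toZFSet ≠ κ.ord.toZFSet := by
    obtain ⟨h, hne⟩ := hcrit.1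
    rwa [← hk ⟨_, h⟩] at hne
  refine exists_guess_of_map hκ.1 hkE hMcl hpair hinter hκM hfix hne hS (fun y => ?_) hinj
    hUM hQM hDM hFM ?_ hGM
  · rw [hSj]
    exact ⟨fun ⟨x, hx⟩ => ⟨x, x.2, (hk x).trans hx⟩,
      fun ⟨x, hx, hxy⟩ => ⟨⟨x, hx⟩, (hk ⟨x, hx⟩).symm.trans hxy⟩⟩
  · rw [hU]
    exact Ordinal.toZFSet_monotone (ord_le_ord.2 hμκ)

end

/-! ### Clubs and directed unions -/

/-- Upper bounds of the finite subfamilies of a directed family can be chosen monotonically. -/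
theorem exists_monotone_upper_bounds {ι α : Type u} [Nonempty ι] {d : ι → Set α}
    (hd : Directed (· ⊆ ·) d) : ∃ w : Finset ι → ι, (∀ t, ∀ i ∈ t, d i ⊆ d (w t)) ∧
      ∀ s t, s ⊆ t → d (w s) ⊆ d (w t) := by
  classical
  choose ub hub using fun s : Finset ι => hd.finset_le s
  let w : Finset ι → ι := Finset.strongInduction fun t ih =>
    ub (t ∪ t.ssubsets.attach.image fun s => ih s.1 (Finset.mem_ssubsets.1 s.2))
  have hw : ∀ t, w t = ub (t ∪ t.ssubsets.attach.image fun s => w s.1) := fun t =>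
    Finset.strongInduction_eq _ t
  refine ⟨w, fun t i hi => ?_, fun s t hst => ?_⟩
  · rw [hw t]
    exact hub _ i (Finset.mem_union_left _ hi)
  · rcases hst.eq_or_ssubset with rfl | h
    · exact subset_rfl
    · rw [hw t]
      exact hub _ _ (Finset.mem_union_right _ (Finset.mem_image.2
        ⟨⟨s, Finset.mem_ssubsets.2 h⟩, Finset.mem_attach _ _, rfl⟩))

/-- A club is closed under directed unions of fewer than `κ` sets. By induction on the number of
sets: an infinite directed family of size `μ` is the union of an increasing chain of length `μ` of
directed families of smaller size, closed under the upper bounds of finite subfamilies. -/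
theorem IsClub.iUnion_mem {α : Type u} {κ : Cardinal.{u}} {X : Set α} {C : Set (Set α)}
    (hC : IsClub κ X C) : ∀ μ < κ, ∀ (ι : Type u) [Nonempty ι], #ι = μ → ∀ d : ι → Set α,
      Directed (· ⊆ ·) d → (∀ i, d i ∈ C) → (⋃ i, d i) ∈ C := by
  intro μ
  induction μ using WellFoundedLT.induction with
  | ind μ ih =>
  intro hμ ι _ hι d hd hdC
  obtain ⟨w, hw, hwm⟩ := exists_monotone_upper_bounds hd
  rcases finite_or_infinite ι with hfin | hinf
  · have := Fintype.ofFinite ι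
    have h : (⋃ i, d i) = d (w Finset.univ) :=
      subset_antisymm (Set.iUnion_subset fun i => hw _ i (Finset.mem_univ i))
        (Set.subset_iUnion d _)
    rw [h]
    exact hdC _
  · -- `r` enumerates `ι` in order type `μ`; the chain consists of the unions over the finite
    -- subsets of the initial segments
    obtain ⟨e⟩ : Nonempty (ι ≃ μ.ord.ToType) := Cardinal.eq.1 (by rw [hι, mk_ord_toType])
    have hμ0 : ℵ₀ ≤ μ := hι ▸ aleph0_le_mk ι
    let r : ι → Ordinal.{u} := fun k => (Ordinal.ToType.mk.symm (e k)).1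
    have hr : ∀ k, r k < μ.ord := fun k => (Ordinal.ToType.mk.symm (e k)).2
    have hrinj : Function.Injective r := fun a b hab =>
      e.injective (Ordinal.ToType.mk.symm.injective (Subtype.ext hab))
    have hsmall : ∀ i < μ.ord, #(Finset {k // r k < i}) < μ := by
      intro i hi
      have h1 : #{k // r k < i} ≤ i.card := by
        rw [← lift_le.{u + 1}, ← Cardinal.mk_Iio_ordinal, ← lift_id'.{u, u + 1} #(Set.Iio i)]
        refine lift_mk_le_lift_mk_of_injective
          (f := fun k : {k // r k < i} => (⟨r k, k.2⟩ : Set.Iio i)) ?_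
        intro a b hab
        have h : r a.1 = r b.1 := congrArg (fun z : Set.Iio i => z.1) hab
        exact Subtype.ext (hrinj h)
      have h2 : #{k // r k < i} < μ := h1.trans_lt (lt_ord.1 hi)
      rcases finite_or_infinite {k // r k < i} with h | h
      · exact (lt_aleph0_of_finite _).trans_le hμ0
      · rwa [mk_finset_of_infinite]
    let f : Set.Iio μ.ord → Set α := fun i =>
      ⋃ t : Finset {k // r k < i.1}, d (w (t.map (Function.Embedding.subtype _)))
    have hf : Monotone f := by
      intro i k hik
      refine Set.iUnion_subset fun t => ?_
      let g : {l // r l < i.1} ↪ {l // r l < k.1} :=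
        ⟨fun x => ⟨x.1, x.2.trans_le hik⟩, fun x y h => Subtype.ext (congrArg (fun z => z.1) h)⟩
      have h : t.map (Function.Embedding.subtype _) =
          (t.map g).map (Function.Embedding.subtype _) := by
        rw [Finset.map_map]; rfl
      change d (w (t.map _)) ⊆ _
      rw [h]
      exact Set.subset_iUnion
        (fun t : Finset {l // r l < k.1} => d (w (t.map (Function.Embedding.subtype _)))) (t.map g)
    have hfC : ∀ i, f i ∈ C := by
      intro i
      refine ih _ (hsmall i.1 i.2) ((hsmall i.1 i.2).trans hμ) _ rfl _ ?_ fun t => hdC _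
      intro s t
      classical
      exact ⟨s ∪ t, hwm _ _ (Finset.map_subset_map.2 Finset.subset_union_left),
        hwm _ _ (Finset.map_subset_map.2 Finset.subset_union_right)⟩
    have hlim : Order.IsSuccLimit μ.ord := isSuccLimit_ord hμ0
    have h := hC.2.2 μ.ord (ord_eq_zero.not.2 (aleph0_pos.trans_le hμ0).ne') (ord_lt_ord.2 hμ)
      f hf hfC
    convert h using 1
    refine subset_antisymm (Set.iUnion_subset fun k => ?_)
      (Set.iUnion_subset fun i => Set.iUnion_subset fun t => Set.subset_iUnion d _)
    refine Set.Subset.trans ?_ (Set.subset_iUnion f ⟨Order.succ (r k), hlim.succ_lt (hr k)⟩)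
    refine Set.Subset.trans ?_ (Set.subset_iUnion _ {⟨k, Order.lt_succ _⟩})
    exact hw _ k (by simp)

/-! ### Normal filters from the guessing principle -/

/-- A set closed under the set-valued binary operation `G`. -/
def ClosedUnder {X : Type u} (G : X → X → Set X) (x : Set X) : Prop :=
  ∀ a ∈ x, ∀ b ∈ x, G a b ⊆ x

open Filter in
/-- The guessing principle yields `κ`-complete filters on `P_κ X` that are fine, contain the sets
closed under given operations, are normal for a given family of regressive functions and decide a
given family of sets. They are generated by the sets of all `x` on which a fixed list agrees with
its guess on a given small set. The list lives on the disjoint sum of `X`, the index sets, and five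
markers. Its entry at an index of a function is the value of the function, its entry at an index of a
set to be decided is one of the markers `0`, `1`, and its entry at marker `4` records in the same way
whether `x` is closed under `G`. -/
theorem exists_normal_filter {κ lam : Cardinal.{u}} (hκ : κ.IsInaccessible) (hle : κ ≤ lam)
    (hP : ∀ μ ≤ lam, ∀ X : Type u, #X = μ → Guessing κ X)
    {X I J : Type u} [Nonempty X] (hX : #X ≤ lam) (hI : #I ≤ lam) (hJ : #J ≤ lam)
    (G : X → X → Set X) (hG : ∀ a b, #(G a b) < κ) (f : I → Set X → X)
    (hf : ∀ (i : I) (x : Set X), x.Nonempty → #x < κ → ClosedUnder G x → f i x ∈ x) (B : J → Set (Set X)) :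
    ∃ U : Filter (Set X), U.NeBot ∧
      (∀ (ι : Type u) (P : ι → Set X → Prop), #ι < κ → (∀ i, ∀ᶠ x in U, P i x) →
        ∀ᶠ x in U, ∀ i, P i x) ∧
      (∀ᶠ x : Set X in U, x.Nonempty ∧ #x < κ ∧ ClosedUnder G x) ∧ (∀ a, ∀ᶠ x in U, a ∈ x) ∧
      (∀ i, ∃ a, ∀ᶠ x in U, f i x = a) ∧ ∀ j, (∀ᶠ x in U, x ∈ B j) ∨ ∀ᶠ x in U, x ∉ B j := by
  classical
  have hl : ℵ₀ ≤ lam := hκ.1.le.trans hle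
  let X' := X ⊕ I ⊕ J ⊕ ULift.{u} (Fin 5)
  have hX' : #X' ≤ lam := by
    simp only [X', mk_sum, lift_id]
    exact add_le_of_le hl hX (add_le_of_le hl hI (add_le_of_le hl hJ
      ((lt_aleph0_of_finite _).le.trans hl)))
  let m : Fin 5 → X' := fun n => .inr (.inr (.inr ⟨n⟩))
  have hm : Function.Injective m := fun a b h =>
    ULift.up.inj (Sum.inr.inj (Sum.inr.inj (Sum.inr.inj h)))
  let tr : Set X' → Set X := fun x => Sum.inl ⁻¹' x
  -- if `x` is not closed, the markers `2` and `3` point to a pair witnessing this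
  have hwit : ∀ x : Set X, ∃ p : X × X, ¬ ClosedUnder G x → p.1 ∈ x ∧ p.2 ∈ x ∧ ¬ G p.1 p.2 ⊆ x := by
    intro x
    by_cases h : ClosedUnder G x
    · exact ⟨(Classical.arbitrary X, Classical.arbitrary X), fun h' => absurd h h'⟩
    · have h' := h
      simp only [ClosedUnder, not_forall] at h'
      obtain ⟨a, ha, b, hb, hab⟩ := h'
      exact ⟨(a, b), fun _ => ⟨ha, hb, hab⟩⟩
  choose wit hwit using hwit
  let val : Set X' → X' → X' := fun x z => match z with
    | .inl a => .inl a
    | .inr (.inl i) => .inl (f i (tr x))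
    | .inr (.inr (.inl j)) => if tr x ∈ B j then m 0 else m 1
    | .inr (.inr (.inr ⟨n⟩)) =>
      if n = 2 then .inl (wit (tr x)).1 else if n = 3 then .inl (wit (tr x)).2
      else if n = 4 then (if ClosedUnder G (tr x) then m 0 else m 1) else m n
  let d : Set X' → X' → X' := fun x z => if val x z ∈ x then val x z else z
  obtain ⟨c, hc⟩ := hP _ hX' X' rfl d (by
    intro x a ha
    simp only [d]
    split_ifs with h <;> assumption)
  let E : Set X' → Set X' → Prop := fun s x => #x < κ ∧ s ⊆ x ∧ ∀ a ∈ s, d x a = c a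
  have hE : ∀ s : Set X', #s < κ → ∃ x, E s x := hc
  have hreg := hκ.isRegular
  have hfin : ∀ s : Set X', s.Finite → #s < κ := fun s hs => hs.lt_aleph0.trans hκ.1
  have hun : ∀ s t : Set X', #s < κ → #t < κ → #(s ∪ t : Set X') < κ := fun s t hs ht =>
    (mk_union_le s t).trans_lt (add_lt_of_lt hκ.1.le hs ht)
  let U : Filter (Set X) :=
    { sets := {A | ∃ s : Set X', #s < κ ∧ ∀ x, E s x → tr x ∈ A}
      univ_sets := ⟨∅, hfin _ Set.finite_empty, fun _ _ => trivial⟩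
      sets_of_superset := fun ⟨s, hs, h⟩ hAB => ⟨s, hs, fun x hx => hAB (h x hx)⟩
      inter_sets := by
        rintro A A' ⟨s, hs, h⟩ ⟨s', hs', h'⟩
        refine ⟨s ∪ s', hun _ _ hs hs', fun x hx => ⟨h x ?_, h' x ?_⟩⟩
        · exact ⟨hx.1, Set.subset_union_left.trans hx.2.1, fun a ha => hx.2.2 a (.inl ha)⟩
        · exact ⟨hx.1, Set.subset_union_right.trans hx.2.1, fun a ha => hx.2.2 a (.inr ha)⟩ }
  have hU : ∀ P : Set X → Prop, (∀ᶠ x in U, P x) ↔ ∃ s : Set X', #s < κ ∧ ∀ x, E s x → P (tr x) :=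
    fun P => Iff.rfl
  have hne : U.NeBot := by
    rw [← Filter.empty_mem_iff_bot.not.trans neBot_iff.symm]
    rintro ⟨s, hs, h⟩
    obtain ⟨x, hx⟩ := hE s hs
    exact h x hx
  have hcomp : ∀ (ι : Type u) (P : ι → Set X → Prop), #ι < κ → (∀ i, ∀ᶠ x in U, P i x) →
        ∀ᶠ x in U, ∀ i, P i x := by
    intro ι P hι h
    choose s hs hsP using fun i => (hU _).1 (h i)
    refine (hU _).2 ⟨⋃ i, s i, ?_, fun x hx i => hsP i x ⟨hx.1,
      (Set.subset_iUnion s i).trans hx.2.1, fun a ha => hx.2.2 a (Set.mem_iUnion.2 ⟨i, ha⟩)⟩⟩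
    exact (mk_iUnion_le_sum_mk).trans_lt (sum_lt_of_isRegular hreg hι hs)
  have hfine : ∀ a, ∀ᶠ x in U, a ∈ x := fun a =>
    (hU _).2 ⟨{.inl a}, hfin _ (Set.finite_singleton _), fun x hx => hx.2.1 rfl⟩
  -- the guess is the actual entry unless the entry lies outside of `x`
  have hd : ∀ s x, E s x → ∀ z ∈ s, val x z ∈ x → val x z = c z := by
    intro s x hx z hz hv
    rw [← hx.2.2 z hz]
    simp [d, hv]
  have hnonempty : ∀ᶠ x in U, x.Nonempty :=
    (hfine (Classical.arbitrary X)).mono fun x hx => ⟨_, hx⟩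
  have hsmall : ∀ᶠ x : Set X in U, #x < κ := by
    refine (hU _).2 ⟨∅, hfin _ Set.finite_empty, fun x hx => ?_⟩
    exact (mk_preimage_of_injective _ _ Sum.inl_injective).trans_lt hx.1
  have hclosed : ∀ᶠ x in U, ClosedUnder G x := by
    let M : Set X' := {m 0, m 1, m 2, m 3, m 4}
    have hM : M.Finite := by simp [M]
    have h4 : ∀ s x, M ⊆ s → E s x → (if ClosedUnder G (tr x) then m 0 else m 1) = c (m 4) := by
      intro s x hMs hx
      refine hd s x hx (m 4) (hMs (by simp [M])) ?_
      change (if ClosedUnder G (tr x) then m 0 else m 1) ∈ x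
      split_ifs
      · exact hx.2.1 (hMs (by simp [M]))
      · exact hx.2.1 (hMs (by simp [M]))
    have h2 : ∀ s x, M ⊆ s → E s x → ¬ ClosedUnder G (tr x) →
        .inl (wit (tr x)).1 = c (m 2) ∧ .inl (wit (tr x)).2 = c (m 3) := by
      intro s x hMs hx hcl
      obtain ⟨h1, h2, -⟩ := hwit _ hcl
      exact ⟨hd s x hx (m 2) (hMs (by simp [M])) h1, hd s x hx (m 3) (hMs (by simp [M])) h2⟩
    by_cases hc4 : c (m 4) = m 0
    · refine (hU _).2 ⟨M, hfin _ hM, fun x hx => ?_⟩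
      by_contra hcl
      have := h4 M x subset_rfl hx
      rw [if_neg hcl, hc4] at this
      exact absurd (hm this) (by decide)
    · -- otherwise the guess fixes a pair `(a, b)` with `G a b` not included in `x`, and a larger
      -- guessed set includes `G a b`
      exfalso
      have hncl : ∀ s x, M ⊆ s → E s x → ¬ ClosedUnder G (tr x) := by
        intro s x hMs hx hcl
        have := h4 s x hMs hx
        rw [if_pos hcl] at this
        exact hc4 this.symm
      obtain ⟨x₀, hx₀⟩ := hE M (hfin _ hM)
      obtain ⟨ha, hb⟩ := h2 M x₀ subset_rfl hx₀ (hncl M x₀ subset_rfl hx₀)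
      set a := (wit (tr x₀)).1
      set b := (wit (tr x₀)).2
      have hs : #(M ∪ Sum.inl '' G a b : Set X') < κ :=
        hun _ _ (hfin _ hM) (mk_image_le.trans_lt (hG a b))
      obtain ⟨x, hx⟩ := hE _ hs
      have hcl := hncl _ x Set.subset_union_left hx
      obtain ⟨ha', hb'⟩ := h2 _ x Set.subset_union_left hx hcl
      have e1 : (wit (tr x)).1 = a := Sum.inl_injective (ha'.trans ha.symm)
      have e2 : (wit (tr x)).2 = b := Sum.inl_injective (hb'.trans hb.symm)
      refine (hwit _ hcl).2.2 ?_
      rw [e1, e2]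
      intro z hz
      exact hx.2.1 (Or.inr ⟨z, hz, rfl⟩)
  have hgood : ∀ᶠ x : Set X in U, x.Nonempty ∧ #x < κ ∧ ClosedUnder G x :=
    hnonempty.and (hsmall.and hclosed)
  refine ⟨U, hne, hcomp, hgood, hfine, fun i => ?_, fun j => ?_⟩
  · have h : ∀ᶠ x in U, (Sum.inl (f i x) : X') = c (.inr (.inl i)) := by
      obtain ⟨s, hs, hsg⟩ := (hU _).1 hgood
      refine (hU _).2 ⟨s ∪ {.inr (.inl i)}, hun _ _ hs (hfin _ (Set.finite_singleton _)),
        fun x hx => ?_⟩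
      have hg := hsg x ⟨hx.1, Set.subset_union_left.trans hx.2.1, fun a ha => hx.2.2 a (.inl ha)⟩
      exact hd _ x hx (.inr (.inl i)) (Or.inr rfl) (hf i (tr x) hg.1 hg.2.1 hg.2.2)
    obtain ⟨x₀, hx₀⟩ := h.exists
    exact ⟨f i x₀, h.mono fun x hx => Sum.inl_injective (hx.trans hx₀.symm)⟩
  · have h : ∀ᶠ x in U, (if x ∈ B j then m 0 else m 1) = c (.inr (.inr (.inl j))) := by
      refine (hU _).2 ⟨{m 0, m 1, .inr (.inr (.inl j))}, hfin _ (by simp), fun x hx => ?_⟩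
      refine hd _ x hx (.inr (.inr (.inl j))) (by simp) ?_
      change (if tr x ∈ B j then m 0 else m 1) ∈ x
      split_ifs
      · exact hx.2.1 (by simp)
      · exact hx.2.1 (by simp)
    by_cases hc0 : c (.inr (.inr (.inl j))) = m 0
    · left
      refine h.mono fun x hx => ?_
      by_contra hxB
      rw [if_neg hxB, hc0] at hx
      exact absurd (hm hx) (by decide)
    · right
      refine h.mono fun x hx hxB => ?_
      rw [if_pos hxB] at hx
      exact hc0 hx.symm

/-! ### Free variables and the number of infinitary formulas -/

namespace InfFormula

variable {L : FirstOrder.Language.{u, u}} {μ : Cardinal.{u}}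

theorem term_realize_congr {A : Type u} [L.Structure A] [DecidableEq (Var μ)]
    (t : L.Term (Var μ)) {v w : Var μ → A} (h : ∀ y ∈ t.varFinset, v y = w y) :
    t.realize v = t.realize w := by
  induction t with
  | var => exact h _ (by simp)
  | func F ts ih =>
    exact congrArg _ (funext fun i => ih i fun y hy => h y (by simpa using ⟨i, hy⟩))

/-- Satisfaction depends only on the values of the free variables. -/
theorem realize_congr {A : Type u} [L.Structure A] (φ : InfFormula L μ) {v w : Var μ → A}
    (h : ∀ y ∈ φ.freeVars, v y = w y) : φ.Realize v ↔ φ.Realize w := by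
  classical
  induction φ generalizing v w with
  | equal s t =>
    simp only [Realize]
    rw [term_realize_congr s (v := v) (w := w) fun y hy => h y (Or.inl (by convert Finset.mem_coe.2 hy)),
      term_realize_congr t (v := v) (w := w) fun y hy => h y (Or.inr (by convert Finset.mem_coe.2 hy))]
  | rel R ts =>
    simp only [Realize]
    rw [iff_iff_eq]
    congr 1
    exact funext fun i => term_realize_congr (ts i) fun y hy =>
      h y (Set.mem_iUnion.2 ⟨i, by convert Finset.mem_coe.2 hy⟩)
  | neg φ ih => exact not_congr (ih h)
  | conj S hS φ ih =>
    exact forall_congr' fun i => ih i fun y hy => h y (Set.mem_iUnion.2 ⟨i, hy⟩)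
  | all V hV φ ih =>
    simp only [Realize]
    have key : ∀ {v w : Var μ → A}, (∀ y ∈ φ.freeVars \ V, v y = w y) →
        (∀ v', (∀ x, x ∉ V → v' x = v x) → φ.Realize v') →
        ∀ w', (∀ x, x ∉ V → w' x = w x) → φ.Realize w' := by
      intro v w h hv w' hw'
      have := hv (fun x => if x ∈ V then w' x else v x) fun x hx => by simp [hx]
      refine (ih fun y hy => ?_).1 this
      by_cases hyV : y ∈ V
      · simp [hyV]
      · simp [hyV, hw' y hyV, h y ⟨hy, hyV⟩]
    exact ⟨key h, key fun y hy => (h y hy).symm⟩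

theorem mk_freeVars_lt (hμ : μ.IsRegular) (φ : InfFormula L μ) : #φ.freeVars < μ := by
  classical
  have hfin : ∀ s : Set (Var μ), s.Finite → #s < μ := fun s hs =>
    hs.lt_aleph0.trans_le hμ.aleph0_le
  induction φ with
  | equal s t => exact hfin _ ((Finset.finite_toSet _).union (Finset.finite_toSet _))
  | rel R ts => exact hfin _ (Set.finite_iUnion fun i => Finset.finite_toSet _)
  | neg φ ih => exact ih
  | conj S hS φ ih =>
    exact (mk_iUnion_le_sum_mk).trans_lt (sum_lt_of_isRegular hμ hS ih)
  | all V hV φ ih => exact (mk_le_mk_of_subset Set.sdiff_subset).trans_lt ih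

/-- The shapes of the nodes in the syntax tree of a formula. -/
inductive Node (L : FirstOrder.Language.{u, u}) (μ : Cardinal.{u}) : Type u
  | equal (s t : L.Term (Var μ))
  | rel (R : Σ n, L.Relations n × (Fin n → L.Term (Var μ)))
  | neg
  | conj (S : {S : Set (Var μ) // #S < μ})
  | all (V : {V : Set (Var μ) // #V < μ})

/-- The number of subtrees at a node of the syntax tree. -/
def Node.Arity : Node L μ → Type u
  | .equal _ _ => PEmpty
  | .rel _ => PEmpty
  | .neg => PUnit
  | .conj S => S.1
  | .all _ => PUnit

/-- The syntax tree of a formula. -/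
def tree : InfFormula L μ → WType (Node.Arity (L := L) (μ := μ))
  | .equal s t => ⟨.equal s t, PEmpty.elim⟩
  | .rel R ts => ⟨.rel ⟨_, R, ts⟩, PEmpty.elim⟩
  | .neg φ => ⟨.neg, fun _ => φ.tree⟩
  | .conj S hS φ => ⟨.conj ⟨S, hS⟩, fun i => (φ i).tree⟩
  | .all V hV φ => ⟨.all ⟨V, hV⟩, fun _ => φ.tree⟩

theorem tree_injective : Function.Injective (tree (L := L) (μ := μ)) := by
  intro φ
  induction φ with
  | equal s t =>
    intro ψ h
    cases ψ with
    | equal s' t' =>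
      obtain ⟨rfl, rfl⟩ := Node.equal.inj (WType.mk.inj h).1
      rfl
    | _ => exact nomatch (WType.mk.inj h).1
  | rel R ts =>
    intro ψ h
    cases ψ with
    | rel R' ts' =>
      obtain ⟨rfl, h⟩ := Sigma.mk.inj_iff.1 (Node.rel.inj (WType.mk.inj h).1)
      obtain ⟨rfl, rfl⟩ := Prod.mk.inj (eq_of_heq h)
      rfl
    | _ => exact nomatch (WType.mk.inj h).1
  | neg φ ih =>
    intro ψ h
    cases ψ with
    | neg ψ => exact congrArg _ (ih (congrFun (eq_of_heq (WType.mk.inj h).2) PUnit.unit))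
    | _ => exact nomatch (WType.mk.inj h).1
  | conj S hS φ ih =>
    intro ψ h
    cases ψ with
    | conj S' hS' ψ =>
      obtain rfl : S = S' := congrArg Subtype.val (Node.conj.inj (WType.mk.inj h).1)
      congr 1
      exact funext fun i => ih i (congrFun (eq_of_heq (WType.mk.inj h).2) i)
    | _ => exact nomatch (WType.mk.inj h).1
  | all V hV φ ih =>
    intro ψ h
    cases ψ with
    | all V' hV' ψ =>
      obtain rfl : V = V' := congrArg Subtype.val (Node.all.inj (WType.mk.inj h).1)
      congr 1
      exact ih (congrFun (eq_of_heq (WType.mk.inj h).2) PUnit.unit)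
    | _ => exact nomatch (WType.mk.inj h).1

end InfFormula

theorem power_le_of_lt {κ lam : Cardinal.{u}} (hlam : lam = lam ^< κ) {ν : Cardinal.{u}}
    (h : ν < κ) : lam ^ ν ≤ lam :=
  (le_powerlt lam h).trans hlam.ge

/-- A language of size at most `lam` has at most `lam` many infinitary formulas, as a syntax tree
has at most `lam` many shapes of nodes, with fewer than `κ` subtrees each. -/
theorem mk_infFormula_le {κ lam : Cardinal.{u}} (hκ : κ.IsInaccessible) (hle : κ ≤ lam)
    (hlam : lam = lam ^< κ) {L : FirstOrder.Language.{u, u}} (hL : L.card ≤ lam) :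
    #(InfFormula L κ) ≤ lam := by
  have hl : ℵ₀ ≤ lam := hκ.1.le.trans hle
  have hfin : ∀ n : ℕ, (n : Cardinal.{u}) < κ := fun n => (natCast_lt_aleph0).trans hκ.1
  have hone : lam ^ (1 : Cardinal.{u}) ≤ lam := (power_one _).le
  have hzero : lam ^ (0 : Cardinal.{u}) ≤ lam := by
    rw [power_zero]; exact one_le_aleph0.trans hl
  have hvar : #(Var κ) ≤ lam := by rw [mk_out]; exact hle
  rw [Language.card_eq_card_functions_add_card_relations] at hL
  simp only [lift_id] at hL
  have hfun : #(Σ n, L.Functions n) ≤ lam := by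
    rw [mk_sigma]; exact (self_le_add_right _ _).trans hL
  have hrel : #(Σ n, L.Relations n) ≤ lam := by
    rw [mk_sigma]; exact (self_le_add_left _ _).trans hL
  have hterm : #(L.Term (Var κ)) ≤ lam := by
    refine Language.Term.card_le.trans (max_le hl ?_)
    rw [mk_sum]
    simp only [lift_id]
    exact add_le_of_le hl hvar hfun
  have hsets := mk_small_subsets_le hκ hle hlam hvar
  have hR : #(Σ n, L.Relations n × (Fin n → L.Term (Var κ))) ≤ lam := by
    let f : (Σ n, L.Relations n × (Fin n → L.Term (Var κ))) →
        (Σ n, L.Relations n) × (Σ n, ULift.{u} (Fin n) → L.Term (Var κ)) := fun R =>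
      (⟨R.1, R.2.1⟩, ⟨R.1, fun i => R.2.2 i.down⟩)
    have hf : Function.Injective f := by
      rintro ⟨n, R, ts⟩ ⟨m, R', ts'⟩ h
      simp only [f, Prod.mk.injEq, Sigma.mk.injEq] at h
      obtain ⟨⟨rfl, h1⟩, -, h2⟩ := h
      obtain rfl := eq_of_heq h1
      have : ts = ts' := funext fun i => congrFun (eq_of_heq h2) ⟨i⟩
      rw [this]
    refine (mk_le_of_injective hf).trans ?_
    rw [mk_prod]
    simp only [lift_id]
    refine (mul_le_mul' hrel ?_).trans (mul_eq_self hl).le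
    rw [mk_sigma]
    refine (sum_le_sum _ (fun _ => lam) fun n => ?_).trans ?_
    · rw [← power_def]
      exact (power_le_power_right hterm).trans (power_le_of_lt hlam (by simpa using hfin n))
    · rw [sum_const]
      simp only [mk_nat, lift_aleph0, lift_uzero]
      exact (mul_le_mul_left hl lam).trans (mul_eq_self hl).le
  have hnode : #(InfFormula.Node L κ) ≤ lam := by
    let f : InfFormula.Node L κ → (L.Term (Var κ) × L.Term (Var κ)) ⊕
        (Σ n, L.Relations n × (Fin n → L.Term (Var κ))) ⊕ PUnit.{u + 1} ⊕
        {S : Set (Var κ) // #S < κ} ⊕ {S : Set (Var κ) // #S < κ}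
      | .equal s t => .inl (s, t)
      | .rel R => .inr (.inl R)
      | .neg => .inr (.inr (.inl ⟨⟩))
      | .conj S => .inr (.inr (.inr (.inl S)))
      | .all S => .inr (.inr (.inr (.inr S)))
    have hf : Function.Injective f := by
      intro a b h
      cases a <;> cases b <;>
        simp only [f, Sum.inl.injEq, Sum.inr.injEq, reduceCtorEq, Prod.mk.injEq] at h
      · rw [h.1, h.2]
      all_goals simp [h]
    refine (mk_le_of_injective hf).trans ?_
    simp only [mk_sum, lift_id, mk_prod]
    exact add_le_of_le hl ((mul_le_mul' hterm hterm).trans (mul_eq_self hl).le)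
      (add_le_of_le hl hR (add_le_of_le hl ((mk_le_aleph0).trans hl) (add_le_of_le hl hsets hsets)))
  refine (mk_le_of_injective InfFormula.tree_injective).trans (WType.cardinalMk_le_of_le ?_)
  refine (sum_le_sum _ (fun _ => lam) fun a => ?_).trans ?_
  · cases a with
    | equal s t => simpa [InfFormula.Node.Arity] using hzero
    | rel R => simpa [InfFormula.Node.Arity] using hzero
    | neg => simp [InfFormula.Node.Arity]
    | conj S => exact power_le_of_lt hlam S.2
    | all V => simp [InfFormula.Node.Arity]
  · rw [sum_const']
    exact (mul_le_mul_left hnode lam).trans (mul_eq_self hl).le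

/-! ### Reduced products of Skolem terms -/

section SkolemTerm

variable (L : FirstOrder.Language.{u, u}) (κ : Cardinal.{u})

/-- The operations on the elements of a structure that are used to form Skolem terms: the function
symbols, and, for a formula `φ` and a set `V` of variables, the coordinates of a function that
chooses for given values of the remaining free variables of `φ` a counterexample to `φ`. -/
inductive SkolemOp : Type u
  | func (F : Σ n, L.Functions n)
  | skolem (φ : InfFormula L κ) (V : {V : Set (Var κ) // #V < κ}) (y : Var κ)

variable {L κ}

/-- The arity of a Skolem operation. -/
def SkolemOp.Arity : SkolemOp L κ → Type u
  | func F => ULift (Fin F.1)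
  | skolem φ V _ => ↥(φ.freeVars \ V.1)

variable (L κ) in
/-- Closed infinitary terms built from the Skolem operations. -/
abbrev SkolemTerm : Type u := WType (SkolemOp.Arity (L := L) (κ := κ))

/-- An assignment refuting `φ` with the given values outside `V`, if there is one. -/
noncomputable def refutation {A : Type u} [Nonempty A] [L.Structure A] (φ : InfFormula L κ)
    (V : Set (Var κ)) (w : ↥(φ.freeVars \ V) → A) : Var κ → A :=
  Classical.epsilon fun v => (∀ y, v y.1 = w y) ∧ ¬ φ.Realize v

theorem refutation_spec {A : Type u} [Nonempty A] [L.Structure A] (φ : InfFormula L κ)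
    {V : Set (Var κ)} {v : Var κ → A} {v' : Var κ → A} (h : ∀ y, y ∉ V → v' y = v y)
    (hφ : ¬ φ.Realize v') : (∀ y : ↥(φ.freeVars \ V), refutation φ V (fun y => v y) y.1 = v y) ∧
      ¬ φ.Realize (refutation φ V fun y => v y) :=
  Classical.epsilon_spec (p := fun w : Var κ → A =>
    (∀ y : ↥(φ.freeVars \ V), w y.1 = v y) ∧ ¬ φ.Realize w) ⟨v', fun y => h _ y.2.2, hφ⟩

/-- The interpretation of a Skolem operation in a structure. -/
noncomputable def SkolemOp.interp (A : Type u) [Nonempty A] [L.Structure A] :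
    ∀ o : SkolemOp L κ, (o.Arity → A) → A
  | func F, w => Language.Structure.funMap F.2 fun i => w ⟨i⟩
  | skolem φ V y, w => refutation φ V.1 w y

/-- The value of a Skolem term in a structure. -/
noncomputable def SkolemTerm.eval (A : Type u) [Nonempty A] [L.Structure A]
    (t : SkolemTerm L κ) : A :=
  WType.elim A (fun s => SkolemOp.interp A s.1 s.2) t

theorem mk_skolemTerm_le {lam : Cardinal.{u}} (hκ : κ.IsInaccessible) (hle : κ ≤ lam)
    (hlam : lam = lam ^< κ) (hL : L.card ≤ lam) : #(SkolemTerm L κ) ≤ lam := by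
  have hl : ℵ₀ ≤ lam := hκ.1.le.trans hle
  have hvar : #(Var κ) ≤ lam := by rw [mk_out]; exact hle
  have hfun : #(Σ n, L.Functions n) ≤ lam := by
    rw [mk_sigma]
    rw [Language.card_eq_card_functions_add_card_relations] at hL
    simp only [lift_id] at hL
    exact (self_le_add_right _ _).trans hL
  have hop : #(SkolemOp L κ) ≤ lam := by
    let f : SkolemOp L κ → (Σ n, L.Functions n) ⊕
        (InfFormula L κ × {V : Set (Var κ) // #V < κ} × Var κ)
      | .func F => .inl F
      | .skolem φ V y => .inr (φ, V, y)
    have hf : Function.Injective f := by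
      intro a b h
      cases a <;> cases b <;>
        simp only [f, Sum.inl.injEq, Sum.inr.injEq, reduceCtorEq, Prod.mk.injEq] at h
      · rw [h]
      · rw [h.1, h.2.1, h.2.2]
    refine (mk_le_of_injective hf).trans ?_
    simp only [mk_sum, lift_id, mk_prod]
    have hm : ∀ {a b : Cardinal.{u}}, a ≤ lam → b ≤ lam → a * b ≤ lam := fun ha hb =>
      (mul_le_mul' ha hb).trans (mul_eq_self hl).le
    exact add_le_of_le hl hfun (hm (mk_infFormula_le hκ hle hlam hL)
      (hm (mk_small_subsets_le hκ hle hlam hvar) hvar))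
  refine WType.cardinalMk_le_of_le ((sum_le_sum _ (fun _ => lam) fun o => ?_).trans ?_)
  · refine power_le_of_lt hlam ?_
    cases o with
    | func F => exact (lt_aleph0_of_finite (ULift (Fin F.1))).trans hκ.1
    | skolem φ V y =>
      exact (mk_le_mk_of_subset Set.sdiff_subset).trans_lt (φ.mk_freeVars_lt hκ.isRegular)
  · rw [sum_const']
    exact (mul_le_mul_left hop lam).trans (mul_eq_self hl).le

end SkolemTerm

section Los

open Filter

variable {L : FirstOrder.Language.{u, u}} {κ : Cardinal.{u}} {Ω : Type u} (A : Ω → Type u)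
  [∀ x, Nonempty (A x)] [∀ x, L.Structure (A x)] (U : Filter Ω)

/-- Skolem terms are identified if their values agree on a set in the filter. -/
def skolemSetoid : Setoid (SkolemTerm L κ) where
  r s t := ∀ᶠ x in U, s.eval (A x) = t.eval (A x)
  iseqv :=
    { refl := fun _ => Eventually.of_forall fun _ => rfl
      symm := fun h => h.mono fun _ h => h.symm
      trans := fun h h' => (h.and h').mono fun _ h => h.1.trans h.2 }

variable (L κ) in
/-- The reduced product, restricted to the elements named by Skolem terms. -/
def SkolemProduct : Type u := Quotient (skolemSetoid (L := L) (κ := κ) A U)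

namespace SkolemProduct

/-- The element of the product named by a Skolem term. -/
def mk (t : SkolemTerm L κ) : SkolemProduct L κ A U := Quotient.mk (skolemSetoid A U) t

/-- A name for an element of the product. -/
noncomputable def name (a : SkolemProduct L κ A U) : SkolemTerm L κ := Quotient.out a

variable {A U}

@[simp]
theorem mk_name (a : SkolemProduct L κ A U) : mk A U a.name = a := Quotient.out_eq a

theorem mk_eq_mk {s t : SkolemTerm L κ} :
    mk A U s = mk A U t ↔ ∀ᶠ x in U, s.eval (A x) = t.eval (A x) := Quotient.eq

theorem name_mk (t : SkolemTerm L κ) : ∀ᶠ x in U, (mk A U t).name.eval (A x) = t.eval (A x) :=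
  mk_eq_mk.1 (mk_name _)

noncomputable instance : L.Structure (SkolemProduct L κ A U) where
  funMap F q := mk A U (WType.mk (.func ⟨_, F⟩) fun i => (q i.down).name)
  RelMap R q := ∀ᶠ x in U, Language.Structure.RelMap R fun i => (q i).name.eval (A x)

/-- Substitution of Skolem terms in a term of the language. -/
def substTerm (σ : Var κ → SkolemTerm L κ) : L.Term (Var κ) → SkolemTerm L κ
  | .var y => σ y
  | .func F ts => WType.mk (.func ⟨_, F⟩) fun i => substTerm σ (ts i.down)

theorem eval_substTerm (σ : Var κ → SkolemTerm L κ) (t : L.Term (Var κ)) (x : Ω) :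
    (substTerm σ t).eval (A x) = t.realize fun y => (σ y).eval (A x) := by
  induction t with
  | var => rfl
  | func F ts ih =>
    change Language.Structure.funMap F _ = Language.Structure.funMap F _
    exact congrArg _ (funext ih)

theorem realize_eq_mk (σ : Var κ → SkolemTerm L κ) (t : L.Term (Var κ)) :
    t.realize (fun y => mk A U (σ y)) = mk A U (substTerm σ t) := by
  induction t with
  | var => rfl
  | func F ts ih =>
    change mk A U _ = mk A U _
    rw [mk_eq_mk]
    have h : ∀ i, ∀ᶠ x in U, (Language.Term.realize (fun y => mk A U (σ y)) (ts i)).name.eval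
        (A x) = (substTerm σ (ts i)).eval (A x) := fun i => by
      rw [ih]; exact name_mk _
    filter_upwards [eventually_all.2 h] with x hx
    change Language.Structure.funMap F _ = Language.Structure.funMap F _
    exact congrArg _ (funext hx)

/-- Łoś's theorem for the infinitary logic, for a filter that is `κ`-complete and decides the truth
of all formulas at Skolem terms. -/
theorem realize_iff [U.NeBot] (hU : ∀ (ι : Type u) (P : ι → Ω → Prop), #ι < κ →
      (∀ i, ∀ᶠ x in U, P i x) → ∀ᶠ x in U, ∀ i, P i x)
    (hdec : ∀ (φ : InfFormula L κ) (σ : Var κ → SkolemTerm L κ),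
      (∀ᶠ x in U, φ.Realize fun y => (σ y).eval (A x)) ∨
        ∀ᶠ x in U, ¬ φ.Realize fun y => (σ y).eval (A x))
    (φ : InfFormula L κ) (σ : Var κ → SkolemTerm L κ) :
    φ.Realize (fun y => mk A U (σ y)) ↔ ∀ᶠ x in U, φ.Realize fun y => (σ y).eval (A x) := by
  classical
  have hneg : ∀ (φ : InfFormula L κ) (σ : Var κ → SkolemTerm L κ),
      (¬ ∀ᶠ x in U, φ.Realize fun y => (σ y).eval (A x)) ↔
        ∀ᶠ x in U, ¬ φ.Realize fun y => (σ y).eval (A x) := fun φ σ => by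
    refine ⟨(hdec φ σ).resolve_left, fun h h' => ?_⟩
    obtain ⟨x, hx, hx'⟩ := (h.and h').exists
    exact hx hx'
  induction φ generalizing σ with
  | equal s t =>
    simp only [InfFormula.Realize, realize_eq_mk, mk_eq_mk, eval_substTerm]
  | rel R ts =>
    simp only [InfFormula.Realize, realize_eq_mk]
    have h : ∀ᶠ x in U, ∀ i, (mk A U (substTerm σ (ts i))).name.eval (A x) =
        (ts i).realize fun y => (σ y).eval (A x) :=
      eventually_all.2 fun i => (name_mk _).mono fun x hx => hx.trans (eval_substTerm _ _ _)
    refine eventually_congr (h.mono fun x hx => ?_)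
    rw [funext hx]
  | neg φ ih =>
    exact (not_congr (ih σ)).trans (hneg φ σ)
  | conj S hS φ ih =>
    simp only [InfFormula.Realize]
    rw [forall_congr' fun i => ih i σ]
    exact ⟨hU S _ hS, fun h i => h.mono fun x hx => hx i⟩
  | all V hV φ ih =>
    constructor
    · intro h
      by_contra hcon
      rw [hneg (.all V hV φ)] at hcon
      -- the Skolem terms for `φ` name a counterexample
      let τ : Var κ → SkolemTerm L κ := fun y =>
        if y ∈ V then WType.mk (.skolem φ ⟨V, hV⟩ y) fun z => σ z.1 else σ y
      have hτ := (ih τ).1 (h _ fun y hy => by simp [τ, hy])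
      obtain ⟨x, hx, hx'⟩ := (hτ.and hcon).exists
      simp only [InfFormula.Realize, not_forall] at hx'
      obtain ⟨w, hw, hφw⟩ := hx'
      obtain ⟨h1, h2⟩ := refutation_spec φ hw hφw
      refine h2 ((φ.realize_congr fun y hy => ?_).1 hx)
      by_cases hyV : y ∈ V
      · simp only [τ, if_pos hyV]
        rfl
      · simp only [τ, if_neg hyV]
        exact (h1 ⟨y, hy, hyV⟩).symm
    · intro h w hw
      let τ : Var κ → SkolemTerm L κ := fun y => if y ∈ V then (w y).name else σ y
      have hτ : w = fun y => mk A U (τ y) := by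
        funext y
        by_cases hyV : y ∈ V
        · simp [τ, hyV]
        · simp [τ, hyV, hw y hyV]
      rw [hτ]
      exact (ih τ).2 <| h.mono fun x hx => hx _ fun y hy => by simp [τ, hy]

end SkolemProduct

end Los

/-! ### Compactness with type omission from the guessing principle -/

theorem IsClub.nonempty {α : Type u} {κ : Cardinal.{u}} {X : Set α} {C : Set (Set α)}
    (hC : IsClub κ X C) (hκ : 0 < κ) : C.Nonempty := by
  obtain ⟨y, hy, -⟩ := hC.2.1 ∅ (Set.empty_subset _) (by simpa using hκ)
  exact ⟨y, hy⟩

/-- For a club `C` in `P_κ X` there are set-valued operations on the disjoint sum of the underlying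
type and `C` such that the trace on `X` of every nonempty small set closed under them
belongs to `C`: they provide a member of `C` containing a given point, an upper bound of
two members, and the elements of a member, which makes the trace a directed union. -/
theorem IsClub.exists_operation {α : Type u} {κ : Cardinal.{u}} (hκ : κ.IsInaccessible)
    {X : Set α} {C : Set (Set α)} (hC : IsClub κ X C) :
    ∃ G : α ⊕ C → α ⊕ C → Set (α ⊕ C), (∀ a b, #(G a b) < κ) ∧
      ∀ x : Set (α ⊕ C), x.Nonempty → #x < κ → ClosedUnder G x → (Sum.inl ⁻¹' x) ∩ X ∈ C := by
  classical
  have hreg := hκ.isRegular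
  have hfin : ∀ s : Set (α ⊕ C), s.Finite → #s < κ := fun s hs => hs.lt_aleph0.trans hκ.1
  obtain ⟨D₀, hD₀⟩ := hC.nonempty hreg.pos
  have hcover : ∀ a, ∃ D : C, a ∈ X → a ∈ D.1 := by
    intro a
    by_cases ha : a ∈ X
    · obtain ⟨y, hy, hay⟩ := hC.2.1 {a} (Set.singleton_subset_iff.2 ha)
        ((Set.finite_singleton a).lt_aleph0.trans hκ.1)
      exact ⟨⟨y, hy⟩, fun _ => hay rfl⟩
    · exact ⟨⟨D₀, hD₀⟩, fun h => absurd h ha⟩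
  have hub : ∀ D E : C, ∃ F : C, D.1 ⊆ F.1 ∧ E.1 ⊆ F.1 := by
    intro D E
    obtain ⟨y, hy, h⟩ := hC.2.1 (D.1 ∪ E.1)
      (Set.union_subset (hC.1 _ D.2).1 (hC.1 _ E.2).1)
      ((mk_union_le _ _).trans_lt (add_lt_of_lt hκ.1.le (hC.1 _ D.2).2 (hC.1 _ E.2).2))
    exact ⟨⟨y, hy⟩, Set.subset_union_left.trans h, Set.subset_union_right.trans h⟩
  choose cov hcov using hcover
  choose ub hub using hub
  let G : α ⊕ C → α ⊕ C → Set (α ⊕ C) := fun a b => match a, b with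
    | .inl a, _ => {.inr (cov a)}
    | .inr _, .inl _ => ∅
    | .inr D, .inr E => {.inr (ub D E)} ∪ Sum.inl '' D.1
  refine ⟨G, fun a b => ?_, fun x hx hxκ hxG => ?_⟩
  · rcases a with a | D <;> rcases b with b | E
    · exact hfin _ (Set.finite_singleton _)
    · exact hfin _ (Set.finite_singleton _)
    · exact hfin _ Set.finite_empty
    · exact (mk_union_le _ _).trans_lt (add_lt_of_lt hκ.1.le (hfin _ (Set.finite_singleton _))
        (mk_image_le.trans_lt (hC.1 _ D.2).2))
  · let ι : Type u := {D : C // .inr D ∈ x}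
    have hι : #ι < κ := (mk_preimage_of_injective _ _ Sum.inr_injective).trans_lt hxκ
    have hcl : ∀ a, Sum.inl a ∈ x → .inr (cov a) ∈ x := fun a ha =>
      hxG _ ha _ ha (Set.mem_singleton _)
    have hne : Nonempty ι := by
      obtain ⟨a | D, ha⟩ := hx
      · exact ⟨⟨_, hcl a ha⟩⟩
      · exact ⟨⟨D, ha⟩⟩
    have hdir : Directed (· ⊆ ·) fun D : ι => D.1.1 := fun D E =>
      ⟨⟨ub D.1 E.1, hxG _ D.2 _ E.2 (Or.inl rfl)⟩, (hub D.1 E.1).1, (hub D.1 E.1).2⟩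
    have h := hC.iUnion_mem _ hι ι rfl _ hdir fun D => D.1.2
    convert h using 1
    ext a
    simp only [Set.mem_inter_iff, Set.mem_preimage, Set.mem_iUnion]
    constructor
    · rintro ⟨ha, haX⟩
      exact ⟨⟨_, hcl a ha⟩, hcov a haX⟩
    · rintro ⟨D, ha⟩
      exact ⟨hxG _ D.2 _ D.2 (Or.inr ⟨a, ha, rfl⟩), (hC.1 _ D.1.2).1 ha⟩

/-- A choice of models that omit the given traces of a type, with an arbitrary structure
where there is no such model. -/
theorem exists_hasModelOmitting_family {L : FirstOrder.Language.{u, u}} {μ : Cardinal.{u}}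
    {T p : Set (InfFormula L μ)} {Ω : Type u} (tr : Ω → Set (InfFormula L μ)) :
    ∃ (A : Ω → Type u) (_ : ∀ x, Nonempty (A x)) (_ : ∀ x, L.Structure (A x)),
      ∀ x, HasModelOmitting (tr x ∩ T) (tr x ∩ p) →
        (∀ φ ∈ tr x ∩ T, ∀ v : Var μ → A x, φ.Realize v) ∧
          ¬ ∃ v : Var μ → A x, ∀ φ ∈ tr x ∩ p, φ.Realize v := by
  have h : ∀ x, ∃ (A : Type u) (_ : Nonempty A) (_ : L.Structure A),
      HasModelOmitting (tr x ∩ T) (tr x ∩ p) →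
        (∀ φ ∈ tr x ∩ T, ∀ v : Var μ → A, φ.Realize v) ∧
          ¬ ∃ v : Var μ → A, ∀ φ ∈ tr x ∩ p, φ.Realize v := by
    intro x
    by_cases hx : HasModelOmitting (tr x ∩ T) (tr x ∩ p)
    · obtain ⟨A, h1, h2, h3⟩ := hx
      exact ⟨A, h1, h2, fun _ => h3⟩
    · exact ⟨PUnit, ⟨⟨⟩⟩, ⟨fun _ _ => ⟨⟩, fun _ _ => False⟩, fun h => absurd h hx⟩
  choose A h1 h2 h3 using h
  exact ⟨A, h1, h2, h3⟩

/-- The guessing principle implies compactness with type omission. The model is the reduced product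
of the given models modulo a normal filter: normality turns the choice of a formula of `p ∩ x` that
is not satisfied by given elements of the model at `x` into a single formula of `p`. -/
theorem compactness_of_guessing {κ lam : Cardinal.{u}} (hκ : κ.IsInaccessible) (hle : κ ≤ lam)
    (hlam : lam = lam ^< κ) (hP : ∀ μ ≤ lam, ∀ X : Type u, #X = μ → Guessing κ X) :
    CompactnessWithTypeOmission κ κ lam := by
  classical
  rintro L hL T p hT hp ⟨C, hC, hCm⟩
  have hl : ℵ₀ ≤ lam := hκ.1.le.trans hle
  have hreg := hκ.isRegular
  have hform := mk_infFormula_le hκ hle hlam hL.le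
  have hterm := mk_skolemTerm_le hκ hle hlam hL.le
  have hsets := mk_small_subsets_le hκ hle hlam hform
  have hCcard : #C ≤ lam := (mk_le_of_injective
    (f := fun D : C => (⟨D.1, (hC.1 _ D.2).2⟩ : {x : Set (InfFormula L κ) // #x < κ}))
      fun D E h => Subtype.ext (congrArg (fun z => z.1) h)).trans hsets
  obtain ⟨G, hG, hGC⟩ := hC.exists_operation hκ
  let X := InfFormula L κ ⊕ C
  have hX : #X ≤ lam := by
    simp only [X, mk_sum, lift_id]
    exact add_le_of_le hl hform hCcard
  obtain ⟨D₀, hD₀⟩ := hC.nonempty hreg.pos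
  have hXne : Nonempty X := ⟨.inr ⟨D₀, hD₀⟩⟩
  let tr : Set X → Set (InfFormula L κ) := fun x => Sum.inl ⁻¹' x ∩ (T ∪ p)
  obtain ⟨A, hA1, hA2, hA⟩ := exists_hasModelOmitting_family (T := T) (p := p) tr
  have hgood : ∀ x : Set X, x.Nonempty → #x < κ → ClosedUnder G x →
      (∀ φ ∈ tr x ∩ T, ∀ v : Var κ → A x, φ.Realize v) ∧
        ¬ ∃ v : Var κ → A x, ∀ φ ∈ tr x ∩ p, φ.Realize v := fun x h1 h2 h3 =>
    hA x (hCm _ (hGC x h1 h2 h3))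
  let W : Set (Var κ) := ⋃ φ ∈ p, φ.freeVars
  -- an assignment of terms to the variables in `W` picks a formula of `p` that it does not satisfy
  have hI : ∀ (σ : W → SkolemTerm L κ) (x : Set X), ∃ a : X,
      x.Nonempty → #x < κ → ClosedUnder G x → a ∈ x ∧ ∃ φ ∈ p, a = .inl φ ∧
        ¬ φ.Realize fun y => if h : y ∈ W then (σ ⟨y, h⟩).eval (A x) else Classical.arbitrary _ := by
    intro σ x
    by_cases h : x.Nonempty ∧ #x < κ ∧ ClosedUnder G x
    · have h' := (hgood x h.1 h.2.1 h.2.2).2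
      simp only [not_exists, not_forall] at h'
      obtain ⟨φ, hφ, hv⟩ := h' fun y =>
        if h : y ∈ W then (σ ⟨y, h⟩).eval (A x) else Classical.arbitrary _
      exact ⟨.inl φ, fun _ _ _ => ⟨hφ.1.1, φ, hφ.2, rfl, hv⟩⟩
    · exact ⟨Classical.arbitrary _, fun h1 h2 h3 => absurd ⟨h1, h2, h3⟩ h⟩
  choose f hf using hI
  let J : Type u := Σ φ : InfFormula L κ, φ.freeVars → SkolemTerm L κ
  have hJ : #J ≤ lam := by
    rw [mk_sigma]
    refine (sum_le_sum _ (fun _ => lam) fun φ => ?_).trans ?_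
    · rw [← power_def]
      exact (power_le_power_right hterm).trans (power_le_of_lt hlam (φ.mk_freeVars_lt hreg))
    · rw [sum_const']
      exact (mul_le_mul_left hform lam).trans (mul_eq_self hl).le
  have hWI : #(W → SkolemTerm L κ) ≤ lam := by
    rw [← power_def]
    exact (power_le_power_right hterm).trans (power_le_of_lt hlam hp)
  let B : J → Set (Set X) := fun j => {x | ∃ v : Var κ → A x,
    (∀ y : j.1.freeVars, v y.1 = (j.2 y).eval (A x)) ∧ j.1.Realize v}
  obtain ⟨U, hU, hUκ, hUgood, hUfine, hUf, hUB⟩ := exists_normal_filter hκ hle hP hX hWI hJ G hG f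
    (fun σ x h1 h2 h3 => (hf σ x h1 h2 h3).1) B
  have hdec : ∀ (φ : InfFormula L κ) (σ : Var κ → SkolemTerm L κ),
      (∀ᶠ x in U, φ.Realize fun y => (σ y).eval (A x)) ∨
        ∀ᶠ x in U, ¬ φ.Realize fun y => (σ y).eval (A x) := by
    intro φ σ
    refine (hUB ⟨φ, fun y => σ y.1⟩).imp (fun h => h.mono fun x hx => ?_)
      fun h => h.mono fun x hx hφ => hx ⟨_, fun y => rfl, hφ⟩
    obtain ⟨v, hv, hφ⟩ := hx
    exact (φ.realize_congr fun y hy => hv ⟨y, hy⟩).1 hφ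
  have hlos := SkolemProduct.realize_iff (A := A) hUκ hdec
  refine ⟨SkolemProduct L κ A U, ?_, inferInstance, fun φ hφ v => ?_, ?_⟩
  · -- the Skolem terms for a sentence are closed terms
    have : Nonempty (Var κ) := by
      rw [← mk_ne_zero_iff, mk_out]
      exact hreg.pos.ne'
    let y := Classical.arbitrary (Var κ)
    exact ⟨SkolemProduct.mk A U (WType.mk (.skolem (.neg (.conj ∅ (by simpa using hreg.pos)
      fun i => (i.2 : False).elim)) ⟨∅, by simpa using hreg.pos⟩ y) fun z => by
        have := z.2.1
        simp [InfFormula.freeVars] at this)⟩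
  · have hv : v = fun y => SkolemProduct.mk A U (v y).name := funext fun y => by simp
    rw [hv, hlos]
    filter_upwards [hUgood, hUfine (.inl φ)] with x hx hφx
    exact (hgood x hx.1 hx.2.1 hx.2.2).1 φ ⟨⟨hφx, Or.inl hφ⟩, hφ⟩ _
  · rintro ⟨v, hv⟩
    have hv' : v = fun y => SkolemProduct.mk A U (v y).name := funext fun y => by simp
    obtain ⟨a, ha⟩ := hUf fun y : W => (v y.1).name
    obtain ⟨x₀, hx₀, ha₀⟩ := (hUgood.and ha).exists
    obtain ⟨-, φ, hφ, haφ, -⟩ := hf (fun y : W => (v y.1).name) x₀ hx₀.1 hx₀.2.1 hx₀.2.2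
    have h := hv φ hφ
    rw [hv', hlos] at h
    obtain ⟨x, ⟨hx, hax⟩, hφx⟩ := ((hUgood.and ha).and h).exists
    obtain ⟨-, ψ, hψ, haψ, hψx⟩ := hf (fun y : W => (v y.1).name) x hx.1 hx.2.1 hx.2.2
    obtain rfl : φ = ψ := Sum.inl_injective (by rw [← haφ, ← haψ, ha₀, hax])
    refine hψx ((φ.realize_congr fun y hy => ?_).1 hφx)
    rw [dif_pos (Set.mem_biUnion hφ hy)]

/-! ### Enlarging the set of variables -/

theorem IsClub.image {α β : Type u} {κ : Cardinal.{u}} {X : Set α} {C : Set (Set α)}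
    (hC : IsClub κ X C) {f : α → β} (hf : Function.Injective f) :
    IsClub κ (f '' X) (Set.image f '' C) := by
  refine ⟨?_, fun x hx hxκ => ?_, fun a ha0 ha F hF hFC => ?_⟩
  · rintro _ ⟨D, hD, rfl⟩
    exact ⟨Set.image_mono (hC.1 D hD).1, mk_image_le.trans_lt (hC.1 D hD).2⟩
  · obtain ⟨y, hy, hxy⟩ := hC.2.1 (f ⁻¹' x) (fun a ha => by
      obtain ⟨b, hb, hba⟩ := hx ha
      exact hf hba ▸ hb) ((mk_preimage_of_injective _ _ hf).trans_lt hxκ)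
    refine ⟨_, ⟨y, hy, rfl⟩, fun b hb => ?_⟩
    obtain ⟨a, -, rfl⟩ := hx hb
    exact ⟨a, hxy hb, rfl⟩
  · refine ⟨_, hC.2.2 a ha0 ha (fun i => f ⁻¹' F i) (fun i j hij => Set.preimage_mono (hF hij))
      fun i => ?_, ?_⟩
    · obtain ⟨D, hD, hDF⟩ := hFC i
      rw [← hDF, Set.preimage_image_eq _ hf]
      exact hD
    · rw [Set.image_iUnion]
      refine Set.iUnion_congr fun i => ?_
      obtain ⟨D, hD, hDF⟩ := hFC i
      rw [← hDF, Set.preimage_image_eq _ hf]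

namespace InfFormula

variable {L : FirstOrder.Language.{u, u}} {μ κ : Cardinal.{u}}

/-- Renaming the variables of a formula along an injection. -/
noncomputable def rename (e : Var μ ↪ Var κ) (h : μ ≤ κ) : InfFormula L μ → InfFormula L κ
  | equal s t => .equal (s.relabel e) (t.relabel e)
  | rel R ts => .rel R fun i => (ts i).relabel e
  | neg φ => .neg (φ.rename e h)
  | conj S hS φ => .conj (e '' S) ((mk_image_le.trans_lt hS).trans_le h) fun i =>
      (φ ((Equiv.Set.image e S e.injective).symm i)).rename e h
  | all V hV φ => .all (e '' V) ((mk_image_le.trans_lt hV).trans_le h) (φ.rename e h)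

theorem realize_rename (e : Var μ ↪ Var κ) (h : μ ≤ κ) {A : Type u} [L.Structure A]
    (φ : InfFormula L μ) (v : Var κ → A) : (φ.rename e h).Realize v ↔ φ.Realize (v ∘ e) := by
  induction φ generalizing v with
  | equal s t => simp [rename, Realize]
  | rel R ts => simp [rename, Realize]
  | neg φ ih => exact not_congr (ih v)
  | conj S hS φ ih =>
    simp only [rename, Realize, ih]
    exact (Equiv.Set.image e S e.injective).symm.forall_congr_right
      (q := fun i => (φ i).Realize (v ∘ e))
  | all V hV φ ih =>
    simp only [rename, Realize, ih]
    constructor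
    · intro hv w hw
      have := hv (Function.extend e w v) fun x hx => ?_
      · rwa [Function.extend_comp e.injective] at this
      · by_cases hxe : ∃ y, e y = x
        · obtain ⟨y, rfl⟩ := hxe
          rw [e.injective.extend_apply]
          exact hw y fun hy => hx ⟨y, hy, rfl⟩
        · exact Function.extend_apply' _ _ _ hxe
    · intro hv w hw
      exact hv _ fun x hx => hw _ fun ⟨y, hy, hyx⟩ => hx (e.injective hyx ▸ hy)

theorem varFinset_relabel_subset [DecidableEq (Var μ)] [DecidableEq (Var κ)] (e : Var μ ↪ Var κ)
    (t : L.Term (Var μ)) :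
    ((t.relabel e).varFinset : Set (Var κ)) ⊆ e '' (t.varFinset : Set (Var μ)) := by
  induction t with
  | var y => simp
  | func F ts ih =>
    intro x hx
    simp only [Language.Term.relabel, Language.Term.varFinset, Finset.coe_biUnion,
      Set.mem_iUnion] at hx ⊢
    obtain ⟨i, hi, hx⟩ := hx
    obtain ⟨y, hy, rfl⟩ := ih i hx
    exact ⟨y, Set.mem_iUnion₂.2 ⟨i, hi, hy⟩, rfl⟩

theorem freeVars_rename_subset (e : Var μ ↪ Var κ) (h : μ ≤ κ) (φ : InfFormula L μ) :
    (φ.rename e h).freeVars ⊆ e '' φ.freeVars := by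
  classical
  induction φ with
  | equal s t =>
    simp only [rename, freeVars]
    rw [Set.image_union]
    exact Set.union_subset_union (by convert varFinset_relabel_subset e s)
      (by convert varFinset_relabel_subset e t)
  | rel R ts =>
    simp only [rename, freeVars]
    rw [Set.image_iUnion]
    exact Set.iUnion_mono fun i => by convert varFinset_relabel_subset e (ts i)
  | neg φ ih => exact ih
  | conj S hS φ ih =>
    simp only [rename, freeVars]
    rw [Set.image_iUnion]
    exact Set.iUnion_subset fun i => (ih _).trans (Set.subset_iUnion
      (fun i => e '' (φ i).freeVars) _)
  | all V hV φ ih =>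
    simp only [rename, freeVars]
    rw [Set.image_sdiff e.injective]
    exact Set.sdiff_subset_sdiff_left ih

theorem relabel_injective (e : Var μ ↪ Var κ) :
    Function.Injective (Language.Term.relabel e : L.Term (Var μ) → L.Term (Var κ)) := by
  intro s
  induction s with
  | var y =>
    intro t h
    cases t with
    | var z => exact congrArg _ (e.injective (Language.Term.var.inj h))
    | func F ts => exact nomatch h
  | func F ts ih =>
    intro t h
    cases t with
    | var z => exact nomatch h
    | func F' ts' =>
      obtain ⟨rfl, h1, h2⟩ := Language.Term.func.inj h
      obtain rfl := eq_of_heq h1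
      exact congrArg _ (funext fun i => ih i (congrFun (eq_of_heq h2) i))

theorem rename_injective (e : Var μ ↪ Var κ) (h : μ ≤ κ) :
    Function.Injective (rename e h : InfFormula L μ → InfFormula L κ) := by
  intro φ
  induction φ with
  | equal s t =>
    intro ψ hψ
    cases ψ with
    | equal s' t' =>
      obtain ⟨h1, h2⟩ := equal.inj hψ
      rw [relabel_injective e h1, relabel_injective e h2]
    | _ => exact nomatch hψ
  | rel R ts =>
    intro ψ hψ
    cases ψ with
    | rel R' ts' =>
      obtain ⟨rfl, h1, h2⟩ := rel.inj hψ
      obtain rfl := eq_of_heq h1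
      exact congrArg _ (funext fun i => relabel_injective e (congrFun (eq_of_heq h2) i))
    | _ => exact nomatch hψ
  | neg φ ih =>
    intro ψ hψ
    cases ψ with
    | neg ψ => exact congrArg _ (ih (neg.inj hψ))
    | _ => exact nomatch hψ
  | conj S hS φ ih =>
    intro ψ hψ
    cases ψ with
    | conj S' hS' ψ =>
      obtain ⟨h1, h2⟩ := conj.inj hψ
      obtain rfl := e.injective.image_injective h1
      congr 1
      funext i
      have := congrFun (eq_of_heq h2) (Equiv.Set.image e S e.injective i)
      exact ih i (by simpa using this)
    | _ => exact nomatch hψ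
  | all V hV φ ih =>
    intro ψ hψ
    cases ψ with
    | all V' hV' ψ =>
      obtain ⟨h1, h2⟩ := all.inj hψ
      obtain rfl := e.injective.image_injective h1
      rw [ih h2]
    | _ => exact nomatch hψ

end InfFormula

theorem hasModelOmitting_rename {L : FirstOrder.Language.{u, u}} {μ κ : Cardinal.{u}}
    (e : Var μ ↪ Var κ) (h : μ ≤ κ) (T p : Set (InfFormula L μ)) :
    HasModelOmitting (InfFormula.rename e h '' T) (InfFormula.rename e h '' p) ↔
      HasModelOmitting T p := by
  have hext : ∀ {A : Type u} [Nonempty A] (v : Var μ → A), ∃ w : Var κ → A, w ∘ e = v :=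
    fun v => ⟨Function.extend e v fun _ => Classical.arbitrary _,
      Function.extend_comp e.injective _ _⟩
  refine exists_congr fun A => exists_congr fun hA => exists_congr fun _ => ?_
  simp only [Set.forall_mem_image, InfFormula.realize_rename]
  refine and_congr (forall₂_congr fun φ _ => ⟨fun h v => ?_, fun h v => h _⟩)
    (not_congr ⟨fun ⟨v, hv⟩ => ⟨_, hv⟩, fun ⟨v, hv⟩ => ?_⟩)
  · obtain ⟨w, rfl⟩ := hext v
    exact h w
  · obtain ⟨w, rfl⟩ := hext v
    exact ⟨w, hv⟩

/-- Compactness with type omission for a logic with more variables implies that for a logic with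
fewer variables, because formulas can be renamed injectively. -/
theorem CompactnessWithTypeOmission.mono {κ μ ν lam : Cardinal.{u}} (h : μ ≤ ν)
    (hc : CompactnessWithTypeOmission κ ν lam) : CompactnessWithTypeOmission κ μ lam := by
  obtain ⟨e⟩ : Nonempty (Var μ ↪ Var ν) := by
    rw [← le_def, mk_out, mk_out]; exact h
  rintro L hL T p hT hp ⟨C, hC, hCm⟩
  have hinj := InfFormula.rename_injective (L := L) e h
  refine (hasModelOmitting_rename e h T p).1 (hc L hL _ _ ?_ ?_
    ⟨_, Set.image_union _ _ _ ▸ hC.image hinj, ?_⟩)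
  · rintro _ ⟨φ, hφ, rfl⟩
    have := φ.freeVars_rename_subset e h
    rwa [hT φ hφ, Set.image_empty, Set.subset_empty_iff] at this
  · refine lt_of_le_of_lt (mk_le_mk_of_subset (t := e '' ⋃ φ ∈ p, φ.freeVars) ?_)
      ((mk_image_le.trans_lt hp).trans_le h)
    refine Set.iUnion₂_subset ?_
    rintro _ ⟨φ, hφ, rfl⟩
    exact (φ.freeVars_rename_subset e h).trans (Set.image_mono (Set.subset_biUnion_of_mem hφ))
  · rintro _ ⟨D, hD, rfl⟩
    rw [← Set.image_inter hinj, ← Set.image_inter hinj, hasModelOmitting_rename]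
    exact hCm D hD

theorem freeVars_wfSentence {L : FirstOrder.Language.{u, u}} (E : L.Relations 2) :
    (wfSentence E).freeVars = ∅ := by
  classical
  simp only [wfSentence, InfFormula.freeVars, Set.sdiff_eq_empty]
  refine Set.iUnion_subset fun y => Set.iUnion_subset fun i => ?_
  intro z hz
  fin_cases i <;> simp at hz <;> simp [hz]

theorem CompactnessWithTypeOmission.wellFounded {κ lam : Cardinal.{u}}
    (hc : CompactnessWithTypeOmission κ ℵ₁ lam) :
    WellFoundedCompactnessWithTypeOmission κ lam := by
  intro L hL E T p hT _ hp _
  refine hc L hL _ _ ?_ ?_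
  · rintro φ (hφ | rfl)
    · exact hT φ hφ
    · exact freeVars_wfSentence E
  · obtain ⟨x, hx⟩ := hp
    refine lt_of_le_of_lt (mk_le_mk_of_subset (Set.iUnion₂_subset hx)) ?_
    exact (Set.finite_singleton x).lt_aleph0.trans aleph0_lt_aleph_one

/-! ### Mostowski collapse -/

section Collapse

variable {A : Type u} {E : A → A → Prop}

/-- The Mostowski collapse of a well-founded relation. -/
noncomputable def collapse (hE : WellFounded E) : A → ZFSet.{u} :=
  hE.fix fun a ih => ZFSet.range fun b : {b // E b a} => ih b.1 b.2

theorem mem_collapse (hE : WellFounded E) {a : A} {x : ZFSet.{u}} :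
    x ∈ collapse hE a ↔ ∃ b, E b a ∧ collapse hE b = x := by
  rw [collapse, hE.fix_eq, ZFSet.mem_range]
  simp

theorem collapse_injective (hE : WellFounded E) (hext : ∀ a b, (∀ c, E c a ↔ E c b) → a = b) :
    Function.Injective (collapse hE) := by
  intro a
  induction a using hE.induction with
  | _ a ih =>
  intro b hab
  refine hext a b fun c => ⟨fun hc => ?_, fun hc => ?_⟩
  · obtain ⟨c', hc', h⟩ := (mem_collapse hE).1 (hab ▸ (mem_collapse hE).2 ⟨c, hc, rfl⟩)
    rwa [ih c hc h.symm]
  · obtain ⟨c', hc', h⟩ := (mem_collapse hE).1 (hab.symm ▸ (mem_collapse hE).2 ⟨c, hc, rfl⟩)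
    rwa [← ih c' hc' h]

theorem collapse_mem_collapse (hE : WellFounded E) (hext : ∀ a b, (∀ c, E c a ↔ E c b) → a = b)
    {a b : A} : collapse hE a ∈ collapse hE b ↔ E a b := by
  rw [mem_collapse]
  exact ⟨fun ⟨c, hc, h⟩ => collapse_injective hE hext h ▸ hc, fun h => ⟨a, h, rfl⟩⟩

theorem isTransitive_range_collapse (hE : WellFounded E) :
    (ZFSet.range (collapse hE)).IsTransitive := by
  intro x hx y hy
  obtain ⟨a, rfl⟩ := ZFSet.mem_range.1 hx
  obtain ⟨b, -, rfl⟩ := (mem_collapse hE).1 hy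
  exact ZFSet.mem_range_self _

end Collapse

/-! ### The language naming the elements of a set -/

/-- Constant symbols for the elements of `K` and two further constant symbols. -/
inductive NameSym (K : Type u) : ℕ → Type u
  | elem (k : K) : NameSym K 0
  | cover : NameSym K 0
  | point : NameSym K 0

/-- A binary relation symbol. -/
inductive BinSym : ℕ → Type u
  | mem : BinSym 2

/-- The language with a binary relation symbol, constant symbols for the elements of `K`, and two
further constant symbols. -/
def nameLang (K : Type u) : FirstOrder.Language.{u, u} := ⟨NameSym K, BinSym⟩

theorem card_nameLang (K : Type u) [Infinite K] : (nameLang K).card = #K := by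
  refine le_antisymm ?_ ?_
  · let f : (nameLang K).Symbols → Option (Option (Option K))
      | .inl ⟨_, .elem k⟩ => some (some (some k))
      | .inl ⟨_, .cover⟩ => some (some none)
      | .inl ⟨_, .point⟩ => some none
      | .inr ⟨_, .mem⟩ => none
    have hf : Function.Injective f := by
      rintro (⟨_, (_ | _ | _)⟩ | ⟨_, (_ | _)⟩) (⟨_, (_ | _ | _)⟩ | ⟨_, (_ | _)⟩) h <;>
        simp_all [f]
    refine (mk_le_of_injective hf).trans ?_
    simp
  · exact mk_le_of_injective (f := fun k => (.inl ⟨0, NameSym.elem k⟩ : (nameLang K).Symbols))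
      fun a b h => NameSym.elem.inj (eq_of_heq (Sigma.mk.inj (Sum.inl.inj h)).2)

section NameLang

variable {K : Type u}

/-- The relation symbol. -/
def nameMem : (nameLang K).Relations 2 := BinSym.mem

/-- A constant symbol as a term. -/
def const {α : Type u} (c : NameSym K 0) : (nameLang K).Term α :=
  .func (L := nameLang K) (l := 0) c Fin.elim0

/-- The value of a constant symbol. -/
def constVal {A : Type u} [(nameLang K).Structure A] (c : NameSym K 0) : A :=
  Language.Structure.funMap (L := nameLang K) (n := 0) c Fin.elim0

/-- The relation interpreting the relation symbol. -/
def memRel (K : Type u) {A : Type u} [(nameLang K).Structure A] (a b : A) : Prop :=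
  Language.Structure.RelMap (nameMem (K := K)) ![a, b]

/-- The interpretation of the relation symbol as a structure for the language of set theory. -/
abbrev setReduct (K A : Type u) [(nameLang K).Structure A] : setLang.Structure A where
  funMap := fun f => Empty.elim f
  RelMap := fun {_} R xs => match R, xs with
    | MemRel.mem, xs => memRel K (xs 0) (xs 1)

@[simp]
theorem realize_const {A α : Type u} [(nameLang K).Structure A] (c : NameSym K 0) (v : α → A) :
    (const c).realize v = constVal c := by
  simp only [const, Language.Term.realize, constVal]
  congr 1
  exact Subsingleton.elim _ _

/-- The atomic formula stating that `s` is in the relation to `t`. -/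
def memFormula (s t : (nameLang K).Term (Var ℵ₁)) : InfFormula (nameLang K) ℵ₁ :=
  .rel nameMem ![s, t]

@[simp]
theorem realize_memFormula {A : Type u} [(nameLang K).Structure A]
    (s t : (nameLang K).Term (Var ℵ₁)) (v : Var ℵ₁ → A) :
    (memFormula s t).Realize v ↔ memRel K (s.realize v) (t.realize v) := by
  simp only [memFormula, InfFormula.Realize, memRel]
  rw [iff_iff_eq]
  congr 1
  funext i
  fin_cases i <;> rfl

theorem freeVars_memFormula [DecidableEq (Var.{u} ℵ₁)] (s t : (nameLang K).Term (Var ℵ₁)) :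
    (memFormula s t).freeVars = (s.varFinset : Set (Var ℵ₁)) ∪ t.varFinset := by
  ext y
  simp only [memFormula, InfFormula.freeVars, Set.mem_iUnion, Fin.exists_fin_two]
  refine or_congr ?_ ?_
  · simp only [Matrix.cons_val_zero]; convert Iff.rfl
  · simp only [Matrix.cons_val_one, Matrix.cons_val_zero]; convert Iff.rfl

theorem varFinset_const {α : Type u} [DecidableEq α] (c : NameSym K 0) :
    (const c : (nameLang K).Term α).varFinset = ∅ := by
  simp [const]

theorem mk_pair_lt_aleph_one {α : Type u} (a b : α) : #({a, b} : Set α) < ℵ₁ :=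
  (Set.toFinite _).lt_aleph0.trans aleph0_lt_aleph_one

/-- Implication, as a formula of the infinitary logic. -/
noncomputable def impFormula {L : FirstOrder.Language.{u, u}} (φ ψ : InfFormula L ℵ₁) :
    InfFormula L ℵ₁ :=
  open Classical in
  .neg (.conj {seqVar 0, seqVar 1} (mk_pair_lt_aleph_one _ _)
    fun i => if i.1 = seqVar 0 then φ else .neg ψ)

section Imp

variable {L : FirstOrder.Language.{u, u}} (φ ψ : InfFormula L ℵ₁)

@[simp]
theorem realize_impFormula {A : Type u} [L.Structure A] (v : Var ℵ₁ → A) :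
    (impFormula φ ψ).Realize v ↔ (φ.Realize v → ψ.Realize v) := by
  have h : seqVar.{u} 1 ≠ seqVar 0 := fun h => one_ne_zero (seqVar.injective h)
  simp only [impFormula, InfFormula.Realize]
  refine ⟨fun hc hφ => by_contra fun hψ => hc fun i => ?_, fun hi hc => ?_⟩
  · split_ifs
    exacts [hφ, hψ]
  · have h0 := hc ⟨seqVar 0, Or.inl rfl⟩
    have h1 := hc ⟨seqVar 1, Or.inr rfl⟩
    rw [if_pos rfl] at h0
    rw [if_neg h] at h1
    exact h1 (hi h0)

theorem freeVars_impFormula_subset :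
    (impFormula φ ψ).freeVars ⊆ φ.freeVars ∪ ψ.freeVars := by
  simp only [impFormula, InfFormula.freeVars]
  refine Set.iUnion_subset fun i => ?_
  split_ifs
  · exact Set.subset_union_left
  · exact Set.subset_union_right

theorem isFirstOrder_impFormula (hφ : φ.IsFirstOrder) (hψ : ψ.IsFirstOrder) :
    (impFormula φ ψ).IsFirstOrder := by
  refine ⟨Set.toFinite _, fun i => ?_⟩
  dsimp only
  split_ifs
  exacts [hφ, hψ]

end Imp

theorem mk_singleton_lt_aleph_one {α : Type u} (a : α) : #({a} : Set α) < ℵ₁ :=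
  (Set.toFinite _).lt_aleph0.trans aleph0_lt_aleph_one

theorem mk_empty_lt_aleph_one {α : Type u} : #(∅ : Set α) < ℵ₁ :=
  (Set.toFinite _).lt_aleph0.trans aleph0_lt_aleph_one

/-- Terms of set theory as terms of the named language: free variables become constants. -/
noncomputable def nameTerm {n : ℕ} : setLang.Term (K ⊕ Fin n) → (nameLang K).Term (Var ℵ₁)
  | .var (.inl k) => const (.elem k)
  | .var (.inr i) => .var (seqVar i)
  | .func f _ => Empty.elim f

/-- Formulas of set theory with parameters from `K` as formulas of the named language. -/
noncomputable def nameFormula : ∀ {n : ℕ}, setLang.BoundedFormula K n → InfFormula (nameLang K) ℵ₁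
  | _, .falsum => .neg (.conj ∅ mk_empty_lt_aleph_one fun i => (i.2 : False).elim)
  | _, .equal s t => .equal (nameTerm s) (nameTerm t)
  | _, .rel R ts => match R, ts with
    | MemRel.mem, ts => memFormula (nameTerm (ts 0)) (nameTerm (ts 1))
  | _, .imp φ ψ => impFormula (nameFormula φ) (nameFormula ψ)
  | n, .all φ => .all {seqVar n} (mk_singleton_lt_aleph_one _) (nameFormula φ)

theorem realize_nameTerm {A : Type u} [(nameLang K).Structure A] {n : ℕ}
    (t : setLang.Term (K ⊕ Fin n)) (v : Var ℵ₁ → A) : (nameTerm t).realize v =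
      letI := setReduct K A
      t.realize (Sum.elim (fun k => constVal (K := K) (.elem k)) fun i : Fin n => v (seqVar i)) := by
  cases t with
  | var y =>
    cases y with
    | inl k => exact realize_const _ _
    | inr i => rfl
  | func f => exact Empty.elim f

theorem realize_nameFormula {A : Type u} [(nameLang K).Structure A] {n : ℕ}
    (φ : setLang.BoundedFormula K n) (v : Var ℵ₁ → A) : (nameFormula φ).Realize v ↔
      letI := setReduct K A
      φ.Realize (fun k => constVal (K := K) (.elem k)) fun i : Fin n => v (seqVar i) := by
  classical
  let _ := setReduct K A
  induction φ generalizing v with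
  | falsum =>
    simp only [nameFormula, InfFormula.Realize, Language.BoundedFormula.Realize, iff_false, not_not]
    exact fun i => (i.2 : False).elim
  | equal s t =>
    simp only [nameFormula, InfFormula.Realize, realize_nameTerm]
    rfl
  | rel R ts =>
    cases R with
    | mem =>
      simp only [nameFormula, realize_memFormula, realize_nameTerm]
      rfl
  | imp φ ψ h1 h2 =>
    simp only [nameFormula, realize_impFormula, h1, h2]
    rfl
  | @all n φ ih =>
    simp only [nameFormula, InfFormula.Realize, ih, Language.BoundedFormula.realize_all]
    have hs : ∀ w : Var ℵ₁ → A, (∀ x, x ∉ ({seqVar n} : Set (Var ℵ₁)) → w x = v x) →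
        (fun i : Fin (n + 1) => w (seqVar i)) =
          Fin.snoc (fun i : Fin n => v (seqVar i)) (w (seqVar n)) := by
      intro w hw
      funext i
      refine Fin.lastCases ?_ (fun i => ?_) i
      · simp
      · rw [Fin.snoc_castSucc]
        refine hw _ fun h => ?_
        have := seqVar.injective (Set.mem_singleton_iff.1 h)
        exact absurd this (by simpa using i.2.ne)
    constructor
    · intro h a
      have hw : ∀ x, x ∉ ({seqVar n} : Set (Var ℵ₁)) → Function.update v (seqVar n) a x = v x :=
        fun x hx => Function.update_of_ne hx _ _
      have := h _ hw
      rw [hs _ hw] at this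
      simpa using this
    · intro h w hw
      rw [hs w hw]
      exact h _

theorem realize_nameFormula_formula {A : Type u} [(nameLang K).Structure A]
    (φ : setLang.Formula K) (v : Var ℵ₁ → A) : (nameFormula φ).Realize v ↔
      letI := setReduct K A
      φ.Realize fun k => (constVal (K := K) (.elem k) : A) := by
  let _ := setReduct K A
  rw [realize_nameFormula (n := 0), Language.Formula.Realize]
  exact iff_of_eq (congrArg _ (Subsingleton.elim _ _))

theorem varFinset_nameTerm_subset [DecidableEq (Var.{u} ℵ₁)] {n : ℕ}
    (t : setLang.Term (K ⊕ Fin n)) :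
    ((nameTerm t).varFinset : Set (Var ℵ₁)) ⊆ seqVar '' Set.Iio n := by
  cases t with
  | var y =>
    cases y with
    | inl k => rw [nameTerm, varFinset_const]; simp
    | inr i => simp [nameTerm]
  | func f => exact Empty.elim f

theorem freeVars_nameFormula_subset {n : ℕ} (φ : setLang.BoundedFormula K n) :
    (nameFormula φ).freeVars ⊆ seqVar '' Set.Iio n := by
  classical
  induction φ with
  | falsum =>
    simp only [nameFormula, InfFormula.freeVars]
    exact Set.iUnion_subset fun i => (i.2 : False).elim
  | equal s t =>
    simp only [nameFormula, InfFormula.freeVars]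
    exact Set.union_subset (by convert varFinset_nameTerm_subset s)
      (by convert varFinset_nameTerm_subset t)
  | rel R ts =>
    cases R with
    | mem =>
      simp only [nameFormula, freeVars_memFormula]
      exact Set.union_subset (varFinset_nameTerm_subset _) (varFinset_nameTerm_subset _)
  | imp φ ψ h1 h2 => exact (freeVars_impFormula_subset _ _).trans (Set.union_subset h1 h2)
  | @all n φ ih =>
    simp only [nameFormula, InfFormula.freeVars]
    rintro _ ⟨hy, hyn⟩
    obtain ⟨i, hi, rfl⟩ := ih hy
    refine ⟨i, ?_, rfl⟩
    have : i ≠ n := fun h => hyn (by rw [h]; rfl)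
    simp only [Set.mem_Iio] at hi ⊢
    omega

theorem isFirstOrder_nameFormula {n : ℕ} (φ : setLang.BoundedFormula K n) :
    (nameFormula φ).IsFirstOrder := by
  induction φ with
  | falsum => exact ⟨Set.finite_empty, fun i => (i.2 : False).elim⟩
  | equal s t => trivial
  | rel R ts =>
    cases R with
    | mem => trivial
  | imp φ ψ h1 h2 => exact isFirstOrder_impFormula _ _ h1 h2
  | all φ ih => exact ⟨Set.finite_singleton _, ih⟩

theorem realize_wfSentence {A : Type u} [Nonempty A] [(nameLang K).Structure A] :
    (∀ v : Var ℵ₁ → A, (wfSentence (nameMem (K := K))).Realize v) ↔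
      WellFounded (memRel K (A := A)) := by
  rw [wellFounded_iff_isEmpty_descending_chain]
  have key : ∀ w : Var ℵ₁ → A, (∀ y : Set.range seqVar.{u}, InfFormula.Realize (L := nameLang K)
      (.rel nameMem ![.var (seqVar ((Equiv.ofInjective seqVar seqVar.injective).symm y + 1)),
        .var (seqVar ((Equiv.ofInjective seqVar seqVar.injective).symm y))]) w) ↔
      ∀ n, memRel K (w (seqVar (n + 1))) (w (seqVar n)) := by
    intro w
    rw [← (Equiv.ofInjective seqVar.{u} seqVar.injective).forall_congr_right]
    simp only [Equiv.symm_apply_apply]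
    refine forall_congr' fun n => ?_
    exact realize_memFormula (.var (seqVar (n + 1))) (.var (seqVar n)) w
  constructor
  · intro h
    refine ⟨fun ⟨f, hf⟩ => ?_⟩
    have h' := h (Function.extend seqVar f fun _ => Classical.arbitrary A)
    simp only [wfSentence, InfFormula.Realize] at h'
    refine h' _ (fun _ _ => rfl) ((key _).2 fun n => ?_)
    rw [seqVar.injective.extend_apply, seqVar.injective.extend_apply]
    exact hf n
  · intro h v
    simp only [wfSentence, InfFormula.Realize]
    intro w _ hw
    exact h.false ⟨fun n => w (seqVar n), (key w).1 hw⟩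

end NameLang

/-! ### Covering the image of an embedding by a set -/

section Cover

variable {K : Type u} (E : K → K → Prop) (k₀ : K)

/-- A binary relation as a structure for the language of set theory. -/
abbrev setStructure : setLang.Structure K where
  funMap := fun f => Empty.elim f
  RelMap := fun {_} R xs => match R, xs with
    | MemRel.mem, xs => E (xs 0) (xs 1)

/-- The expansion of `(K, E)` in which every element of `K` is named by its constant symbol. -/
abbrev namedStructure (d e : K) : (nameLang K).Structure K where
  funMap := fun {_} f _ => match f with
    | NameSym.elem k => k
    | NameSym.cover => d
    | NameSym.point => e
  RelMap := fun {_} R xs => match R, xs with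
    | BinSym.mem, xs => E (xs 0) (xs 1)

/-- The sentence stating that `m` is an element of the cover. -/
def memCover (m : K) : InfFormula (nameLang K) ℵ₁ :=
  memFormula (const (.elem m)) (const .cover)

/-- The formula stating that the variable is an element of the cover. -/
noncomputable def varMemCover : InfFormula (nameLang K) ℵ₁ :=
  memFormula (.var (seqVar 0)) (const .cover)

/-- The sentence stating that `b` is a subset of the cover. -/
noncomputable def subsetCover (b : K) : InfFormula (nameLang K) ℵ₁ :=
  .all {seqVar 0} (mk_singleton_lt_aleph_one _)
    (impFormula (memFormula (.var (seqVar 0)) (const (.elem b))) varMemCover)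

/-- The sentence stating that the point differs from `b`. -/
def pointNe (b : K) : InfFormula (nameLang K) ℵ₁ :=
  .neg (.equal (const .point) (const (.elem b)))

/-- The formula stating that the variable differs from `m`. -/
noncomputable def varNe (m : K) : InfFormula (nameLang K) ℵ₁ :=
  .neg (.equal (.var (seqVar 0)) (const (.elem m)))

/-- The elementary diagram of `(K, E)`. -/
def diagram : Set (InfFormula (nameLang K) ℵ₁) :=
  {ψ | ∃ φ : setLang.Formula K, (letI := setStructure E; φ.Realize id) ∧ ψ = nameFormula φ}

/-- The theory of an elementary extension of `(K, E)` with a cover, which contains all elements of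
`K` and includes all elements of `k₀`, and a new element of `k₀`. -/
def coverTheory : Set (InfFormula (nameLang K) ℵ₁) :=
  diagram E ∪ Set.range memCover ∪ subsetCover '' {b | E b k₀} ∪
    {memFormula (const .point) (const (.elem k₀))} ∪ pointNe '' {b | E b k₀}

variable (K) in
/-- The type of an element of the cover that is not in `K`. -/
def coverType : Set (InfFormula (nameLang K) ℵ₁) := {varMemCover} ∪ Set.range varNe

variable {E k₀}

theorem isTheory_coverTheory : IsTheory (coverTheory E k₀) := by
  classical
  rintro _ ((((⟨φ, -, rfl⟩ | ⟨m, rfl⟩) | ⟨b, -, rfl⟩) | rfl) | ⟨b, -, rfl⟩)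
  · have h := freeVars_nameFormula_subset (K := K) (n := 0) φ
    simpa using h
  · simp [memCover, freeVars_memFormula, varFinset_const]
  · refine Set.sdiff_eq_empty.2 ((freeVars_impFormula_subset _ _).trans ?_)
    simp [varMemCover, freeVars_memFormula, varFinset_const]
  · simp [freeVars_memFormula, varFinset_const]
  · simp [pointNe, InfFormula.freeVars, varFinset_const]

theorem isFirstOrder_coverTheory : ∀ φ ∈ coverTheory E k₀, φ.IsFirstOrder := by
  rintro _ ((((⟨φ, -, rfl⟩ | ⟨m, rfl⟩) | ⟨b, -, rfl⟩) | rfl) | ⟨b, -, rfl⟩)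
  · exact isFirstOrder_nameFormula _
  · trivial
  · exact ⟨Set.finite_singleton _, isFirstOrder_impFormula _ _ trivial trivial⟩
  · trivial
  · trivial

theorem freeVars_coverType : ∀ φ ∈ coverType K, φ.freeVars ⊆ {seqVar 0} := by
  classical
  rintro _ (rfl | ⟨m, rfl⟩)
  · simp [varMemCover, freeVars_memFormula, varFinset_const]
  · simp [varNe, InfFormula.freeVars, varFinset_const]

theorem isFirstOrder_coverType : ∀ φ ∈ coverType K, φ.IsFirstOrder := by
  rintro _ (rfl | ⟨m, rfl⟩)
  · trivial
  · trivial

/-- The elements that a set of sentences requires to be in the cover. -/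
def required (E : K → K → Prop) (k₀ : K) (x : Set (InfFormula (nameLang K) ℵ₁)) : Set K :=
  {m | memCover m ∈ x} ∪ ⋃ b ∈ {b | E b k₀ ∧ subsetCover b ∈ x}, {m | E m b}

theorem const_injective {α : Type u} :
    Function.Injective (const : NameSym K 0 → (nameLang K).Term α) := fun _ _ h =>
  eq_of_heq (Language.Term.func.inj h).2.1

theorem memCover_injective : Function.Injective (memCover : K → _) := fun _ _ h =>
  NameSym.elem.inj (const_injective (congrFun (eq_of_heq (InfFormula.rel.inj h).2.2) 0))

theorem subsetCover_injective : Function.Injective (subsetCover : K → _) := by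
  intro a b h
  have h1 := (InfFormula.all.inj h).2
  simp only [impFormula, InfFormula.neg.injEq] at h1
  have h2 := congrFun (eq_of_heq (InfFormula.conj.inj h1).2) ⟨seqVar 0, Or.inl rfl⟩
  simp only [if_true] at h2
  exact NameSym.elem.inj (const_injective (congrFun (eq_of_heq (InfFormula.rel.inj h2).2.2) 1))

theorem mk_required_lt {κ : Cardinal.{u}} (hκ : κ.IsRegular)
    (hsm : ∀ b, E b k₀ → #{m | E m b} < κ) {x : Set (InfFormula (nameLang K) ℵ₁)} (hx : #x < κ) :
    #(required E k₀ x) < κ := by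
  refine (mk_union_le _ _).trans_lt (add_lt_of_lt hκ.aleph0_le ?_ ?_)
  · exact (mk_preimage_of_injective _ _ memCover_injective).trans_lt hx
  · refine (card_biUnion_lt_iff_forall_of_isRegular hκ ?_).2 fun b hb => hsm b hb.1
    exact (mk_le_mk_of_subset fun b hb => hb.2).trans_lt
      ((mk_preimage_of_injective _ _ subsetCover_injective).trans_lt hx)

variable (E k₀) in
/-- The small sets of formulas whose part of the type excludes, as elements of the cover that
realize the type, all elements required to be in the cover. -/
def coverClub (κ : Cardinal.{u}) : Set (Set (InfFormula (nameLang K) ℵ₁)) :=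
  {x | (x ⊆ coverTheory E k₀ ∪ {wfSentence nameMem} ∪ coverType K ∧ #x < κ) ∧ varMemCover ∈ x ∧
    ∀ m ∈ required E k₀ x, varNe m ∈ x}

theorem isClub_coverClub {κ : Cardinal.{u}} (hκ : κ.IsRegular)
    (hsm : ∀ b, E b k₀ → #{m | E m b} < κ) :
    IsClub κ (coverTheory E k₀ ∪ {wfSentence nameMem} ∪ coverType K) (coverClub E k₀ κ) := by
  refine ⟨fun x hx => hx.1, fun x hx hxκ => ?_, fun a ha0 ha f hf hfC => ?_⟩
  · have hy : x ∪ {varMemCover} ∪ varNe '' required E k₀ x ∈ coverClub E k₀ κ := by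
      refine ⟨⟨?_, ?_⟩, Or.inl (Or.inr rfl), fun m hm => Or.inr ⟨m, ?_, rfl⟩⟩
      · rintro φ ((hφ | rfl) | ⟨m, -, rfl⟩)
        · exact hx hφ
        · exact Or.inr (Or.inl rfl)
        · exact Or.inr (Or.inr ⟨m, rfl⟩)
      · refine (mk_union_le _ _).trans_lt (add_lt_of_lt hκ.aleph0_le ((mk_union_le _ _).trans_lt
          (add_lt_of_lt hκ.aleph0_le hxκ ?_)) (mk_image_le.trans_lt (mk_required_lt hκ hsm hxκ)))
        exact (Set.finite_singleton _).lt_aleph0.trans_le hκ.aleph0_le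
      · refine Or.imp (fun h => ?_) (fun h => ?_) hm
        · rcases h with (h | h) | ⟨k, -, h⟩
          · exact h
          · exact nomatch congrFun (eq_of_heq (InfFormula.rel.inj h).2.2) 0
          · exact nomatch h
        · obtain ⟨b, ⟨hb, h⟩, hmb⟩ := Set.mem_iUnion₂.1 h
          refine Set.mem_iUnion₂.2 ⟨b, ⟨hb, ?_⟩, hmb⟩
          rcases h with (h | h) | ⟨k, -, h⟩
          · exact h
          · exact nomatch h
          · exact nomatch h
    exact ⟨_, hy, fun φ hφ => Or.inl (Or.inl hφ)⟩
  · refine ⟨⟨Set.iUnion_subset fun i => (hfC i).1.1, ?_⟩, ?_, fun m hm => ?_⟩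
    · have ha' : #(a.ToType) < κ := by rw [mk_toType]; exact lt_ord.1 ha
      rw [← (Ordinal.ToType.mk (o := a)).symm.surjective.iUnion_comp]
      exact (card_iUnion_lt_iff_forall_of_isRegular hκ ha').2 fun i => (hfC _).1.2
    · exact Set.mem_iUnion.2 ⟨⟨0, pos_iff_ne_zero.2 ha0⟩, (hfC _).2.1⟩
    · rcases hm with hm | hm
      · obtain ⟨i, hi⟩ := Set.mem_iUnion.1 hm
        exact Set.mem_iUnion.2 ⟨i, (hfC i).2.2 m (Or.inl hi)⟩
      · obtain ⟨b, ⟨hb, h⟩, hmb⟩ := Set.mem_iUnion₂.1 hm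
        obtain ⟨i, hi⟩ := Set.mem_iUnion.1 h
        exact Set.mem_iUnion.2 ⟨i, (hfC i).2.2 m (Or.inr (Set.mem_iUnion₂.2 ⟨b, ⟨hb, hi⟩, hmb⟩))⟩

/-- The members of the club have models omitting the type: interpret the cover in `(K, E)` by the
set of required elements, and the point by an element that is not excluded. -/
theorem hasModelOmitting_of_mem_coverClub {κ : Cardinal.{u}} (hκ : κ.IsRegular)
    (hwf : WellFounded E) (hsub : ∀ D : Set K, #D < κ → ∃ d, ∀ m, E m d ↔ m ∈ D)
    (hpt : κ ≤ #{b | E b k₀}) (hsm : ∀ b, E b k₀ → #{m | E m b} < κ)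
    {x : Set (InfFormula (nameLang K) ℵ₁)} (hx : x ∈ coverClub E k₀ κ) :
    HasModelOmitting (x ∩ (coverTheory E k₀ ∪ {wfSentence nameMem})) (x ∩ coverType K) := by
  obtain ⟨⟨-, hxκ⟩, hvar, hreq⟩ := hx
  obtain ⟨d, hd⟩ := hsub _ (mk_required_lt hκ hsm hxκ)
  -- fewer than `κ` elements of `k₀` are excluded as values of the point
  have he : ∃ e, E e k₀ ∧ pointNe e ∉ x := by
    by_contra! h
    have hinj : Function.Injective (pointNe : K → _) := fun a b hab =>
      NameSym.elem.inj (const_injective (InfFormula.equal.inj (InfFormula.neg.inj hab)).2)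
    exact absurd ((hpt.trans (mk_le_mk_of_subset h)).trans (mk_preimage_of_injective _ _ hinj))
      (not_le.2 hxκ)
  obtain ⟨e, he, hex⟩ := he
  have : Nonempty K := ⟨k₀⟩
  let _ := namedStructure E d e
  refine ⟨K, ⟨k₀⟩, inferInstance, ?_, ?_⟩
  · rintro φ ⟨hφx, hφ | rfl⟩ v
    · rcases hφ with (((⟨φ, hφ, rfl⟩ | ⟨m, rfl⟩) | ⟨b, hb, rfl⟩) | rfl) | ⟨b, hb, rfl⟩
      · exact (realize_nameFormula_formula φ v).2 hφ
      · rw [memCover, realize_memFormula, realize_const, realize_const]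
        exact (hd m).2 (Or.inl hφx)
      · intro w _
        rw [realize_impFormula, realize_memFormula, varMemCover, realize_memFormula, realize_const,
          realize_const]
        intro h
        exact (hd _).2 (Or.inr (Set.mem_iUnion₂.2 ⟨b, ⟨hb, hφx⟩, h⟩))
      · rw [realize_memFormula, realize_const, realize_const]
        exact he
      · simp only [pointNe, InfFormula.Realize, realize_const]
        rintro (rfl : e = b)
        exact hex hφx
    · exact (realize_wfSentence (K := K) (A := K)).2 hwf v
  · rintro ⟨v, hv⟩
    have h1 := hv _ ⟨hvar, Or.inl rfl⟩
    rw [varMemCover, realize_memFormula, realize_const] at h1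
    have h2 : v (seqVar 0) ∈ required E k₀ x := (hd _).1 h1
    have h3 := hv _ ⟨hreq _ h2, Or.inr ⟨_, rfl⟩⟩
    simp only [varNe, InfFormula.Realize, realize_const] at h3
    exact h3 rfl

end Cover

/-! ### Embeddings from well-founded compactness -/

/-- The axiom of extensionality. -/
def extensionality (K : Type u) : setLang.Formula K :=
  Language.BoundedFormula.all (Language.BoundedFormula.all
    ((Language.BoundedFormula.all ((memSym.boundedFormula₂ (&2) (&0)).iff
      (memSym.boundedFormula₂ (&2) (&1)))).imp (Language.Term.bdEqual (&0) (&1))))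

theorem realize_extensionality {K A : Type u} [setLang.Structure A] (v : K → A) :
    (extensionality K).Realize v ↔ ∀ a b : A, (∀ c, Language.Structure.RelMap memSym ![c, a] ↔
      Language.Structure.RelMap memSym ![c, b]) → a = b := by
  simp [extensionality, Language.Formula.Realize, Fin.snoc, Language.BoundedFormula.realize_rel₂]

/-- The collapse of a model of the covering theory that omits the type is the target of an embedding
of `M`. The collapse of the cover is the pointwise image of `M`; the ordinals below `κ` are fixed
because all their elements are named; and the point is a new element of the image of `κ`. -/
theorem hasEmbedding_of_hasModelOmitting {κ : Cardinal.{u}} {M : ZFSet.{u}} (hM : M.IsTransitive)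
    (hκM : κ.ord.toZFSet ∈ M) {K : Type u} (g : K ≃ M)
    (h : HasModelOmitting (coverTheory (fun a b => (g a : ZFSet.{u}) ∈ (g b : ZFSet.{u}))
      (g.symm ⟨_, hκM⟩) ∪ {wfSentence nameMem}) (coverType K)) :
    HasEmbedding κ M := by
  obtain ⟨A, _, _, hT, hp⟩ := h
  set E : K → K → Prop := fun a b => (g a : ZFSet.{u}) ∈ (g b : ZFSet.{u})
  set k₀ := g.symm ⟨_, hκM⟩
  let _ := setStructure E
  let _ := setReduct K A
  let v₀ : Var ℵ₁ → A := fun _ => Classical.arbitrary A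
  have hwf : WellFounded (memRel K (A := A)) := realize_wfSentence.1 (hT _ (Or.inr rfl))
  let c : K → A := fun k => constVal (K := K) (.elem k)
  have hdiag : ∀ φ : setLang.Formula K, φ.Realize id → φ.Realize c := by
    intro φ hφ
    exact (realize_nameFormula_formula φ v₀).1
      (hT (nameFormula φ) (Or.inl (Or.inl (Or.inl (Or.inl (Or.inl ⟨φ, hφ, rfl⟩))))) v₀)
  have helem : ∀ (n : ℕ) (φ : setLang.Formula (Fin n)) (x : Fin n → K),
      φ.Realize (c ∘ x) ↔ φ.Realize x := by
    intro n φ x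
    have h1 : ∀ φ : setLang.Formula (Fin n), φ.Realize x → φ.Realize (c ∘ x) := fun φ hφ => by
      have := hdiag (φ.relabel x) (by rw [Language.Formula.realize_relabel]; exact hφ)
      rwa [Language.Formula.realize_relabel] at this
    refine ⟨fun hφ => by_contra fun hn => ?_, h1 φ⟩
    exact h1 φ.not hn hφ
  have hKext : (extensionality K).Realize (id : K → K) := by
    rw [realize_extensionality]
    intro a b hab
    refine g.injective (Subtype.ext (ZFSet.ext fun z => ⟨fun hz => ?_, fun hz => ?_⟩))
    · have := (hab (g.symm ⟨z, hM _ (g a).2 hz⟩)).1 (by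
        change (g _ : ZFSet.{u}) ∈ (g a : ZFSet.{u}); simpa using hz)
      change (g _ : ZFSet.{u}) ∈ (g b : ZFSet.{u}) at this
      simpa using this
    · have := (hab (g.symm ⟨z, hM _ (g b).2 hz⟩)).2 (by
        change (g _ : ZFSet.{u}) ∈ (g b : ZFSet.{u}); simpa using hz)
      change (g _ : ZFSet.{u}) ∈ (g a : ZFSet.{u}) at this
      simpa using this
  have hext : ∀ a b : A, (∀ c, memRel K c a ↔ memRel K c b) → a = b :=
    (realize_extensionality c).1 (hdiag _ hKext)
  let π := collapse hwf
  have hπ : ∀ {a b}, π a ∈ π b ↔ memRel K a b := collapse_mem_collapse hwf hext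
  have hπinj : Function.Injective π := collapse_injective hwf hext
  let N := ZFSet.range π
  have hπN : ∀ a, π a ∈ N := fun a => ZFSet.mem_range_self a
  let eM : M ≃[setLang] K :=
    { toEquiv := g.symm
      map_fun' := fun f => Empty.elim f
      map_rel' := fun {n} R xs => by
        cases R
        change (g (g.symm (xs 0)) : ZFSet.{u}) ∈ (g (g.symm (xs 1)) : ZFSet.{u}) ↔ _
        simp only [Equiv.apply_symm_apply]
        rfl }
  let eK : K ↪ₑ[setLang] A := ⟨c, fun n φ x => helem n φ x⟩
  let eN : A ≃[setLang] N :=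
    { toEquiv := Equiv.ofBijective (fun a => (⟨π a, hπN a⟩ : N))
        ⟨fun a b hab => hπinj (congrArg (fun z : N => z.1) hab), fun ⟨z, hz⟩ => by
          obtain ⟨a, rfl⟩ := ZFSet.mem_range.1 hz
          exact ⟨a, rfl⟩⟩
      map_fun' := fun f => Empty.elim f
      map_rel' := fun {n} R xs => by
        cases R
        exact hπ }
  let j : M ↪ₑ[setLang] N :=
    eN.toElementaryEmbedding.comp (eK.comp eM.toElementaryEmbedding)
  have hj : ∀ x : M, (j x : ZFSet.{u}) = π (c (g.symm x)) := fun x => rfl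
  have hcE : ∀ a b, memRel K (c a) (c b) ↔ E a b := fun a b => by
    have := eK.map_rel memSym ![a, b]
    exact this
  -- the elements of the cover are the named elements
  have hcover : ∀ a, memRel K a (constVal (K := K) .cover) ↔ ∃ m, c m = a := by
    intro a
    constructor
    · intro ha
      by_contra! hne
      refine hp ⟨fun _ => a, ?_⟩
      rintro _ (rfl | ⟨m, rfl⟩)
      · rw [varMemCover, realize_memFormula, realize_const]
        exact ha
      · simp only [varNe, InfFormula.Realize, realize_const]
        exact fun h => hne m h.symm
    · rintro ⟨m, rfl⟩
      have := hT (memCover m) (Or.inl (Or.inl (Or.inl (Or.inl (Or.inr ⟨m, rfl⟩))))) v₀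
      rwa [memCover, realize_memFormula, realize_const, realize_const] at this
  have hk₀ : (g k₀ : ZFSet.{u}) = κ.ord.toZFSet := by simp [k₀]
  have hsubset : ∀ b, E b k₀ → ∀ a, memRel K a (c b) → ∃ m, c m = a := by
    intro b hb a ha
    have := hT (subsetCover b) (Or.inl (Or.inl (Or.inl (Or.inr ⟨b, hb, rfl⟩))))
      (fun _ => a) (fun _ => a) fun _ _ => rfl
    rw [realize_impFormula, realize_memFormula, varMemCover, realize_memFormula, realize_const,
      realize_const] at this
    exact (hcover a).1 (this ha)
  have hfix : ∀ b < κ.ord, ∀ h : b.toZFSet ∈ M, π (c (g.symm ⟨_, h⟩)) = b.toZFSet := by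
    intro b
    induction b using WellFoundedLT.induction with
    | ind b ih =>
    intro hb h
    have hbE : E (g.symm ⟨_, h⟩) k₀ := by
      simp only [E, Equiv.apply_symm_apply, hk₀]
      exact Ordinal.toZFSet_mem_toZFSet_iff.2 hb
    ext z
    rw [mem_collapse, Ordinal.mem_toZFSet_iff]
    constructor
    · rintro ⟨a, ha, rfl⟩
      obtain ⟨m, rfl⟩ := hsubset _ hbE a ha
      have hm := (hcE _ _).1 ha
      simp only [E, Equiv.apply_symm_apply] at hm
      obtain ⟨i, hi, him⟩ := Ordinal.mem_toZFSet_iff.1 hm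
      have hiM : i.toZFSet ∈ M := him ▸ (g m).2
      obtain rfl : m = g.symm ⟨_, hiM⟩ := by
        rw [Equiv.eq_symm_apply]; exact Subtype.ext him.symm
      exact ⟨i, hi, (ih i hi (hi.trans hb) hiM).symm⟩
    · rintro ⟨i, hi, rfl⟩
      have hiM : i.toZFSet ∈ M := hM _ h (Ordinal.toZFSet_mem_toZFSet_iff.2 hi)
      refine ⟨_, (hcE _ _).2 ?_, ih i hi (hi.trans hb) hiM⟩
      simp only [E, Equiv.apply_symm_apply]
      exact Ordinal.toZFSet_mem_toZFSet_iff.2 hi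
  refine ⟨N, isTransitive_range_collapse hwf, j, ⟨⟨hκM, fun h => ?_⟩, fun b hb h => ?_⟩,
    π (constVal (K := K) .cover), hπN _, fun y => ?_⟩
  · -- the point is an element of the image of `κ` that differs from all ordinals below `κ`
    have h1 := hT _ (Or.inl (Or.inl (Or.inr rfl))) v₀
    rw [realize_memFormula, realize_const, realize_const] at h1
    have h2 : π (constVal (K := K) .point) ∈ κ.ord.toZFSet := h ▸ hπ.2 h1
    obtain ⟨b, hb, hbp⟩ := Ordinal.mem_toZFSet_iff.1 h2
    have hbM : b.toZFSet ∈ M := hM _ hκM (Ordinal.toZFSet_mem_toZFSet_iff.2 hb)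
    have h3 := hT (pointNe (g.symm ⟨_, hbM⟩)) (Or.inl (Or.inr ⟨_, by
      simp only [Set.mem_ofPred_eq, E, Equiv.apply_symm_apply, hk₀]
      exact Ordinal.toZFSet_mem_toZFSet_iff.2 hb, rfl⟩)) v₀
    simp only [pointNe, InfFormula.Realize, realize_const] at h3
    exact h3 (hπinj (hbp.symm.trans (hfix b hb hbM).symm))
  · exact hfix b hb h
  · rw [mem_collapse]
    constructor
    · rintro ⟨a, ha, rfl⟩
      obtain ⟨m, rfl⟩ := (hcover a).1 ha
      exact ⟨g m, by rw [hj, Equiv.symm_apply_apply]⟩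
    · rintro ⟨x, rfl⟩
      exact ⟨_, (hcover _).2 ⟨_, rfl⟩, (hj x).symm⟩

section

open SetFormula

theorem mk_preimage_elements {M : ZFSet.{u}} {K : Type u} (g : K ≃ M) {Y : ZFSet.{u}}
    (hY : Y ⊆ M) : #{k | (g k : ZFSet.{u}) ∈ Y} = Y.card := by
  rw [← lift_inj.{u, u + 1}, ← ZFSet.cardinalMk_coe_sort, ← lift_id'.{u, u + 1} #Y]
  refine lift_mk_eq'.2 ⟨(Equiv.ofBijective (fun k => ⟨g k.1, k.2⟩) ⟨fun a b h => ?_, fun z => ?_⟩)⟩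
  · exact Subtype.ext (g.injective (Subtype.ext (congrArg (fun z : Y => z.1) h)))
  · exact ⟨⟨g.symm ⟨z.1, hY z.2⟩, by simp⟩, by simp⟩

/-- Well-founded compactness with type omission yields embeddings, by applying it to the covering
theory of an isomorphic copy of `(M, ∈)`. -/
theorem hasEmbedding_of_wellFoundedCompactness {κ lam : Cardinal.{u}} (hκ : κ.IsInaccessible)
    (hle : κ ≤ lam) (h : WellFoundedCompactnessWithTypeOmission κ lam) {M : ZFSet.{u}}
    (hM : M.IsTransitive) (hκM : κ.ord.toZFSet ∈ M) (hcard : M.card = lam)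
    (hcl : SubsetClosed κ M) : HasEmbedding κ M := by
  let K : Type u := Shrink.{u} M
  let g : K ≃ M := (equivShrink M).symm
  have hK : #K = lam := hcard
  have : Infinite K := infinite_iff.2 (by rw [hK]; exact hκ.1.le.trans hle)
  refine hasEmbedding_of_hasModelOmitting hM hκM g ?_
  set E : K → K → Prop := fun a b => (g a : ZFSet.{u}) ∈ (g b : ZFSet.{u})
  set k₀ := g.symm ⟨_, hκM⟩
  have hk₀ : (g k₀ : ZFSet.{u}) = κ.ord.toZFSet := by simp [k₀]
  have hcount : ∀ b, #{m | E m b} = (g b : ZFSet.{u}).card := fun b =>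
    mk_preimage_elements g (hM _ (g b).2)
  have hsm : ∀ b, E b k₀ → #{m | E m b} < κ := by
    intro b hb
    rw [hcount]
    simp only [E, hk₀] at hb
    obtain ⟨i, hi, hib⟩ := Ordinal.mem_toZFSet_iff.1 hb
    rw [← hib, Ordinal.card_toZFSet]
    exact lt_ord.1 hi
  have hpt : κ ≤ #{b | E b k₀} := by
    rw [hcount, hk₀, Ordinal.card_toZFSet, card_ord]
  have hwf : WellFounded E := InvImage.wf (fun a => (g a : ZFSet.{u})) ZFSet.mem_wf
  have hsub : ∀ D : Set K, #D < κ → ∃ d, ∀ m, E m d ↔ m ∈ D := by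
    intro D hD
    let Z : ZFSet.{u} := ZFSet.range fun k : D => (g k : ZFSet.{u})
    have hZ : Z ∈ M := by
      refine hcl Z (fun z hz => ?_) (lt_of_le_of_lt ?_ hD)
      · obtain ⟨k, rfl⟩ := ZFSet.mem_range.1 hz
        exact (g k).2
      · simpa using ZFSet.lift_card_range_le (f := fun k : D => (g k : ZFSet.{u}))
    refine ⟨g.symm ⟨Z, hZ⟩, fun m => ?_⟩
    simp only [E, Equiv.apply_symm_apply, Z, ZFSet.mem_range]
    constructor
    · rintro ⟨k, hk⟩
      exact g.injective (Subtype.ext hk) ▸ k.2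
    · exact fun hm => ⟨⟨m, hm⟩, rfl⟩
  exact h (nameLang K) ((card_nameLang K).trans hK) nameMem _ _ isTheory_coverTheory
    isFirstOrder_coverTheory ⟨_, freeVars_coverType⟩ isFirstOrder_coverType
    ⟨_, isClub_coverClub hκ.isRegular hsm, fun x hx =>
      hasModelOmitting_of_mem_coverClub hκ.isRegular hwf hsub hpt hsm hx⟩

/-! ### Closure under small subsets -/

/-- A subset of size less than `κ` is the range of a sequence of length less than `κ`, hence exists
by separation. -/
theorem IsTransitiveModelZFCMinus.subsetClosed {κ : Cardinal.{u}} {M : ZFSet.{u}}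
    (hM : IsTransitiveModelZFCMinus M) (hcl : SeqClosed κ M) : SubsetClosed κ M := by
  intro x hx hxκ
  obtain ⟨e, he, hex⟩ := exists_enumeration x
  let f := seqGraph x.card.ord e
  have hf : f ∈ M := hcl _ (ord_lt_ord.2 hxκ) _ (isFunc_seqGraph fun i hi => hx (he i hi))
  let φ : SetFormula := ex 2 (pairMem 2 0 1)
  let D : Set M := {y | Sat (M : Set ZFSet.{u}) φ fun i => if i = 0 then y else f}
  have hD : (Set.univ : Set M).Definable₁ setLang D := by
    rw [Set.Definable₁, Set.definable_iff_exists_formula_sum]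
    refine ⟨φ.toFormula.relabel fun i => if i = 0 then .inr 0 else .inl ⟨⟨f, hf⟩, trivial⟩, ?_⟩
    ext v
    simp only [Set.mem_ofPred_eq, Language.Formula.realize_relabel]
    rw [realize_toFormula_set]
    change Sat _ φ _ ↔ Sat _ φ _
    refine iff_of_eq (congrArg _ (funext fun i => ?_))
    by_cases hi : i = 0 <;> simp [hi]
  have hmem : ∀ y : M, y ∈ D ↔ (y : ZFSet.{u}) ∈ x := by
    intro y
    change Sat (M : Set ZFSet.{u}) (ex 2 (pairMem 2 0 1)) _ ↔ _
    rw [sat_ex]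
    have : ∀ z ∈ (M : Set ZFSet.{u}), Sat (M : Set ZFSet.{u}) (pairMem 2 0 1)
        (Function.update (fun i => if i = 0 then (y : ZFSet.{u}) else f) 2 z) ↔
          ZFSet.pair z y ∈ f := by
      intro z hz
      rw [sat_pairMem hM.transitive (by omega) (by omega) (by omega) (by simpa using hf)]
      simp
    constructor
    · rintro ⟨z, hz, h⟩
      obtain ⟨i, hi, hp⟩ := mem_seqGraph.1 ((this z hz).1 h)
      exact (ZFSet.pair_inj.1 hp).2 ▸ he i hi
    · intro hy
      obtain ⟨i, hi, hiy⟩ := hex y hy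
      have hp : ZFSet.pair i.toZFSet y ∈ f := mem_seqGraph.2 ⟨i, hi, by rw [hiy]⟩
      have hiM := (pair_components_mem (M := (M : Set ZFSet.{u})) hM.transitive
        (hM.transitive _ hf hp)).1
      exact ⟨_, hiM, (this _ hiM).2 hp⟩
  obtain ⟨b, hb⟩ := hM.separation D hD ⟨_, hM.union _ (hM.union _ hf)⟩
  have hbx : b.1 = x := by
    ext y
    constructor
    · intro hy
      have hyM := hM.transitive _ b.2 hy
      exact (hmem ⟨y, hyM⟩).1 ((hb ⟨y, hyM⟩).1 hy).2
    · intro hy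
      refine (hb ⟨y, hx hy⟩).2 ⟨?_, (hmem ⟨y, hx hy⟩).2 hy⟩
      obtain ⟨i, hi, hiy⟩ := hex y hy
      refine ZFSet.mem_sUnion.2 ⟨{i.toZFSet, y}, ZFSet.mem_sUnion.2
        ⟨ZFSet.pair i.toZFSet y, mem_seqGraph.2 ⟨i, hi, by rw [hiy]⟩, ?_⟩, by simp⟩
      rw [ZFSet.pair]; simp
  exact hbx ▸ b.2

end

end TypeOmission

theorem mainTheorem1 (κ lam : Cardinal.{u}) (hκ : κ.IsInaccessible) (hle : κ ≤ lam)
    (hlam : lam = lam ^< κ) :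
    List.TFAE [
      -- transitive models of `ZFC⁻`, closed under sequences of length less than `κ`
      ∀ M : ZFSet.{u}, TypeOmission.IsTransitiveModelZFCMinus M → κ.ord.toZFSet ∈ M →
        M.card = lam → TypeOmission.SeqClosed κ M → TypeOmission.HasEmbedding κ M,
      -- arbitrary transitive sets, closed under subsets of size less than `κ`
      ∀ M : ZFSet.{u}, M.IsTransitive → κ.ord.toZFSet ∈ M →
        M.card = lam → TypeOmission.SubsetClosed κ M → TypeOmission.HasEmbedding κ M,
      TypeOmission.CompactnessWithTypeOmission κ κ lam,
      TypeOmission.CompactnessWithTypeOmission κ ℵ₁ lam,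
      TypeOmission.WellFoundedCompactnessWithTypeOmission κ lam] := by
  have hℵ₁ : ℵ₁ ≤ κ := by
    rw [← succ_aleph0]
    exact Order.succ_le_of_lt hκ.1
  tfae_have 1 → 3 := fun h => TypeOmission.compactness_of_guessing hκ hle hlam
    (TypeOmission.guessing_of_hasEmbedding hκ hle hlam h)
  tfae_have 3 → 4 := fun h => h.mono hℵ₁
  tfae_have 4 → 5 := fun h => h.wellFounded
  tfae_have 5 → 2 := fun h M hM hκM hcard hcl =>
    TypeOmission.hasEmbedding_of_wellFoundedCompactness hκ hle h hM hκM hcard hcl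
  tfae_have 2 → 1 := fun h M hM hκM hcard hcl =>
    h M hM.transitive hκM hcard (hM.subsetClosed hcl)
  tfae_finish
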